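/- Let $H\subseteq GL_M(\mathbb C)$ be a connected complex reductive group (a Zariski closed, connected subgroup with trivial unipotent radical). Let $S$ be a simply connected complex Lie group with semisimple Lie algebra, let $G=(\mathbb C^*)^k\times S$ and $\tilde G=\mathbb C^k\times S$, the latter covering $G$ by the exponential map on the first $k$ factors (with kernel $2\pi i\,\mathbb Z^k$). Let $V$ be a finite-dimensional holomorphic linear representation of $G$ such that some one-parameter subgroup $\mathbb C^*\to(\mathbb C^*)^k$, $z\mapsto(z^{a_1},\dots,z^{a_k})$ with $a_i\in\mathbb Z$, acts on $V$ with only positive weights. Let $F:\tilde G\to H$ be a holomorphic homomorphism with semisimple monodromy, i.e. $F(2\pi i n,1)$ is semisimple for every $n\in\mathbb Z^k$, and let $S_i=dF(e_i)$, where $e_1,\dots,e_k$ is the standard basis of $\mathbb C^k$. Let $\mathrm{Aut}(F)\subseteq H$ be the centralizer of $F(\tilde G)$, and let $\mathrm{Aut}(p^*F)$ be the group, under pointwise product, of holomorphic maps $h:V\to H$ with $h(gv)F(g)=F(g)h(v)$ for all $g\in\tilde G$, $v\in V$. Put $\mathrm{Aut}_0=\{h\in\mathrm{Aut}(p^*F):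 h(0)=1\}$. Then the $S_i$ are pairwise commuting and semisimple, $\mathrm{Aut}(F)=\bigcap_i C_H(S_i)\cap C_H(F(S))$, and $\mathrm{Aut}(F)$ is a Zariski closed, (possibly disconnected) reductive subgroup of $H$. Moreover $\mathrm{Aut}(p^*F)$ is an affine algebraic group, whose coordinate ring is generated by the functions $h\mapsto q(h(v))$ with $v\in V$ and $q$ a regular function on $H$; the sequence $$1\to \mathrm{Aut}_0\to\mathrm{Aut}(p^*F)\xrightarrow{\,h\mapsto h(0)\,}\mathrm{Aut}(F)\to 1$$ is exact and split by the inclusion of constant maps, both maps being algebraic; and $\mathrm{Aut}(p^*F)=\mathrm{Aut}_0\rtimes\mathrm{Aut}(F)$ is a Levi decomposition: $\mathrm{Aut}_0$ is the unipotent radical of $\mathrm{Aut}(p^*F)$ (in particular it is unipotent), and the constant maps $\mathrm{Aut}(F)$ form a closed reductive complement. -/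

import Mathlib

open scoped Manifold ContDiff Topology

noncomputable section

/-! ## Affine algebraic groups over `ℂ`, through their algebras of regular functions -/

namespace AlgGroup

variable {A : Type*} [Group A]

/-- `O` is the coordinate ring of a structure of affine algebraic group over `ℂ` on `A`:
it is a finitely generated (automatically reduced) algebra of functions on `A`, the points of `A`
are exactly the `ℂ`-points of `O`, and multiplication and inversion are regular. -/
structure IsAffineAlgebraicGroup (O : Subalgebra ℂ (A → ℂ)) : Prop where
  fg : O.FG
  bijective_eval : Function.Bijective
    (fun x : A => ((Pi.evalAlgHom ℂ (fun _ : A => ℂ) x).comp O.val : O →ₐ[ℂ] ℂ))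
  mul_regular : ∀ f ∈ O, (fun p : A × A => f (p.1 * p.2)) ∈
    Algebra.adjoin ℂ {u : A × A → ℂ | ∃ q ∈ O, u = (fun p => q p.1) ∨ u = (fun p => q p.2)}
  inv_regular : ∀ f ∈ O, (fun x : A => f x⁻¹) ∈ O

/-- The Zariski topology: the sets `{f ≠ 0}`, `f` regular, form a basis. -/
@[reducible] def zariski (O : Subalgebra ℂ (A → ℂ)) : TopologicalSpace A :=
  TopologicalSpace.generateFrom {U : Set A | ∃ f ∈ O, U = {x | f x ≠ 0}}

/-- The algebra of restrictions to a subgroup `K` of the regular functions. -/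
def restrict (O : Subalgebra ℂ (A → ℂ)) (K : Subgroup A) : Subalgebra ℂ (K → ℂ) :=
  O.map (AlgHom.pi (fun x : K => Pi.evalAlgHom ℂ (fun _ : A => ℂ) (x : A)))

/-- Right translation of functions, `(R_g f)(x) = f (x g)`. -/
def rightTranslation (g : A) : Module.End ℂ (A → ℂ) :=
  LinearMap.funLeft ℂ ℂ (fun x : A => x * g)

/-- `g` is unipotent: right translation by `g` is locally unipotent on regular functions. -/
def IsUnipotentElement (O : Subalgebra ℂ (A → ℂ)) (g : A) : Prop :=
  ∀ f ∈ O, ∃ n : ℕ, ((rightTranslation g - 1) ^ n) f = 0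

/-- `N` is a Zariski closed, Zariski connected, normal subgroup with unipotent elements. -/
structure IsConnectedNormalUnipotent (O : Subalgebra ℂ (A → ℂ)) (N : Subgroup A) : Prop where
  closed : IsClosed[zariski O] (N : Set A)
  connected : @IsConnected A (zariski O) (N : Set A)
  normal : N.Normal
  unipotent : ∀ g ∈ N, IsUnipotentElement O g

/-- `U` is the unipotent radical: the largest connected normal unipotent closed subgroup. -/
structure IsUnipotentRadical (O : Subalgebra ℂ (A → ℂ)) (U : Subgroup A) : Prop where
  isConnectedNormalUnipotent : IsConnectedNormalUnipotent O U
  le_of_isConnectedNormalUnipotent : ∀ N : Subgroup A, IsConnectedNormalUnipotent O N → N ≤ U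

/-- A (possibly disconnected) reductive group: an affine algebraic group with trivial unipotent
radical. -/
structure IsReductive (O : Subalgebra ℂ (A → ℂ)) : Prop where
  isAffineAlgebraicGroup : IsAffineAlgebraicGroup O
  isUnipotentRadical_bot : IsUnipotentRadical O ⊥

/-- Levi decomposition `A = U ⋊ L` of an affine algebraic group: `U` is the unipotent radical and
`L` is a closed reductive subgroup which is a complement of `U`. -/
structure IsLeviDecomposition (O : Subalgebra ℂ (A → ℂ)) (U L : Subgroup A) : Prop where
  isAffineAlgebraicGroup : IsAffineAlgebraicGroup O
  isUnipotentRadical : IsUnipotentRadical O U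
  closed_levi : IsClosed[zariski O] (L : Set A)
  reductive_levi : IsReductive (restrict O L)
  isComplement : Subgroup.IsComplement' U L

/-- A homomorphism is algebraic if it pulls regular functions back to regular functions. -/
def IsAlgebraicHom {B : Type*} [Group B] (OA : Subalgebra ℂ (A → ℂ)) (OB : Subalgebra ℂ (B → ℂ))
    (f : A →* B) : Prop :=
  ∀ q ∈ OB, (fun x : A => q (f x)) ∈ OA

/-- The coordinate ring of `GL_M(ℂ)`, generated by the entries of `g` and of `g⁻¹`. -/
def glRing (M : ℕ) : Subalgebra ℂ (Matrix.GeneralLinearGroup (Fin M) ℂ → ℂ) :=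
  Algebra.adjoin ℂ {f | ∃ i j : Fin M,
    f = (fun g : Matrix.GeneralLinearGroup (Fin M) ℂ => (g : Matrix (Fin M) (Fin M) ℂ) i j) ∨
    f = (fun g : Matrix.GeneralLinearGroup (Fin M) ℂ =>
      ((g⁻¹ : Matrix.GeneralLinearGroup (Fin M) ℂ) : Matrix (Fin M) (Fin M) ℂ) i j)}

end AlgGroup

open AlgGroup

/-! ## Representations of `G̃ ⋉ V` and their automorphisms -/

namespace HomogeneousRep

/-- The matrix of an element of a subgroup of `GL_M(ℂ)`. -/
def mat {M : ℕ} {H : Subgroup (Matrix.GeneralLinearGroup (Fin M) ℂ)} (x : H) :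
    Matrix (Fin M) (Fin M) ℂ :=
  ((x : Matrix.GeneralLinearGroup (Fin M) ℂ) : Matrix (Fin M) (Fin M) ℂ)

/-- The group `G̃ = ℂ^k × S`. -/
abbrev Gtilde (k : ℕ) (S : Type*) : Type _ := Multiplicative (Fin k → ℂ) × S

/-- The covering `G̃ = ℂ^k × S → G = (ℂ^*)^k × S`, exponential in each of the first `k` factors. -/
def cover (k : ℕ) (S : Type*) [Group S] : Gtilde k S →* (Fin k → ℂˣ) × S where
  toFun g := (fun i => Units.mk0 (Complex.exp (g.1.toAdd i)) (Complex.exp_ne_zero _), g.2)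
  map_one' := by
    ext i <;> simp
  map_mul' g g' := by
    ext i <;> simp [Complex.exp_add]

/-- A map from `G̃ = ℂ^k × S`, with `S` a complex manifold of dimension `d`, to a complex
vector space is holomorphic. -/
def HolomorphicOnGtilde {k d : ℕ} {S : Type*} [TopologicalSpace S] [ChartedSpace (Fin d → ℂ) S]
    {W : Type*} [NormedAddCommGroup W] [NormedSpace ℂ W] (f : Gtilde k S → W) : Prop :=
  ContMDiff (𝓘(ℂ, Fin k → ℂ).prod 𝓘(ℂ, Fin d → ℂ)) 𝓘(ℂ, W) ω
    (fun p : (Fin k → ℂ) × S => f (Multiplicative.ofAdd p.1, p.2))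

/-- The weight space, of weight `n`, of the one-parameter subgroup `z ↦ (z^{a_1}, …, z^{a_k})` of
`(ℂ^*)^k` acting on `V`. -/
def weightSpace {k : ℕ} {S : Type*} [Group S] {V : Type*} [AddCommGroup V] [Module ℂ V]
    (ρ : Representation ℂ ((Fin k → ℂˣ) × S) V) (a : Fin k → ℤ) (n : ℤ) : Submodule ℂ V where
  carrier := {v | ∀ z : ℂˣ, ρ (fun i => z ^ a i, 1) v = ((z ^ n : ℂˣ) : ℂ) • v}
  add_mem' hv hw z := by rw [map_add, hv z, hw z, smul_add]
  zero_mem' z := by simp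
  smul_mem' c v hv z := by rw [map_smul, hv z, smul_comm]

/-- Some one-parameter subgroup `ℂ^* → (ℂ^*)^k` acts on `V` with positive weights only. -/
def IsPositive {k : ℕ} {S : Type*} [Group S] {V : Type*} [AddCommGroup V] [Module ℂ V]
    (ρ : Representation ℂ ((Fin k → ℂˣ) × S) V) : Prop :=
  ∃ a : Fin k → ℤ, ⨆ n : {n : ℤ // 0 < n}, weightSpace ρ a n = ⊤

section

variable {k M : ℕ} {S : Type*} [Group S] {H : Subgroup (Matrix.GeneralLinearGroup (Fin M) ℂ)}

/-- The monodromy of `F : G̃ → H` (equivalently, the constant monodromy of `p^*F`): the values of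
`F` on the kernel `2πi ℤ^k` of the exponential `ℂ^k → (ℂ^*)^k`. -/
def monodromy (F : Gtilde k S →* H) (n : Fin k → ℤ) : H :=
  F (Multiplicative.ofAdd (fun i => 2 * (Real.pi : ℂ) * Complex.I * (n i : ℂ)), 1)

/-- The matrix `S_i = dF(e_i)`. -/
def residue (F : Gtilde k S →* H) (i : Fin k) : Matrix (Fin M) (Fin M) ℂ :=
  Matrix.of fun a b =>
    deriv (fun t : ℂ => mat (F (Multiplicative.ofAdd (Pi.single i t : Fin k → ℂ), 1)) a b) 0

/-- `Aut(F)`, the centralizer in `H` of the image of `F`. -/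
def AutF (F : Gtilde k S →* H) : Subgroup H := Subgroup.centralizer (Set.range F)

variable {V : Type*} [NormedAddCommGroup V] [NormedSpace ℂ V]

/-- A map `V → H ⊆ GL_M(ℂ)` is holomorphic. -/
def IsHolomorphic (h : V → H) : Prop :=
  ∀ i j : Fin M, ContDiff ℂ ω (fun v => mat (h v) i j)

/-- The pullback `p^*F : G̃ ⋉ V → H` of `F` by the projection `p : G̃ ⋉ V → G̃`. -/
def pullback (V : Type*) (F : Gtilde k S →* H) : Gtilde k S × V → H := fun x => F x.1

theorem isHolomorphic_one : IsHolomorphic (fun _ : V => (1 : H)) :=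
  fun _ _ => contDiff_const

theorem IsHolomorphic.mul {h h' : V → H} (hh : IsHolomorphic h) (hh' : IsHolomorphic h') :
    IsHolomorphic (fun v => h v * h' v) := by
  intro i j
  simp only [mat, Subgroup.coe_mul, Units.val_mul, Matrix.mul_apply]
  exact ContDiff.sum fun l _ => (hh i l).mul (hh' l j)

theorem contDiff_det {n : ℕ} {X : V → Matrix (Fin n) (Fin n) ℂ}
    (hX : ∀ i j, ContDiff ℂ ω (fun v => X v i j)) : ContDiff ℂ ω (fun v => (X v).det) := by
  simp only [Matrix.det_apply']
  exact ContDiff.sum fun σ _ => contDiff_const.mul (contDiff_prod fun i _ => hX (σ i) i)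

theorem IsHolomorphic.inv {h : V → H} (hh : IsHolomorphic h) :
    IsHolomorphic (fun v => (h v)⁻¹) := by
  intro i j
  have hne : ∀ v, (mat (h v)).det ≠ 0 := fun v =>
    ((Matrix.isUnit_iff_isUnit_det _).mp (Units.isUnit _)).ne_zero
  have key : (fun v => mat ((h v)⁻¹) i j) =
      fun v => ((mat (h v)).det)⁻¹ * ((mat (h v)).updateRow j (Pi.single i 1)).det := by
    funext v
    have : mat ((h v)⁻¹) = (mat (h v))⁻¹ := by
      simp [mat, Matrix.coe_units_inv]
    rw [this, Matrix.inv_def, Matrix.smul_apply, Ring.inverse_eq_inv', smul_eq_mul,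
      Matrix.adjugate_apply]
  rw [key]
  refine ((contDiff_det hh).inv hne).mul (contDiff_det fun a b => ?_)
  by_cases hab : a = j
  · subst hab
    simpa using contDiff_const
  · simpa [Matrix.updateRow_ne hab] using hh a b

/-- The automorphism group of a representation `φ : G̃ ⋉ V → H` (on the trivial bundle): the
holomorphic maps `h : V → H` with `h(g v) φ(g, v) = φ(g, v) h(v)`, under pointwise product. -/
def Aut (ρ : Representation ℂ ((Fin k → ℂˣ) × S) V) (φ : Gtilde k S × V → H) :
    Subgroup (V → H) where
  carrier := {h | IsHolomorphic h ∧
    ∀ (g : Gtilde k S) (v : V), h (ρ (cover k S g) v) * φ (g, v) = φ (g, v) * h v}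
  one_mem' := ⟨isHolomorphic_one, fun g v => by simp⟩
  mul_mem' := by
    rintro h h' ⟨hh, he⟩ ⟨hh', he'⟩
    refine ⟨hh.mul hh', fun g v => ?_⟩
    simp only [Pi.mul_apply]
    rw [mul_assoc, he', ← mul_assoc, he, mul_assoc]
  inv_mem' := by
    rintro h ⟨hh, he⟩
    refine ⟨hh.inv, fun g v => ?_⟩
    simp only [Pi.inv_apply]
    rw [inv_mul_eq_iff_eq_mul, ← mul_assoc, he, mul_assoc, mul_inv_cancel, mul_one]

/-- The coordinate ring of `Aut(φ)`, generated by the functions `h ↦ q (h v)` for `v ∈ V` and `q`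
a regular function on `H`. When the elements of `Aut(φ)` are polynomial maps of bounded degree,
these are the polynomial functions in the coefficients of `h` and `h⁻¹`. -/
def autRing (ρ : Representation ℂ ((Fin k → ℂˣ) × S) V) (φ : Gtilde k S × V → H) :
    Subalgebra ℂ (Aut ρ φ → ℂ) :=
  Algebra.adjoin ℂ {f | ∃ v : V, ∃ q ∈ restrict (glRing M) H,
    f = fun h : Aut ρ φ => q ((h : V → H) v)}

/-- The homomorphism `ι^* : Aut(p^*F) → Aut(F)`, `h ↦ h(0)`. -/
def evalZero (ρ : Representation ℂ ((Fin k → ℂˣ) × S) V) (F : Gtilde k S →* H) :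
    Aut ρ (pullback V F) →* AutF F where
  toFun h := ⟨(h : V → H) 0, by
    rw [AutF, Subgroup.mem_centralizer_iff]
    rintro _ ⟨g, rfl⟩
    simpa [pullback] using (h.2.2 g 0).symm⟩
  map_one' := rfl
  map_mul' _ _ := rfl

/-- The homomorphism `p^* : Aut(F) → Aut(p^*F)`, sending an element to the constant map. -/
def constant (ρ : Representation ℂ ((Fin k → ℂˣ) × S) V) (F : Gtilde k S →* H) :
    AutF F →* Aut ρ (pullback V F) where
  toFun x := ⟨fun _ => x, fun _ _ => contDiff_const, fun g _ =>
    ((Subgroup.mem_centralizer_iff.mp x.2) (F g) ⟨g, rfl⟩).symm⟩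
  map_one' := rfl
  map_mul' _ _ := rfl

/-- `Aut_0(p^*F)`, the subgroup of the automorphisms `h` of `p^*F` with `h(0) = 1`. -/
def Aut₀ (ρ : Representation ℂ ((Fin k → ℂˣ) × S) V) (F : Gtilde k S →* H) :
    Subgroup (Aut ρ (pullback V F)) :=
  (evalZero ρ F).ker

end

end HomogeneousRep

end

open AlgGroup HomogeneousRep

section

/-! ### The Zariski topology and linear groups -/

namespace AlgGroup

/-! Reductivity of `Aut(F)` is proved through the trace form `(x, y) ↦ tr(xy)`: a closed linear
group is reductive exactly when this form is nondegenerate on its Lie algebra. If the form is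
nondegenerate, a closed normal unipotent subgroup has for Lie algebra an ideal of nilpotent
matrices. By Engel's theorem the ideal lowers a flag that the whole Lie algebra preserves, so it is
trace-orthogonal to everything and vanishes (`isReductive_of_trace_nondegenerate`). Conversely, by
Jordan decomposition and Chevalley's replicas, the radical of the form consists of nilpotent
matrices. It exponentiates into a closed normal unipotent subgroup, which is trivial when the group
is reductive (`trace_nondegenerate_of_isReductive`).

The Lie algebra of `Aut(F)` is the part of `Lie(H)` commuting with the `S_i` and with `F(S)`. For
`x` in it, the functional `tr(x ·)` on `Lie(H)` is killed by each `ad S_i` and by the Lie algebra of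
`S`. Such a functional is determined by its values on invariants: for the `S_i` because they are
commuting and semisimple (`eq_zero_of_commutant_family`), for `S` by complete reducibility, proved
with Casimir operators (`exists_invariant_of_invariant_functional`, `eq_zero_of_invariants`). So
nondegeneracy descends from `H` to `Aut(F)` (`trace_nondegenerate_autFImage`). The `S_i` are
semisimple because `exp(2πi S_i)` is a monodromy matrix and a nontrivial nilpotent part would
survive exponentiation.

On the side of `Aut(p^*F)`, the positive one-parameter subgroup contracts `V` to `0`. An equivariant
matrix valued map is determined by a jet of bounded order at `0`, since conjugation by `F` grows at
most geometrically while a high order zero decays faster (`finiteDimensional_of_contracting`).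
Finite generation and the identification of points with characters follow
(`isAffineAlgebraicGroup_autRing`). The characteristic polynomial of `h(v)` is constant along the
contraction, so `h(0) = 1` forces every `h(v)` to be unipotent (`isNilpotent_of_mem_Aut₀`);
rescaling the argument joins `h` to `1`. A connected normal unipotent subgroup maps into the trivial
unipotent radical of `Aut(F)`, hence lies in `Aut_0` (`isUnipotentRadical_Aut₀`). -/

theorem isClosed_zariski_iff {A : Type*} (O : Subalgebra ℂ (A → ℂ)) (C : Set A) :
    IsClosed[zariski O] C ↔ ∀ x ∉ C, ∃ f ∈ O, f x ≠ 0 ∧ ∀ y ∈ C, f y = 0 := by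
  let _ := zariski O
  have hb : TopologicalSpace.IsTopologicalBasis {U : Set A | ∃ f ∈ O, U = {x | f x ≠ 0}} := by
    refine ⟨?_, ?_, rfl⟩
    · rintro _ ⟨f, hf, rfl⟩ _ ⟨g, hg, rfl⟩ x ⟨hx, hx'⟩
      refine ⟨{x | (f * g) x ≠ 0}, ⟨_, O.mul_mem hf hg, rfl⟩, ?_, ?_⟩
      · exact mul_ne_zero hx hx'
      · intro y hy
        exact ⟨left_ne_zero_of_mul hy, right_ne_zero_of_mul hy⟩
    · refine Set.eq_univ_of_forall fun x => ⟨{x | (1 : A → ℂ) x ≠ 0}, ⟨1, O.one_mem, rfl⟩, ?_⟩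
      simp
  rw [← isOpen_compl_iff, hb.isOpen_iff]
  constructor
  · intro h x hx
    obtain ⟨_, ⟨f, hf, rfl⟩, hfx, hsub⟩ := h x hx
    refine ⟨f, hf, hfx, fun y hy => ?_⟩
    by_contra hne
    exact hsub hne hy
  · intro h x hx
    obtain ⟨f, hf, hfx, h0⟩ := h x hx
    exact ⟨_, ⟨f, hf, rfl⟩, hfx, fun y hy hyC => hy (h0 y hyC)⟩

theorem isClosed_zariski_of_forall {A : Type*} {ι : Sort*} (O : Subalgebra ℂ (A → ℂ)) (C : Set A)
    (f : ι → A → ℂ) (hf : ∀ i, f i ∈ O) (hC : ∀ x, x ∈ C ↔ ∀ i, f i x = 0) :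
    IsClosed[zariski O] C := by
  rw [isClosed_zariski_iff]
  intro x hx
  rw [hC] at hx
  push Not at hx
  obtain ⟨i, hi⟩ := hx
  exact ⟨f i, hf i, hi, fun y hy => (hC y).1 hy i⟩

theorem continuous_zariski {A X : Type*} [TopologicalSpace X] (O : Subalgebra ℂ (A → ℂ)) (φ : X → A)
    (h : ∀ f ∈ O, Continuous fun x => f (φ x)) : @Continuous X A _ (zariski O) φ := by
  refine continuous_generateFrom_iff.2 ?_
  rintro _ ⟨f, hf, rfl⟩
  exact isOpen_ne_fun (h f hf) continuous_const

variable {A B : Type*} [Group A] [Group B]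

theorem IsAlgebraicHom.continuous {OA : Subalgebra ℂ (A → ℂ)} {OB : Subalgebra ℂ (B → ℂ)}
    {f : A →* B} (h : IsAlgebraicHom OA OB f) : @Continuous A B (zariski OA) (zariski OB) f := by
  let _ := zariski OA
  refine continuous_generateFrom_iff.2 ?_
  rintro _ ⟨q, hq, rfl⟩
  exact TopologicalSpace.isOpen_generateFrom_of_mem ⟨_, h q hq, rfl⟩

/-- A set joined to one of its points by images of connected spaces is connected. -/
theorem isConnected_zariski_of_paths (O : Subalgebra ℂ (A → ℂ)) (N : Subgroup A)
    (h : ∀ x ∈ N, ∃ γ : ℂ → A, (∀ t, γ t ∈ N) ∧ γ 0 = 1 ∧ γ 1 = x ∧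
      ∀ f ∈ O, Continuous fun t => f (γ t)) : @IsConnected A (zariski O) (N : Set A) := by
  let _ := zariski O
  refine ⟨⟨1, N.one_mem⟩, isPreconnected_of_forall 1 fun x hx => ?_⟩
  obtain ⟨γ, hγ, h0, h1, hc⟩ := h x hx
  refine ⟨Set.range γ, ?_, ⟨0, h0⟩, ⟨1, h1⟩, ?_⟩
  · rintro _ ⟨t, rfl⟩
    exact hγ t
  · exact isPreconnected_range (continuous_zariski O γ hc)

/-- Right translation is multiplicative, so its difference with the identity satisfies a Leibniz
rule with one extra product term. -/
theorem rightTranslation_sub_one_mul (g : A) (f f' : A → ℂ) :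
    (rightTranslation g - 1) (f * f') = (rightTranslation g - 1) f * f' +
      f * (rightTranslation g - 1) f' +
      (rightTranslation g - 1) f * (rightTranslation g - 1) f' := by
  ext x
  simp [rightTranslation, LinearMap.funLeft]
  ring

/-- Each of the three terms of the twisted Leibniz rule lowers the sum of the two nilpotency
exponents by at least one, whence induction on a bound for that sum. -/
theorem rightTranslation_locally_unipotent_mul (g : A) (n : ℕ) : ∀ (m k : ℕ), m + k ≤ n →
    ∀ f f' : A → ℂ, ((rightTranslation g - 1) ^ m) f = 0 → ((rightTranslation g - 1) ^ k) f' = 0 →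
    ((rightTranslation g - 1) ^ n) (f * f') = 0 := by
  induction n with
  | zero =>
    intro m k hmk f f' hf hf'
    obtain rfl : m = 0 := by omega
    have : f = 0 := by simpa using hf
    simp [this]
  | succ n ih =>
    intro m k hmk f f' hf hf'
    rcases m with _ | m
    · have : f = 0 := by simpa using hf
      simp [this]
    rcases k with _ | k
    · have : f' = 0 := by simpa using hf'
      simp [this]
    rw [pow_succ, Module.End.mul_apply, rightTranslation_sub_one_mul, map_add, map_add]
    rw [pow_succ, Module.End.mul_apply] at hf hf'
    have hf2 : ((rightTranslation g - 1) ^ (m + 1)) f = 0 := by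
      rw [pow_succ, Module.End.mul_apply, hf]
    have hf2' : ((rightTranslation g - 1) ^ (k + 1)) f' = 0 := by
      rw [pow_succ, Module.End.mul_apply, hf']
    rw [ih m (k + 1) (by omega) _ _ hf hf2', ih (m + 1) k (by omega) _ _ hf2 hf',
      ih m k (by omega) _ _ hf hf']
    simp

/-- The functions on which right translation by `g` is locally unipotent form a subalgebra. -/
theorem isUnipotentElement_adjoin (s : Set (A → ℂ)) (g : A)
    (h : ∀ f ∈ s, ∃ n : ℕ, ((rightTranslation g - 1) ^ n) f = 0) :
    IsUnipotentElement (Algebra.adjoin ℂ s) g := by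
  intro f hf
  have mono : ∀ {f : A → ℂ} {n m : ℕ}, n ≤ m → ((rightTranslation g - 1) ^ n) f = 0 →
      ((rightTranslation g - 1) ^ m) f = 0 := by
    intro f n m hnm hf
    obtain ⟨k, rfl⟩ := Nat.exists_eq_add_of_le hnm
    rw [add_comm, pow_add, Module.End.mul_apply, hf, map_zero]
  induction hf using Algebra.adjoin_induction with
  | mem f hf => exact h f hf
  | algebraMap r =>
    refine ⟨1, ?_⟩
    ext x
    simp [rightTranslation, LinearMap.funLeft]
  | add f f' _ _ ih ih' =>
    obtain ⟨n, hn⟩ := ih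
    obtain ⟨m, hm⟩ := ih'
    refine ⟨max n m, ?_⟩
    rw [map_add, mono (le_max_left _ _) hn, mono (le_max_right _ _) hm, add_zero]
  | mul f f' _ _ ih ih' =>
    obtain ⟨n, hn⟩ := ih
    obtain ⟨m, hm⟩ := ih'
    exact ⟨n + m, rightTranslation_locally_unipotent_mul g _ n m le_rfl f f' hn hm⟩

theorem rightTranslation_pow_comp (φ : A →* B) (g : A) (f : B → ℂ) (n : ℕ) :
    ((rightTranslation g - 1) ^ n) (fun x => f (φ x)) =
      fun x => ((rightTranslation (φ g) - 1) ^ n) f (φ x) := by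
  induction n generalizing f with
  | zero => simp
  | succ n ih =>
    rw [pow_succ, pow_succ, Module.End.mul_apply, Module.End.mul_apply, ← ih]
    congr 1
    ext x
    simp [rightTranslation, LinearMap.funLeft]

theorem IsUnipotentElement.map {OA : Subalgebra ℂ (A → ℂ)} {OB : Subalgebra ℂ (B → ℂ)}
    {φ : A →* B} (h : IsAlgebraicHom OA OB φ) {g : A} (hg : IsUnipotentElement OA g)
    (hφ : Function.Surjective φ) : IsUnipotentElement OB (φ g) := by
  intro f hf
  obtain ⟨n, hn⟩ := hg _ (h f hf)
  refine ⟨n, ?_⟩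
  rw [rightTranslation_pow_comp] at hn
  ext y
  obtain ⟨x, rfl⟩ := hφ y
  exact congrFun hn x

/-- Regularity of multiplication puts `f (x y)` in the algebra generated by functions of one
variable; it remains to specialise `y` to `g`. -/
theorem IsAffineAlgebraicGroup.right_mul_mem {O : Subalgebra ℂ (A → ℂ)}
    (hO : IsAffineAlgebraicGroup O) {f : A → ℂ} (hf : f ∈ O) (g : A) :
    (fun x => f (x * g)) ∈ O := by
  have key : ∀ u ∈ Algebra.adjoin ℂ {u : A × A → ℂ | ∃ q ∈ O, u = (fun p => q p.1) ∨
      u = (fun p => q p.2)}, (fun x => u (x, g)) ∈ O := by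
    intro u hu
    induction hu using Algebra.adjoin_induction with
    | mem u hu =>
      obtain ⟨q, hq, rfl | rfl⟩ := hu
      · exact hq
      · exact O.algebraMap_mem (q g)
    | algebraMap r => exact O.algebraMap_mem r
    | add _ _ _ _ h h' => exact O.add_mem h h'
    | mul _ _ _ _ h h' => exact O.mul_mem h h'
  exact key _ (hO.mul_regular f hf)

theorem IsAffineAlgebraicGroup.left_mul_mem {O : Subalgebra ℂ (A → ℂ)}
    (hO : IsAffineAlgebraicGroup O) {f : A → ℂ} (hf : f ∈ O) (g : A) :
    (fun x => f (g * x)) ∈ O := by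
  have := hO.inv_regular _ (hO.right_mul_mem (hO.inv_regular f hf) g⁻¹)
  simpa [mul_inv_rev] using this

/-- The Zariski closure of a subgroup. -/
def closureSubgroup {O : Subalgebra ℂ (A → ℂ)} (hO : IsAffineAlgebraicGroup O) (N : Subgroup A) :
    Subgroup A where
  carrier := {x | ∀ f ∈ O, (∀ y ∈ N, f y = 0) → f x = 0}
  one_mem' := fun f _ h => h 1 N.one_mem
  mul_mem' := by
    intro x y hx hy f hf h
    -- Two passes: for `z ∈ N` the right translate by `z` vanishes on `N`, hence at `x`; so the left
    -- translate by `x` vanishes on `N`, hence at `y`.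
    refine hy _ (hO.left_mul_mem hf x) fun z hz => ?_
    exact hx _ (hO.right_mul_mem hf z) fun w hw => h _ (N.mul_mem hw hz)
  inv_mem' := by
    intro x hx f hf h
    exact hx _ (hO.inv_regular f hf) fun y hy => h _ (N.inv_mem hy)

theorem mem_closureSubgroup {O : Subalgebra ℂ (A → ℂ)} (hO : IsAffineAlgebraicGroup O)
    {N : Subgroup A} {x : A} :
    x ∈ closureSubgroup hO N ↔ ∀ f ∈ O, (∀ y ∈ N, f y = 0) → f x = 0 := Iff.rfl

theorem le_closureSubgroup {O : Subalgebra ℂ (A → ℂ)} (hO : IsAffineAlgebraicGroup O)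
    (N : Subgroup A) : N ≤ closureSubgroup hO N :=
  fun x hx _ _ h => h x hx

theorem isClosed_closureSubgroup {O : Subalgebra ℂ (A → ℂ)} (hO : IsAffineAlgebraicGroup O)
    (N : Subgroup A) : IsClosed[zariski O] (closureSubgroup hO N : Set A) := by
  rw [isClosed_zariski_iff]
  intro x hx
  rw [SetLike.mem_coe, mem_closureSubgroup] at hx
  push Not at hx
  obtain ⟨f, hf, h, hx⟩ := hx
  exact ⟨f, hf, hx, fun y hy => hy f hf h⟩

theorem coe_closureSubgroup {O : Subalgebra ℂ (A → ℂ)} (hO : IsAffineAlgebraicGroup O)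
    (N : Subgroup A) : (closureSubgroup hO N : Set A) = @closure A (zariski O) N := by
  let _ := zariski O
  refine Set.Subset.antisymm (fun x hx => ?_)
    (closure_minimal (le_closureSubgroup hO N) (isClosed_closureSubgroup hO N))
  by_contra hne
  obtain ⟨f, hf, hfx, h⟩ := (isClosed_zariski_iff O _).1 isClosed_closure x hne
  exact hfx (hx f hf fun y hy => h y (subset_closure hy))

theorem isConnected_closureSubgroup {O : Subalgebra ℂ (A → ℂ)} (hO : IsAffineAlgebraicGroup O)
    {N : Subgroup A} (h : @IsConnected A (zariski O) (N : Set A)) :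
    @IsConnected A (zariski O) (closureSubgroup hO N : Set A) := by
  let _ := zariski O
  rw [coe_closureSubgroup]
  exact h.closure

theorem closureSubgroup_normal {O : Subalgebra ℂ (A → ℂ)} (hO : IsAffineAlgebraicGroup O)
    {N : Subgroup A} (h : N.Normal) : (closureSubgroup hO N).Normal := by
  refine ⟨fun x hx g f hf h0 => ?_⟩
  exact hx _ (hO.left_mul_mem (hO.right_mul_mem hf g⁻¹) g) fun y hy => h0 _ (h.conj_mem y hy g)

/-! ### Linear groups -/

open Matrix

variable {M : ℕ}

/-- The functions on `A` induced by the regular functions on `GL_M(ℂ)`. -/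
def pullbackRing (ι : A →* GeneralLinearGroup (Fin M) ℂ) : Subalgebra ℂ (A → ℂ) :=
  (glRing M).map (AlgHom.pi fun x : A =>
    Pi.evalAlgHom ℂ (fun _ : GeneralLinearGroup (Fin M) ℂ => ℂ) (ι x))

theorem mem_pullbackRing {ι : A →* GeneralLinearGroup (Fin M) ℂ} {f : A → ℂ} :
    f ∈ pullbackRing ι ↔ ∃ q ∈ glRing M, f = fun x => q (ι x) := by
  constructor
  · rintro ⟨q, hq, rfl⟩
    exact ⟨q, hq, rfl⟩
  · rintro ⟨q, hq, rfl⟩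
    exact ⟨q, hq, rfl⟩

theorem restrict_pullbackRing (ι : A →* GeneralLinearGroup (Fin M) ℂ) (K : Subgroup A) :
    restrict (pullbackRing ι) K = pullbackRing (ι.comp K.subtype) := by
  ext f
  rw [mem_pullbackRing]
  constructor
  · rintro ⟨_, ⟨q, hq, rfl⟩, rfl⟩
    exact ⟨q, hq, rfl⟩
  · rintro ⟨q, hq, rfl⟩
    exact ⟨_, ⟨q, hq, rfl⟩, rfl⟩

theorem restrict_glRing (H : Subgroup (GeneralLinearGroup (Fin M) ℂ)) :
    restrict (glRing M) H = pullbackRing H.subtype := rfl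

theorem pullbackRing_eq_adjoin (ι : A →* GeneralLinearGroup (Fin M) ℂ) :
    pullbackRing ι = Algebra.adjoin ℂ {f | ∃ i j : Fin M,
      f = (fun x : A => (ι x).val i j) ∨ f = (fun x : A => (ι x)⁻¹.val i j)} := by
  rw [pullbackRing, glRing, AlgHom.map_adjoin]
  congr 1
  ext f
  constructor
  · rintro ⟨_, ⟨i, j, rfl | rfl⟩, rfl⟩
    · exact ⟨i, j, Or.inl rfl⟩
    · exact ⟨i, j, Or.inr rfl⟩
  · rintro ⟨i, j, rfl | rfl⟩
    · exact ⟨_, ⟨i, j, Or.inl rfl⟩, rfl⟩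
    · exact ⟨_, ⟨i, j, Or.inr rfl⟩, rfl⟩

theorem entry_mem_pullbackRing (ι : A →* GeneralLinearGroup (Fin M) ℂ) (i j : Fin M) :
    (fun x : A => (ι x).val i j) ∈ pullbackRing ι := by
  rw [pullbackRing_eq_adjoin]
  exact Algebra.subset_adjoin ⟨i, j, Or.inl rfl⟩

theorem inv_entry_mem_pullbackRing (ι : A →* GeneralLinearGroup (Fin M) ℂ) (i j : Fin M) :
    (fun x : A => (ι x)⁻¹.val i j) ∈ pullbackRing ι := by
  rw [pullbackRing_eq_adjoin]
  exact Algebra.subset_adjoin ⟨i, j, Or.inr rfl⟩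

theorem entry_mem_glRing (i j : Fin M) :
    (fun x : GeneralLinearGroup (Fin M) ℂ => x.val i j) ∈ glRing M :=
  Algebra.subset_adjoin ⟨i, j, Or.inl rfl⟩

theorem polynomial_mem_of_entries {X : Type*} {O : Subalgebra ℂ (X → ℂ)}
    {P Q : X → Matrix (Fin M) (Fin M) ℂ} (hP : ∀ i j, (fun x => P x i j) ∈ O)
    (hQ : ∀ i j, (fun x => Q x i j) ∈ O) (i j : Fin M) : (fun x => (P x * Q x) i j) ∈ O := by
  have : (fun x => (P x * Q x) i j) = ∑ l, (fun x => P x i l) * fun x => Q x l j := by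
    ext x
    simp [Matrix.mul_apply]
  rw [this]
  exact O.sum_mem fun l _ => O.mul_mem (hP i l) (hQ l j)

theorem pow_entry_mem {X : Type*} {O : Subalgebra ℂ (X → ℂ)}
    {P : X → Matrix (Fin M) (Fin M) ℂ} (hP : ∀ i j, (fun x => P x i j) ∈ O) (n : ℕ) :
    ∀ i j : Fin M, (fun x => (P x ^ n) i j) ∈ O := by
  induction n with
  | zero =>
    intro i j
    simp only [pow_zero]
    exact O.algebraMap_mem ((1 : Matrix (Fin M) (Fin M) ℂ) i j)
  | succ n ih =>
    intro i j
    simp only [pow_succ]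
    exact polynomial_mem_of_entries ih hP i j

/-- Evaluation of regular functions on `GL_M` at a family of points whose entries come from points
of an algebra `R`. -/
theorem exists_eval_eq {R Ω : Type*} [CommRing R] [Algebra ℂ R] (ev : Ω → R →ₐ[ℂ] ℂ)
    (g : Ω → GeneralLinearGroup (Fin M) ℂ) (X Y : Matrix (Fin M) (Fin M) R)
    (hX : ∀ a i j, (g a).val i j = ev a (X i j)) (hY : ∀ a i j, (g a)⁻¹.val i j = ev a (Y i j))
    {q : GeneralLinearGroup (Fin M) ℂ → ℂ} (hq : q ∈ glRing M) :
    ∃ r : R, ∀ a, q (g a) = ev a r := by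
  induction hq using Algebra.adjoin_induction with
  | mem q hq =>
    obtain ⟨i, j, rfl | rfl⟩ := hq
    · exact ⟨X i j, fun a => hX a i j⟩
    · exact ⟨Y i j, fun a => hY a i j⟩
  | algebraMap c => exact ⟨algebraMap ℂ R c, fun a => ((ev a).commutes c).symm⟩
  | add q q' _ _ h h' =>
    obtain ⟨r, hr⟩ := h
    obtain ⟨r', hr'⟩ := h'
    exact ⟨r + r', fun a => by rw [map_add, Pi.add_apply, hr, hr']⟩
  | mul q q' _ _ h h' =>
    obtain ⟨r, hr⟩ := h
    obtain ⟨r', hr'⟩ := h'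
    exact ⟨r * r', fun a => by rw [map_mul, Pi.mul_apply, hr, hr']⟩

/-- The substantial point is that every character comes from a point. Applying it to the entries of
`ι` and of its inverse gives an invertible matrix, and closedness of the image puts that matrix in
the image. -/
theorem isAffineAlgebraicGroup_pullbackRing (ι : A →* GeneralLinearGroup (Fin M) ℂ)
    (hι : Function.Injective ι) (hc : IsClosed[zariski (glRing M)] (Set.range ι)) :
    IsAffineAlgebraicGroup (pullbackRing ι) where
  fg := by
    rw [pullbackRing_eq_adjoin]
    refine Subalgebra.fg_def.2 ⟨_, ?_, rfl⟩
    refine Set.Finite.subset (s := (Set.range fun p : Fin M × Fin M => fun x : A =>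
      (ι x).val p.1 p.2) ∪ Set.range fun p : Fin M × Fin M => fun x : A => (ι x)⁻¹.val p.1 p.2)
      ((Set.finite_range _).union (Set.finite_range _)) ?_
    rintro _ ⟨i, j, rfl | rfl⟩
    · exact Or.inl ⟨(i, j), rfl⟩
    · exact Or.inr ⟨(i, j), rfl⟩
  bijective_eval := by
    constructor
    · intro x y hxy
      refine hι (Units.ext (Matrix.ext fun i j => ?_))
      exact DFunLike.congr_fun hxy ⟨_, entry_mem_pullbackRing ι i j⟩
    · intro χ
      have hmul : ∀ (P Q : A → Matrix (Fin M) (Fin M) ℂ)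
          (hP : ∀ i j, (fun x => P x i j) ∈ pullbackRing ι)
          (hQ : ∀ i j, (fun x => Q x i j) ∈ pullbackRing ι), (∀ x, P x * Q x = 1) →
          Matrix.of (fun i j => χ ⟨_, hP i j⟩) * Matrix.of (fun i j => χ ⟨_, hQ i j⟩) = 1 := by
        intro P Q hP hQ h
        ext i j
        have : ∑ l, (⟨_, hP i l⟩ : pullbackRing ι) * ⟨_, hQ l j⟩ =
            algebraMap ℂ _ ((1 : Matrix (Fin M) (Fin M) ℂ) i j) := by
          ext x
          have := congrFun (congrFun (h x) i) j
          rw [Matrix.mul_apply] at this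
          simpa using this
        have := congrArg χ this
        rw [χ.commutes, map_sum] at this
        simp only [map_mul] at this
        rw [Matrix.mul_apply]
        exact this
      let g : GeneralLinearGroup (Fin M) ℂ :=
        ⟨_, _, hmul (fun x => (ι x).val) (fun x => (ι x)⁻¹.val) (entry_mem_pullbackRing ι)
          (inv_entry_mem_pullbackRing ι) (fun x => (ι x).mul_inv),
          hmul (fun x => (ι x)⁻¹.val) (fun x => (ι x).val) (inv_entry_mem_pullbackRing ι)
          (entry_mem_pullbackRing ι) (fun x => (ι x).inv_mul)⟩
      have hg : ∀ q, ∀ hq : q ∈ glRing M, χ ⟨fun x => q (ι x), mem_pullbackRing.2 ⟨q, hq, rfl⟩⟩ =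
          q g := by
        intro q hq
        induction hq using Algebra.adjoin_induction with
        | mem q hq =>
          obtain ⟨i, j, rfl | rfl⟩ := hq
          · rfl
          · rfl
        | algebraMap c => exact χ.commutes c
        | add q q' h1 h2 h h' =>
          rw [Pi.add_apply, ← h, ← h', ← map_add]
          rfl
        | mul q q' h1 h2 h h' =>
          rw [Pi.mul_apply, ← h, ← h', ← map_mul]
          rfl
      -- A regular function vanishing on the image pulls back to `0`, so it is killed by `χ` and
      -- vanishes at `g`.
      have hmem : g ∈ Set.range ι := by
        by_contra hne
        obtain ⟨q, hq, hqg, h0⟩ := (isClosed_zariski_iff _ _).1 hc g hne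
        apply hqg
        rw [← hg q hq]
        have : (⟨fun x => q (ι x), mem_pullbackRing.2 ⟨q, hq, rfl⟩⟩ : pullbackRing ι) = 0 := by
          ext x
          exact h0 _ ⟨x, rfl⟩
        rw [this, map_zero]
      obtain ⟨x, hx⟩ := hmem
      refine ⟨x, AlgHom.ext ?_⟩
      rintro ⟨f, hf⟩
      obtain ⟨q, hq, rfl⟩ := mem_pullbackRing.1 hf
      exact (congrArg q hx).trans (hg q hq).symm
  mul_regular := by
    intro f hf
    obtain ⟨q, hq, rfl⟩ := mem_pullbackRing.1 hf
    clear hf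
    have hl : ∀ f ∈ pullbackRing ι, (fun p : A × A => f p.1) ∈ Algebra.adjoin ℂ
        {u : A × A → ℂ | ∃ q ∈ pullbackRing ι, u = (fun p => q p.1) ∨ u = (fun p => q p.2)} :=
      fun f hf => Algebra.subset_adjoin ⟨f, hf, Or.inl rfl⟩
    have hr : ∀ f ∈ pullbackRing ι, (fun p : A × A => f p.2) ∈ Algebra.adjoin ℂ
        {u : A × A → ℂ | ∃ q ∈ pullbackRing ι, u = (fun p => q p.1) ∨ u = (fun p => q p.2)} :=
      fun f hf => Algebra.subset_adjoin ⟨f, hf, Or.inr rfl⟩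
    induction hq using Algebra.adjoin_induction with
    | mem q hq =>
      obtain ⟨i, j, rfl | rfl⟩ := hq
      · simp only [map_mul, Units.val_mul]
        exact polynomial_mem_of_entries (fun i j => hl _ (entry_mem_pullbackRing ι i j))
          (fun i j => hr _ (entry_mem_pullbackRing ι i j)) i j
      · simp only [map_mul, _root_.mul_inv_rev, Units.val_mul]
        exact polynomial_mem_of_entries (fun i j => hr _ (inv_entry_mem_pullbackRing ι i j))
          (fun i j => hl _ (inv_entry_mem_pullbackRing ι i j)) i j
    | algebraMap c => exact Subalgebra.algebraMap_mem _ c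
    | add q q' h1 h2 h h' => exact Subalgebra.add_mem _ h h'
    | mul q q' h1 h2 h h' => exact Subalgebra.mul_mem _ h h'
  inv_regular := by
    intro f hf
    obtain ⟨q, hq, rfl⟩ := mem_pullbackRing.1 hf
    clear hf
    induction hq using Algebra.adjoin_induction with
    | mem q hq =>
      obtain ⟨i, j, rfl | rfl⟩ := hq
      · simp only [map_inv]
        exact inv_entry_mem_pullbackRing ι i j
      · simp only [map_inv, inv_inv]
        exact entry_mem_pullbackRing ι i j
    | algebraMap c => exact Subalgebra.algebraMap_mem _ c
    | add q q' h1 h2 h h' => exact Subalgebra.add_mem _ h h'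
    | mul q q' h1 h2 h h' => exact Subalgebra.mul_mem _ h h'

/-- On matrix entries, right translation is right multiplication by `ι g`; evaluating at `1` will
recover the powers of `ι g - 1`. -/
theorem rightTranslation_pow_entry (ι : A →* GeneralLinearGroup (Fin M) ℂ) (g : A) (n : ℕ)
    (i j : Fin M) : ((rightTranslation g - 1) ^ n) (fun x : A => (ι x).val i j) =
      fun x => ((ι x).val * ((ι g).val - 1) ^ n) i j := by
  induction n with
  | zero => simp
  | succ n ih =>
    rw [pow_succ', Module.End.mul_apply, ih]
    ext x
    simp only [rightTranslation, LinearMap.sub_apply, LinearMap.funLeft_apply, Pi.sub_apply,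
      Module.End.one_apply, map_mul, Units.val_mul]
    rw [pow_succ', ← Matrix.sub_apply]
    noncomm_ring

theorem rightTranslation_pow_inv_entry (ι : A →* GeneralLinearGroup (Fin M) ℂ) (g : A) (n : ℕ)
    (i j : Fin M) : ((rightTranslation g - 1) ^ n) (fun x : A => (ι x)⁻¹.val i j) =
      fun x => (((ι g)⁻¹.val - 1) ^ n * (ι x)⁻¹.val) i j := by
  induction n with
  | zero => simp
  | succ n ih =>
    rw [pow_succ', Module.End.mul_apply, ih]
    ext x
    simp only [rightTranslation, LinearMap.sub_apply, LinearMap.funLeft_apply, Pi.sub_apply,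
      Module.End.one_apply, map_mul, Units.val_mul, _root_.mul_inv_rev]
    rw [pow_succ, ← Matrix.sub_apply]
    noncomm_ring

theorem isNilpotent_inv_sub_one (g : GeneralLinearGroup (Fin M) ℂ)
    (h : IsNilpotent (g.val - 1)) : IsNilpotent (g⁻¹.val - 1) := by
  have h1 : g⁻¹.val - 1 = (-g⁻¹.val) * (g.val - 1) := by
    rw [neg_mul, mul_sub, ← Units.val_mul, inv_mul_cancel, mul_one, Units.val_one]
    abel
  have hc : Commute (-g⁻¹.val) (g.val - 1) := by
    refine Commute.neg_left (Commute.sub_right ?_ (Commute.one_right _))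
    rw [Commute, SemiconjBy, ← Units.val_mul, ← Units.val_mul, inv_mul_cancel, mul_inv_cancel]
  rw [h1]
  exact hc.isNilpotent_mul_left h

/-- This reduces the intrinsic notion of unipotence to matrices. In one direction evaluate the entry
functions at `1`; in the other, the entries of `ι` and of its inverse generate the ring. -/
theorem isUnipotentElement_pullbackRing_iff (ι : A →* GeneralLinearGroup (Fin M) ℂ) (g : A) :
    IsUnipotentElement (pullbackRing ι) g ↔ IsNilpotent ((ι g).val - 1) := by
  constructor
  · intro h
    choose n hn using fun p : Fin M × Fin M => h _ (entry_mem_pullbackRing ι p.1 p.2)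
    -- The sum of the exponents dominates each of them, giving one exponent for all entries.
    refine ⟨∑ p, n p, Matrix.ext fun i j => ?_⟩
    have hle : n (i, j) ≤ ∑ p, n p :=
      Finset.single_le_sum (f := n) (fun _ _ => Nat.zero_le _) (Finset.mem_univ (i, j))
    obtain ⟨k, hk⟩ := Nat.exists_eq_add_of_le hle
    have h0 : ((rightTranslation g - 1) ^ (∑ p, n p)) (fun x : A => (ι x).val i j) = 0 := by
      rw [hk, add_comm, pow_add, Module.End.mul_apply, hn (i, j), map_zero]
    rw [rightTranslation_pow_entry] at h0
    simpa using congrFun h0 1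
  · intro h
    rw [pullbackRing_eq_adjoin]
    refine isUnipotentElement_adjoin _ _ ?_
    rintro _ ⟨i, j, rfl | rfl⟩
    · obtain ⟨n, hn⟩ := h
      refine ⟨n, ?_⟩
      rw [rightTranslation_pow_entry, hn]
      ext x
      simp
    · obtain ⟨n, hn⟩ := isNilpotent_inv_sub_one _ h
      refine ⟨n, ?_⟩
      rw [rightTranslation_pow_inv_entry, hn]
      ext x
      simp

theorem isClosed_image_of_isClosed (ι : A →* GeneralLinearGroup (Fin M) ℂ)
    (hc : IsClosed[zariski (glRing M)] (Set.range ι)) (N : Subgroup A)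
    (hN : IsClosed[zariski (pullbackRing ι)] (N : Set A)) :
    IsClosed[zariski (glRing M)] (N.map ι : Set (GeneralLinearGroup (Fin M) ℂ)) := by
  rw [isClosed_zariski_iff] at *
  intro g hg
  by_cases hgr : g ∈ Set.range ι
  · obtain ⟨x, rfl⟩ := hgr
    have hx : x ∉ N := fun hx => hg ⟨x, hx, rfl⟩
    obtain ⟨f, hf, hfx, h0⟩ := hN x hx
    obtain ⟨q, hq, rfl⟩ := mem_pullbackRing.1 hf
    refine ⟨q, hq, hfx, ?_⟩
    rintro _ ⟨y, hy, rfl⟩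
    exact h0 y hy
  · obtain ⟨q, hq, hqg, h0⟩ := hc g hgr
    refine ⟨q, hq, hqg, ?_⟩
    rintro _ ⟨y, hy, rfl⟩
    exact h0 _ ⟨y, rfl⟩

end AlgGroup

end

section

/-! ### Exponentials -/

theorem NormedSpace.exp_eq_sum_range {𝔸 : Type*} [Ring 𝔸] [Algebra ℂ 𝔸]
    [TopologicalSpace 𝔸] [IsTopologicalRing 𝔸] {a : 𝔸} {k : ℕ} (h : a ^ k = 0) :
    NormedSpace.exp a = ∑ i ∈ Finset.range k, ((i.factorial : ℂ)⁻¹) • a ^ i := by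
  rw [NormedSpace.exp_eq_tsum ℂ]
  refine tsum_eq_sum fun i hi => ?_
  rw [pow_eq_zero_of_le (by simpa using hi) h, smul_zero]

/-- If `c` is differentiable at `0` with `c 0 = 1` and derivative `z`, then
`c (1/n) ^ n` tends to `exp z`. -/
theorem tendsto_pow_exp {𝔸 : Type*} [NormedRing 𝔸] [NormedAlgebra ℂ 𝔸] [CompleteSpace 𝔸]
    {c : ℂ → 𝔸} {z : 𝔸} (h0 : c 0 = 1) (hc : HasDerivAt c z 0) :
    Filter.Tendsto (fun n : ℕ => c ((n : ℂ)⁻¹) ^ n) Filter.atTop (𝓝 (NormedSpace.exp z)) := by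
  let _ : NormedAlgebra ℚ 𝔸 := NormedAlgebra.restrictScalars ℚ ℂ 𝔸
  have hs : HasStrictFDerivAt (NormedSpace.exp : 𝔸 → 𝔸)
      ((ContinuousLinearEquiv.refl ℂ 𝔸 : 𝔸 ≃L[ℂ] 𝔸) : 𝔸 →L[ℂ] 𝔸) 0 :=
    hasStrictFDerivAt_exp_zero (𝕂 := ℂ)
  -- A local logarithm: `n • l (c (1/n))` tends to the derivative `z`, and its exponential is `c
  -- (1/n) ^ n`.
  set l := hs.localInverse with hl
  have hl1 : l 1 = 0 := by
    have := hs.localInverse_apply_image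
    rwa [NormedSpace.exp_zero] at this
  have hld : HasFDerivAt l (((ContinuousLinearEquiv.refl ℂ 𝔸).symm : 𝔸 ≃L[ℂ] 𝔸) : 𝔸 →L[ℂ] 𝔸)
      (c 0) := by
    have := hs.to_localInverse.hasFDerivAt
    rwa [NormedSpace.exp_zero, ← h0] at this
  have hlc : HasDerivAt (fun t => l (c t)) z 0 := by
    have := hld.comp_hasDerivAt (0 : ℂ) hc
    exact this
  have hinv : Filter.Tendsto (fun n : ℕ => ((n : ℂ)⁻¹)) Filter.atTop (𝓝[≠] 0) := by
    refine tendsto_nhdsWithin_iff.2 ⟨tendsto_inv_atTop_nhds_zero_nat, ?_⟩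
    filter_upwards [Filter.eventually_gt_atTop 0] with n hn
    simp [hn.ne']
  have hlim : Filter.Tendsto (fun n : ℕ => (n : ℂ) • l (c ((n : ℂ)⁻¹))) Filter.atTop (𝓝 z) := by
    have := (hasDerivAt_iff_tendsto_slope_zero.1 hlc).comp hinv
    refine this.congr fun n => ?_
    simp [h0, hl1]
  have hev : ∀ᶠ n : ℕ in Filter.atTop, NormedSpace.exp (l (c ((n : ℂ)⁻¹))) = c ((n : ℂ)⁻¹) := by
    have h1 : ∀ᶠ y in 𝓝 (c 0), NormedSpace.exp (l y) = y := by
      have := hs.eventually_right_inverse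
      rwa [NormedSpace.exp_zero, ← h0] at this
    exact ((hc.continuousAt.tendsto.mono_left nhdsWithin_le_nhds).comp hinv).eventually h1
  refine Filter.Tendsto.congr' ?_ hlim.exp
  filter_upwards [hev] with n hn
  rw [← hn, ← NormedSpace.exp_nsmul, Nat.cast_smul_eq_nsmul, hn]

open NormedSpace Matrix

namespace AlgGroup

variable {M : ℕ}

theorem exp_mul_exp_neg (x : Matrix (Fin M) (Fin M) ℂ) : exp x * exp (-x) = 1 := by
  rw [← Matrix.exp_add_of_commute _ _ (Commute.neg_right (Commute.refl x)), add_neg_cancel,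
    NormedSpace.exp_zero]

/-- The exponential, with values in the general linear group. -/
noncomputable def expGL (x : Matrix (Fin M) (Fin M) ℂ) : GeneralLinearGroup (Fin M) ℂ :=
  ⟨exp x, exp (-x), exp_mul_exp_neg x, by simpa using exp_mul_exp_neg (-x)⟩

theorem expGL_val (x : Matrix (Fin M) (Fin M) ℂ) : (expGL x).val = exp x := rfl

theorem expGL_inv_val (x : Matrix (Fin M) (Fin M) ℂ) : (expGL x)⁻¹.val = exp (-x) := rfl

theorem expGL_zero : expGL (0 : Matrix (Fin M) (Fin M) ℂ) = 1 :=
  Units.ext (by rw [expGL_val, NormedSpace.exp_zero, Units.val_one])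

theorem expGL_add {x y : Matrix (Fin M) (Fin M) ℂ} (h : Commute x y) :
    expGL (x + y) = expGL x * expGL y :=
  Units.ext (by rw [Units.val_mul, expGL_val, expGL_val, expGL_val, exp_add_of_commute _ _ h])

theorem expGL_conj (g : GeneralLinearGroup (Fin M) ℂ) (x : Matrix (Fin M) (Fin M) ℂ) :
    expGL (g.val * x * g⁻¹.val) = g * expGL x * g⁻¹ :=
  Units.ext (Matrix.exp_units_conj g x)

theorem expGL_nsmul (n : ℕ) (x : Matrix (Fin M) (Fin M) ℂ) : expGL ((n : ℂ) • x) = expGL x ^ n :=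
  Units.ext (by rw [Units.val_pow_eq_pow_val, expGL_val, expGL_val, Nat.cast_smul_eq_nsmul,
    Matrix.exp_nsmul])

theorem hasDerivAt_exp_entry (x : Matrix (Fin M) (Fin M) ℂ) (t : ℂ) (i j : Fin M) :
    HasDerivAt (fun t : ℂ => exp (t • x) i j) ((x * exp (t • x)) i j) t :=
  open scoped Matrix.Norms.Operator in
  (LinearMap.toContinuousLinearMap (Matrix.entryLinearMap ℂ ℂ i j)).hasFDerivAt.comp_hasDerivAt t
    (hasDerivAt_exp_smul_const' x t)

theorem continuous_exp_smul (x : Matrix (Fin M) (Fin M) ℂ) :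
    Continuous fun t : ℂ => exp (t • x) :=
  continuous_matrix fun i j => continuous_iff_continuousAt.2 fun t =>
    (hasDerivAt_exp_entry x t i j).continuousAt

theorem tendsto_slope_exp (x : Matrix (Fin M) (Fin M) ℂ) :
    Filter.Tendsto (fun t : ℂ => t⁻¹ • (exp (t • x) - 1)) (𝓝[≠] 0) (𝓝 x) := by
  refine tendsto_pi_nhds.2 fun i => tendsto_pi_nhds.2 fun j => ?_
  have := hasDerivAt_iff_tendsto_slope_zero.1 (hasDerivAt_exp_entry x 0 i j)
  simpa [NormedSpace.exp_zero] using this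

section

open scoped Matrix.Norms.Operator

theorem hasDerivAt_exp_mul_exp (x y : Matrix (Fin M) (Fin M) ℂ) :
    HasDerivAt (fun t : ℂ => exp (t • x) * exp (t • y)) (x + y) 0 := by
  have h := (hasDerivAt_exp_smul_const x (0 : ℂ)).mul (hasDerivAt_exp_smul_const y (0 : ℂ))
  refine h.congr_deriv ?_
  simp [NormedSpace.exp_zero]

end

/-- Trotter's product formula, which makes the Lie algebra of a closed group stable under addition.
-/
theorem tendsto_trotter (x y : Matrix (Fin M) (Fin M) ℂ) :
    Filter.Tendsto (fun n : ℕ => (exp ((n : ℂ)⁻¹ • x) * exp ((n : ℂ)⁻¹ • y)) ^ n) Filter.atTop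
      (𝓝 (exp (x + y))) :=
  open scoped Matrix.Norms.Operator in
  tendsto_pow_exp (c := fun t : ℂ => exp (t • x) * exp (t • y))
    (by simp [NormedSpace.exp_zero]) (hasDerivAt_exp_mul_exp x y)

theorem tendsto_of_mem_glRing {X : Type*} {l : Filter X} {γ : X → GeneralLinearGroup (Fin M) ℂ}
    {g : GeneralLinearGroup (Fin M) ℂ} (hv : Filter.Tendsto (fun x => (γ x).val) l (𝓝 g.val))
    (hi : Filter.Tendsto (fun x => (γ x)⁻¹.val) l (𝓝 g⁻¹.val))
    {q : GeneralLinearGroup (Fin M) ℂ → ℂ} (hq : q ∈ glRing M) :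
    Filter.Tendsto (fun x => q (γ x)) l (𝓝 (q g)) := by
  induction hq using Algebra.adjoin_induction with
  | mem q hq =>
    obtain ⟨i, j, rfl | rfl⟩ := hq
    · exact tendsto_pi_nhds.1 (tendsto_pi_nhds.1 hv i) j
    · exact tendsto_pi_nhds.1 (tendsto_pi_nhds.1 hi i) j
  | algebraMap c => exact tendsto_const_nhds
  | add q q' _ _ h h' => exact h.add h'
  | mul q q' _ _ h h' => exact h.mul h'

theorem continuous_of_mem_glRing {X : Type*} [TopologicalSpace X]
    {γ : X → GeneralLinearGroup (Fin M) ℂ} (hv : Continuous fun x => (γ x).val)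
    (hi : Continuous fun x => (γ x)⁻¹.val)
    {q : GeneralLinearGroup (Fin M) ℂ → ℂ} (hq : q ∈ glRing M) : Continuous fun x => q (γ x) :=
  continuous_iff_continuousAt.2 fun _ =>
    tendsto_of_mem_glRing hv.continuousAt hi.continuousAt hq

/-- Zariski closed implies closed for the classical topology, since regular functions are continuous
in the entries of a matrix and of its inverse. -/
theorem mem_of_tendsto_of_isClosed {K : Subgroup (GeneralLinearGroup (Fin M) ℂ)}
    (hK : IsClosed[zariski (glRing M)] (K : Set (GeneralLinearGroup (Fin M) ℂ)))
    {X : Type*} {l : Filter X} [l.NeBot] {γ : X → GeneralLinearGroup (Fin M) ℂ}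
    {g : GeneralLinearGroup (Fin M) ℂ} (hv : Filter.Tendsto (fun x => (γ x).val) l (𝓝 g.val))
    (hi : Filter.Tendsto (fun x => (γ x)⁻¹.val) l (𝓝 g⁻¹.val)) (hγ : ∀ x, γ x ∈ K) : g ∈ K := by
  by_contra hne
  obtain ⟨q, hq, hqg, h0⟩ := (isClosed_zariski_iff _ _).1 hK g hne
  refine hqg (tendsto_nhds_unique (tendsto_of_mem_glRing hv hi hq) ?_)
  simp only [h0 _ (hγ _)]
  exact tendsto_const_nhds

/-! ### Unipotent matrices -/

/-- Cayley–Hamilton with characteristic polynomial `X ^ M`. The uniform exponent makes nilpotency a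
closed condition, stable under limits and Zariski closure. -/
theorem pow_eq_zero_of_isNilpotent {x : Matrix (Fin M) (Fin M) ℂ} (h : IsNilpotent x) :
    x ^ M = 0 := by
  have h1 := (Matrix.isNilpotent_charpoly_sub_pow_of_isNilpotent h).eq_zero
  have h2 := Matrix.aeval_self_charpoly x
  rw [sub_eq_zero.1 h1] at h2
  simpa using h2

/-- A logarithm without its series: `(1 + a) exp(-a)` is `1` plus a multiple of `a ^ 2`, so its
nilpotent part has smaller exponent and strong induction applies. Staying inside the algebra
generated by `a` keeps everything commuting, so the exponentials multiply. -/
theorem exists_exp_eq_one_add (k : ℕ) : ∀ a : Matrix (Fin M) (Fin M) ℂ, a ^ k = 0 →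
    ∃ x ∈ Algebra.adjoin ℂ {a}, IsNilpotent x ∧ exp x = 1 + a := by
  induction k using Nat.strong_induction_on with
  | _ k ih =>
  intro a ha
  rcases Nat.lt_or_ge k 2 with hk | hk
  · have ha0 : a = 0 := by
      interval_cases k
      · have : (1 : Matrix (Fin M) (Fin M) ℂ) = 0 := by simpa using ha
        rw [← mul_one a, this, mul_zero]
      · simpa using ha
    exact ⟨0, Subalgebra.zero_mem _, IsNilpotent.zero, by simp [ha0, NormedSpace.exp_zero]⟩
  obtain ⟨m, rfl⟩ := Nat.exists_eq_add_of_le' hk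
  have haA : a ∈ Algebra.adjoin ℂ {a} := Algebra.self_mem_adjoin_singleton ℂ a
  have hna : (-a) ^ (m + 2) = 0 := by rw [neg_pow, ha, mul_zero]
  obtain ⟨d, hd, hexp⟩ : ∃ d ∈ Algebra.adjoin ℂ {a}, exp (-a) = 1 - a + a ^ 2 * d := by
    refine ⟨∑ i ∈ Finset.range m, (((i + 2).factorial : ℂ)⁻¹) • (-a) ^ i,
      Subalgebra.sum_mem _ fun i _ => Subalgebra.smul_mem _ (Subalgebra.pow_mem _
        (Subalgebra.neg_mem _ haA) _) _, ?_⟩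
    rw [NormedSpace.exp_eq_sum_range hna, Finset.sum_range_succ', Finset.sum_range_succ',
      Finset.mul_sum]
    have : ∀ i, (-a) ^ (i + 1 + 1) = a ^ 2 * (-a) ^ i := fun i => by
      rw [add_assoc, add_comm, pow_add]
      simp
    simp only [this, mul_smul_comm]
    simp
    abel
  have hcd : Commute a d := Algebra.commute_of_mem_adjoin_self hd
  obtain ⟨c, hc, hb⟩ : ∃ c ∈ Algebra.adjoin ℂ {a}, (1 + a) * exp (-a) - 1 = a ^ 2 * c := by
    refine ⟨-1 + d + a * d, ?_, ?_⟩
    · exact Subalgebra.add_mem _ (Subalgebra.add_mem _ (Subalgebra.neg_mem _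
        (Subalgebra.one_mem _)) hd) (Subalgebra.mul_mem _ haA hd)
    · rw [hexp]
      noncomm_ring
  have hca : Commute a c := Algebra.commute_of_mem_adjoin_self hc
  -- The power `m + 1` of a multiple of `a ^ 2` contains `a ^ (2m + 2)`, and `2m + 2 ≥ m + 2`.
  have hb0 : ((1 + a) * exp (-a) - 1) ^ (m + 1) = 0 := by
    rw [hb, (hca.pow_left 2).mul_pow, ← pow_mul, pow_eq_zero_of_le (by omega) ha, zero_mul]
  obtain ⟨x, hx, hxn, hxe⟩ := ih (m + 1) (by omega) _ hb0
  have hbA : (1 + a) * exp (-a) - 1 ∈ Algebra.adjoin ℂ {a} := by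
    rw [hb]
    exact Subalgebra.mul_mem _ (Subalgebra.pow_mem _ haA _) hc
  have hxA : x ∈ Algebra.adjoin ℂ {a} :=
    (Algebra.adjoin_le (Set.singleton_subset_iff.2 hbA)) hx
  have hxa : Commute x a := (Algebra.commute_of_mem_adjoin_self hxA).symm
  refine ⟨x + a, Subalgebra.add_mem _ hxA haA, hxa.isNilpotent_add hxn ⟨_, ha⟩, ?_⟩
  rw [Matrix.exp_add_of_commute _ _ hxa, hxe, add_sub_cancel, mul_assoc]
  have := exp_mul_exp_neg (-a)
  rw [neg_neg] at this
  rw [this, mul_one]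

theorem exists_expGL_eq (u : GeneralLinearGroup (Fin M) ℂ) (h : IsNilpotent (u.val - 1)) :
    ∃ x : Matrix (Fin M) (Fin M) ℂ, IsNilpotent x ∧ expGL x = u := by
  obtain ⟨k, hk⟩ := h
  obtain ⟨x, -, hx, he⟩ := exists_exp_eq_one_add k _ hk
  exact ⟨x, hx, Units.ext (by rw [expGL_val, he, add_sub_cancel])⟩

/-- A closed subgroup containing a unipotent element contains the one-parameter group through
it. -/
theorem expGL_smul_mem_of_isNilpotent {K : Subgroup (GeneralLinearGroup (Fin M) ℂ)}
    (hK : IsClosed[zariski (glRing M)] (K : Set (GeneralLinearGroup (Fin M) ℂ)))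
    {x : Matrix (Fin M) (Fin M) ℂ} (hx : IsNilpotent x) (h : expGL x ∈ K) (t : ℂ) :
    expGL (t • x) ∈ K := by
  by_contra hne
  obtain ⟨q, hq, hqg, h0⟩ := (isClosed_zariski_iff _ _).1 hK _ hne
  obtain ⟨k, hk⟩ := hx
  have hpow : ∀ (c s : ℂ), exp ((c * s) • x) = ∑ i ∈ Finset.range k,
      ((i.factorial : ℂ)⁻¹) • (c * s) ^ i • x ^ i := fun c s => by
    rw [NormedSpace.exp_eq_sum_range (k := k) (by rw [smul_pow, hk, smul_zero])]
    simp only [smul_pow]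
  have hent : ∀ (c s : ℂ) (a b : Fin M), exp ((c * s) • x) a b = Polynomial.aeval s
      (∑ i ∈ Finset.range k, Polynomial.C ((i.factorial : ℂ)⁻¹ * c ^ i * (x ^ i) a b) *
        Polynomial.X ^ i) := by
    intro c s a b
    rw [hpow, Matrix.sum_apply, map_sum]
    refine Finset.sum_congr rfl fun i _ => ?_
    simp [mul_pow]
    ring
  -- As `x` is nilpotent, `q (exp (s x))` is a polynomial in `s`. It vanishes at every natural
  -- number, where `exp (n x)` is a power of an element of `K`, so it is zero.
  obtain ⟨r, hr⟩ := exists_eval_eq (R := Polynomial ℂ) (fun s : ℂ => Polynomial.aeval s)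
    (fun s : ℂ => expGL (s • x)) (Matrix.of fun a b => ∑ i ∈ Finset.range k,
      Polynomial.C ((i.factorial : ℂ)⁻¹ * 1 ^ i * (x ^ i) a b) * Polynomial.X ^ i)
    (Matrix.of fun a b => ∑ i ∈ Finset.range k,
      Polynomial.C ((i.factorial : ℂ)⁻¹ * (-1) ^ i * (x ^ i) a b) * Polynomial.X ^ i)
    (fun s a b => by rw [Matrix.of_apply, ← hent, one_mul, expGL_val])
    (fun s a b => by rw [Matrix.of_apply, ← hent, neg_one_mul, expGL_inv_val, neg_smul]) hq
  have hr0 : r = 0 := by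
    refine Polynomial.eq_zero_of_infinite_isRoot r ?_
    refine (Set.infinite_range_of_injective (Nat.cast_injective (R := ℂ))).mono ?_
    rintro _ ⟨n, rfl⟩
    have := hr (n : ℂ)
    rw [expGL_nsmul, h0 _ (K.pow_mem h n)] at this
    simpa using this.symm
  apply hqg
  rw [hr t, hr0, map_zero]

/-- The matrix `x` is the limit of the quotients `(exp (t x) - 1) / t`, all of which have vanishing
`M`-th power. -/
theorem isNilpotent_of_forall_exp {x : Matrix (Fin M) (Fin M) ℂ}
    (h : ∀ t : ℂ, IsNilpotent (exp (t • x) - 1)) : IsNilpotent x := by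
  refine ⟨M, tendsto_nhds_unique ((tendsto_slope_exp x).pow M) ?_⟩
  have : ∀ t : ℂ, (t⁻¹ • (exp (t • x) - 1)) ^ M = 0 := fun t => by
    rw [smul_pow, pow_eq_zero_of_isNilpotent (h t), smul_zero]
  simp only [this]
  exact tendsto_const_nhds

theorem isNilpotent_exp_sub_one {x : Matrix (Fin M) (Fin M) ℂ} (h : IsNilpotent x) :
    IsNilpotent (exp x - 1) := by
  obtain ⟨k, hk⟩ := h
  have hk' : x ^ (k + 1) = 0 := by rw [pow_succ, hk, zero_mul]
  rw [NormedSpace.exp_eq_sum_range hk', Finset.sum_range_succ']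
  have : ∑ i ∈ Finset.range k, (((i + 1).factorial : ℂ)⁻¹) • x ^ (i + 1) =
      x * ∑ i ∈ Finset.range k, (((i + 1).factorial : ℂ)⁻¹) • x ^ i := by
    rw [Finset.mul_sum]
    refine Finset.sum_congr rfl fun i _ => ?_
    rw [mul_smul_comm, pow_succ']
  rw [this]
  simp only [Nat.factorial_zero, Nat.cast_one, inv_one, pow_zero, one_smul, add_sub_cancel_right]
  refine Commute.isNilpotent_mul_right ?_ ⟨k, hk⟩
  exact Commute.sum_right _ _ _ fun i _ => (Commute.refl x).pow_right i |>.smul_right _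

theorem commute_of_forall_commute_exp {x y : Matrix (Fin M) (Fin M) ℂ}
    (h : ∀ t : ℂ, Commute y (exp (t • x))) : Commute y x := by
  refine tendsto_nhds_unique ((tendsto_slope_exp x).const_mul y) ?_
  have : ∀ t : ℂ, y * t⁻¹ • (exp (t • x) - 1) = t⁻¹ • (exp (t • x) - 1) * y := fun t => by
    exact (((h t).sub_right (Commute.one_right _)).smul_right _)
  simp only [this]
  exact (tendsto_slope_exp x).mul_const y

end AlgGroup

end

section

open NormedSpace Matrix

/-! ### The Lie algebra of a closed linear group -/

namespace AlgGroup

variable {M : ℕ}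

/-- The commutator is the derivative at `0` of the conjugates of `y`, and a finite-dimensional
subspace is closed. -/
theorem lie_mem_of_conj_mem (P : Submodule ℂ (Matrix (Fin M) (Fin M) ℂ))
    (x y : Matrix (Fin M) (Fin M) ℂ)
    (h : ∀ t : ℂ, exp (t • x) * y * exp (-(t • x)) ∈ P) : x * y - y * x ∈ P := by
  have hcl : IsClosed (P : Set (Matrix (Fin M) (Fin M) ℂ)) := P.closed_of_finiteDimensional
  have hy : y ∈ P := by simpa [NormedSpace.exp_zero] using h 0
  have h1 := tendsto_slope_exp x
  have h2 : Filter.Tendsto (fun t : ℂ => exp (-(t • x))) (𝓝[≠] 0) (𝓝 1) := by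
    have := (continuous_exp_smul (-x)).tendsto 0
    simp only [smul_neg, zero_smul, neg_zero, NormedSpace.exp_zero] at this
    exact this.mono_left nhdsWithin_le_nhds
  have h3 := ((h1.mul_const y).sub ((h1.const_mul y))).mul h2
  rw [mul_one] at h3
  refine hcl.mem_of_tendsto h3 (Filter.Eventually.of_forall fun t => ?_)
  have : (t⁻¹ • (exp (t • x) - 1) * y - y * t⁻¹ • (exp (t • x) - 1)) * exp (-(t • x)) =
      t⁻¹ • (exp (t • x) * y * exp (-(t • x)) - y) := by
    rw [smul_mul_assoc, mul_smul_comm, ← smul_sub, smul_mul_assoc]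
    congr 1
    have he := exp_mul_exp_neg (t • x)
    have : ((exp (t • x) - 1) * y - y * (exp (t • x) - 1)) * exp (-(t • x)) =
      exp (t • x) * y * exp (-(t • x)) - y * (exp (t • x) * exp (-(t • x))) := by noncomm_ring
    rw [this, he, mul_one]
  rw [this]
  exact P.smul_mem _ (P.sub_mem (h t) hy)

/-- The Lie algebra of a closed subgroup of `GL_M(ℂ)`. -/
def tangentSpace (K : Subgroup (GeneralLinearGroup (Fin M) ℂ))
    (hK : IsClosed[zariski (glRing M)] (K : Set (GeneralLinearGroup (Fin M) ℂ))) :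
    Submodule ℂ (Matrix (Fin M) (Fin M) ℂ) where
  carrier := {x | ∀ t : ℂ, expGL (t • x) ∈ K}
  zero_mem' t := by
    rw [smul_zero, expGL_zero]
    exact K.one_mem
  smul_mem' c x hx t := by
    rw [smul_smul]
    exact hx _
  add_mem' := by
    intro x y hx hy t
    rw [smul_add]
    refine mem_of_tendsto_of_isClosed hK (l := Filter.atTop) (γ := fun n : ℕ =>
      (expGL ((n : ℂ)⁻¹ • t • x) * expGL ((n : ℂ)⁻¹ • t • y)) ^ n) ?_ ?_ ?_
    · exact tendsto_trotter (t • x) (t • y)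
    -- Inversion reverses the product, so the inverses converge by the same formula with the factors
    -- exchanged and negated.
    · have := tendsto_trotter (-(t • y)) (-(t • x))
      rw [expGL_inv_val, neg_add_rev]
      refine this.congr fun n => ?_
      rw [← inv_pow, _root_.mul_inv_rev, Units.val_pow_eq_pow_val, Units.val_mul, expGL_inv_val,
        expGL_inv_val, smul_neg, smul_neg]
    · intro n
      refine K.pow_mem (K.mul_mem ?_ ?_) n
      · rw [smul_smul]
        exact hx _
      · rw [smul_smul]
        exact hy _

variable {K N : Subgroup (GeneralLinearGroup (Fin M) ℂ)}
  {hK : IsClosed[zariski (glRing M)] (K : Set (GeneralLinearGroup (Fin M) ℂ))}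
  {hN : IsClosed[zariski (glRing M)] (N : Set (GeneralLinearGroup (Fin M) ℂ))}

theorem mem_tangentSpace {x : Matrix (Fin M) (Fin M) ℂ} :
    x ∈ tangentSpace K hK ↔ ∀ t : ℂ, expGL (t • x) ∈ K := Iff.rfl

theorem conj_mem_tangentSpace {g : GeneralLinearGroup (Fin M) ℂ}
    (hg : ∀ n ∈ N, g * n * g⁻¹ ∈ N) {x : Matrix (Fin M) (Fin M) ℂ} (hx : x ∈ tangentSpace N hN) :
    g.val * x * g⁻¹.val ∈ tangentSpace N hN := by
  intro t
  have : t • (g.val * x * g⁻¹.val) = g.val * (t • x) * g⁻¹.val := by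
    rw [mul_smul_comm, smul_mul_assoc]
  rw [this, expGL_conj]
  exact hg _ (hx t)

theorem lie_mem_tangentSpace (h : ∀ g ∈ K, ∀ n ∈ N, g * n * g⁻¹ ∈ N)
    {x y : Matrix (Fin M) (Fin M) ℂ} (hx : x ∈ tangentSpace K hK) (hy : y ∈ tangentSpace N hN) :
    x * y - y * x ∈ tangentSpace N hN :=
  lie_mem_of_conj_mem _ x y fun t => conj_mem_tangentSpace (h _ (hx t)) hy

theorem isNilpotent_of_mem_tangentSpace (h : ∀ n ∈ N, IsNilpotent (n.val - 1))
    {x : Matrix (Fin M) (Fin M) ℂ} (hx : x ∈ tangentSpace N hN) : IsNilpotent x :=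
  isNilpotent_of_forall_exp fun t => h _ (hx t)

/-! ### Engel's theorem and flags -/

/-- The descending flag `ℂ^M ⊇ P ℂ^M ⊇ P (P ℂ^M) ⊇ …`. -/
def descendingFlag (P : Submodule ℂ (Matrix (Fin M) (Fin M) ℂ)) : ℕ → Submodule ℂ (Fin M → ℂ)
  | 0 => ⊤
  | i + 1 => Submodule.span ℂ {w | ∃ x ∈ P, ∃ v ∈ descendingFlag P i, x *ᵥ v = w}

theorem mulVec_mem_descendingFlag {P : Submodule ℂ (Matrix (Fin M) (Fin M) ℂ)}
    {x : Matrix (Fin M) (Fin M) ℂ} (hx : x ∈ P) {i : ℕ} {v : Fin M → ℂ}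
    (hv : v ∈ descendingFlag P i) : x *ᵥ v ∈ descendingFlag P (i + 1) :=
  Submodule.subset_span ⟨x, hx, v, hv, rfl⟩

/-- The relation `a x = y a + z` covers both uses at once: conjugation by a group element, with `z =
0`, and bracket with a Lie algebra element, with `y = x` and `z` the commutator. -/
theorem mulVec_mem_descendingFlag_of_normalize {P : Submodule ℂ (Matrix (Fin M) (Fin M) ℂ)}
    {a : Matrix (Fin M) (Fin M) ℂ} (ha : ∀ x ∈ P, ∃ y ∈ P, ∃ z ∈ P, a * x = y * a + z) (i : ℕ) :
    ∀ v ∈ descendingFlag P i, a *ᵥ v ∈ descendingFlag P i := by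
  induction i with
  | zero => exact fun v _ => Submodule.mem_top
  | succ i ih =>
    intro v hv
    rw [descendingFlag] at hv
    induction hv using Submodule.span_induction with
    | mem w hw =>
      obtain ⟨x, hx, v, hv, rfl⟩ := hw
      obtain ⟨y, hy, z, hz, h⟩ := ha x hx
      rw [Matrix.mulVec_mulVec, h, Matrix.add_mulVec, ← Matrix.mulVec_mulVec]
      exact Submodule.add_mem _ (mulVec_mem_descendingFlag hy (ih v hv))
        (mulVec_mem_descendingFlag hz hv)
    | zero => simp
    | add u w _ _ hu hw =>
      rw [Matrix.mulVec_add]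
      exact Submodule.add_mem _ hu hw
    | smul c u _ hu =>
      rw [Matrix.mulVec_smul]
      exact Submodule.smul_mem _ c hu

section

attribute [local instance] LieRing.ofAssociativeRing

/-- Engel's theorem: `ℂ^M` is a nilpotent module over the Lie algebra `P`, and the flag is contained
in the lower central series. -/
theorem exists_descendingFlag_eq_bot (P : Submodule ℂ (Matrix (Fin M) (Fin M) ℂ))
    (hlie : ∀ x ∈ P, ∀ y ∈ P, x * y - y * x ∈ P) (hnil : ∀ x ∈ P, IsNilpotent x) :
    ∃ m, descendingFlag P m = ⊥ := by
  let L : LieSubalgebra ℂ (Module.End ℂ (Fin M → ℂ)) :=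
    { P.map (Matrix.toLin' (R := ℂ) (m := Fin M) (n := Fin M)).toLinearMap with
      lie_mem' := by
        rintro _ _ ⟨x, hx, rfl⟩ ⟨y, hy, rfl⟩
        refine ⟨x * y - y * x, hlie x hx y hy, ?_⟩
        simp only [LinearEquiv.coe_coe, map_sub, Matrix.toLin'_mul]
        rfl }
  have hL : ∀ x ∈ P, Matrix.toLin' x ∈ L := fun x hx => ⟨x, hx, rfl⟩
  have : LieModule.IsNilpotent L (Fin M → ℂ) := by
    rw [LieModule.isNilpotent_iff_forall' (R := ℂ)]
    rintro ⟨_, ⟨x, hx, rfl⟩⟩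
    obtain ⟨k, hk⟩ := hnil x hx
    refine ⟨k, ?_⟩
    have h1 : (LieModule.toEnd ℂ L (Fin M → ℂ)) ⟨Matrix.toLin' x, hL x hx⟩ = Matrix.toLin' x := by
      ext v
      rfl
    have h2 : (Matrix.toLin' x) ^ k = 0 := by
      rw [← Matrix.toLin'_pow, hk, map_zero]
    exact h1 ▸ h2
  obtain ⟨m, hm⟩ := (LieModule.isNilpotent_iff ℂ L (Fin M → ℂ)).1 this
  refine ⟨m, ?_⟩
  have hle : ∀ i, descendingFlag P i ≤
      (LieModule.lowerCentralSeries ℂ L (Fin M → ℂ) i).toSubmodule := by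
    intro i
    induction i with
    | zero => simp [descendingFlag]
    | succ i ih =>
      rw [descendingFlag, Submodule.span_le]
      rintro _ ⟨x, hx, v, hv, rfl⟩
      rw [LieModule.lowerCentralSeries_succ]
      have := LieSubmodule.lie_mem_lie (I := (⊤ : LieIdeal ℂ L))
        (N := LieModule.lowerCentralSeries ℂ L (Fin M → ℂ) i)
        (x := ⟨Matrix.toLin' x, hL x hx⟩) (m := v) (LieSubmodule.mem_top _) (ih hv)
      exact this
  have := hle m
  rw [hm] at this
  simpa using this

end

theorem pow_mulVec_mem_descendingFlag {P : Submodule ℂ (Matrix (Fin M) (Fin M) ℂ)}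
    {a : Matrix (Fin M) (Fin M) ℂ}
    (ha : ∀ i, ∀ v ∈ descendingFlag P i, a *ᵥ v ∈ descendingFlag P (i + 1)) (k : ℕ)
    (v : Fin M → ℂ) : (a ^ k) *ᵥ v ∈ descendingFlag P k := by
  induction k with
  | zero => exact Submodule.mem_top
  | succ k ih =>
    rw [pow_succ', ← Matrix.mulVec_mulVec]
    exact ha k _ ih

theorem isNilpotent_of_descendingFlag {P : Submodule ℂ (Matrix (Fin M) (Fin M) ℂ)}
    (hP : ∃ m, descendingFlag P m = ⊥) {a : Matrix (Fin M) (Fin M) ℂ}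
    (ha : ∀ i, ∀ v ∈ descendingFlag P i, a *ᵥ v ∈ descendingFlag P (i + 1)) : IsNilpotent a := by
  obtain ⟨m, hm⟩ := hP
  refine ⟨m, ?_⟩
  refine Matrix.mulVec_injective (funext fun v => ?_)
  have := pow_mulVec_mem_descendingFlag ha m v
  rw [hm, Submodule.mem_bot] at this
  rw [this, Matrix.zero_mulVec]

/-- The normalizing matrix `z` preserves the flag and `x` lowers it, so `x z` is nilpotent. -/
theorem trace_mul_eq_zero_of_normalize (P : Submodule ℂ (Matrix (Fin M) (Fin M) ℂ))
    (hlie : ∀ x ∈ P, ∀ y ∈ P, x * y - y * x ∈ P) (hnil : ∀ x ∈ P, IsNilpotent x)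
    {x z : Matrix (Fin M) (Fin M) ℂ} (hx : x ∈ P) (hz : ∀ y ∈ P, z * y - y * z ∈ P) :
    (x * z).trace = 0 := by
  refine (Matrix.isNilpotent_trace_of_isNilpotent (isNilpotent_of_descendingFlag
    (exists_descendingFlag_eq_bot P hlie hnil) fun i v hv => ?_)).eq_zero
  rw [← Matrix.mulVec_mulVec]
  refine mulVec_mem_descendingFlag hx (mulVec_mem_descendingFlag_of_normalize ?_ i v hv)
  intro y hy
  exact ⟨y, hy, _, hz y hy, by abel⟩

/-- A closed linear group whose Lie algebra has nondegenerate trace form is reductive. -/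
theorem isReductive_of_trace_nondegenerate {A : Type*} [Group A]
    (ι : A →* GeneralLinearGroup (Fin M) ℂ)
    (hι : Function.Injective ι)
    (hc : IsClosed[zariski (glRing M)] (ι.range : Set (GeneralLinearGroup (Fin M) ℂ)))
    (hnd : ∀ x ∈ tangentSpace ι.range hc, (∀ y ∈ tangentSpace ι.range hc, (x * y).trace = 0) →
      x = 0) : IsReductive (pullbackRing ι) := by
  have hc' : IsClosed[zariski (glRing M)] (Set.range ι) := by rwa [← MonoidHom.coe_range]
  refine ⟨isAffineAlgebraicGroup_pullbackRing ι hι hc', ⟨?_, ?_, ?_, ?_⟩, ?_⟩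
  · refine isClosed_zariski_of_forall (pullbackRing ι) _
      (fun p : Fin M × Fin M => fun x => (ι x).val p.1 p.2 - (1 : Matrix (Fin M) (Fin M) ℂ) p.1 p.2)
      (fun p => Subalgebra.sub_mem _ (entry_mem_pullbackRing ι p.1 p.2)
        (Subalgebra.algebraMap_mem _ ((1 : Matrix (Fin M) (Fin M) ℂ) p.1 p.2))) fun x => ?_
    rw [SetLike.mem_coe, Subgroup.mem_bot, ← map_eq_one_iff ι hι]
    simp only [sub_eq_zero, Prod.forall]
    exact ⟨fun h i j => by rw [h, Units.val_one], fun h => Units.ext (Matrix.ext h)⟩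
  · let _ := zariski (pullbackRing ι)
    rw [Subgroup.coe_bot]
    exact isConnected_singleton
  · infer_instance
  · intro g hg
    rw [isUnipotentElement_pullbackRing_iff, Subgroup.mem_bot.1 hg]
    simp
  · intro N hN
    have hNc := isClosed_image_of_isClosed ι hc' N hN.closed
    have hu : ∀ n ∈ N.map ι, IsNilpotent (n.val - 1) := by
      rintro _ ⟨n, hn, rfl⟩
      exact (isUnipotentElement_pullbackRing_iff ι n).1 (hN.unipotent n hn)
    have hnil : ∀ x ∈ tangentSpace (N.map ι) hNc, IsNilpotent x :=
      fun x hx => isNilpotent_of_mem_tangentSpace hu hx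
    have hnorm : ∀ g ∈ ι.range, ∀ n ∈ N.map ι, g * n * g⁻¹ ∈ N.map ι := by
      rintro _ ⟨g, rfl⟩ _ ⟨n, hn, rfl⟩
      exact ⟨g * n * g⁻¹, hN.normal.conj_mem n hn g, by simp⟩
    have hle : ∀ n ∈ N.map ι, n ∈ ι.range := by
      rintro _ ⟨n, _, rfl⟩
      exact ⟨n, rfl⟩
    -- The Lie algebra of `N` is an ideal of nilpotent matrices, hence lies in the radical of the
    -- trace form.
    have hzero : ∀ x ∈ tangentSpace (N.map ι) hNc, x = 0 := by
      intro x hx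
      refine hnd x (fun t => hle _ (hx t)) fun y hy => ?_
      exact trace_mul_eq_zero_of_normalize _
        (fun a ha b hb => lie_mem_tangentSpace (fun g hg => hnorm g (hle g hg)) ha hb) hnil hx
        fun z hz => lie_mem_tangentSpace hnorm hy hz
    intro u hu'
    -- A nontrivial unipotent element would generate a one-parameter group inside `N`, hence a
    -- nonzero tangent vector.
    obtain ⟨x, hx, hxu⟩ := exists_expGL_eq (ι u) (hu _ ⟨u, hu', rfl⟩)
    have hx0 : x = 0 := hzero x fun t =>
      expGL_smul_mem_of_isNilpotent hNc hx (hxu ▸ ⟨u, hu', rfl⟩) t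
    rw [Subgroup.mem_bot, ← map_eq_one_iff ι hι, ← hxu, hx0, expGL_zero]

end AlgGroup

end

section

open NormedSpace Matrix

/-! ### Linear independence of exponentials over polynomials -/

/-- The derivative has strictly smaller degree than `c p`, so it cannot cancel the leading term. -/
theorem Polynomial.eq_zero_of_derivative_add_smul_eq_zero {p : Polynomial ℂ} {c : ℂ} (hc : c ≠ 0)
    (h : Polynomial.derivative p + Polynomial.C c * p = 0) : p = 0 := by
  by_contra hp
  have h1 : (Polynomial.C c * p).degree = p.degree := Polynomial.degree_C_mul hc
  have h2 : (Polynomial.derivative p).degree < p.degree := Polynomial.degree_derivative_lt hp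
  have h3 := Polynomial.degree_add_eq_right_of_degree_lt (h1 ▸ h2)
  rw [h, h1, Polynomial.degree_zero] at h3
  exact hp (Polynomial.degree_eq_bot.1 h3.symm)

theorem Polynomial.eq_zero_of_sum_mul_exp_eq_zero (T : Finset ℂ) : ∀ p : ℂ → Polynomial ℂ,
    (∀ t : ℂ, ∑ μ ∈ T, (p μ).eval t * Complex.exp (μ * t) = 0) → ∀ μ ∈ T, p μ = 0 := by
  classical
  induction T using Finset.induction_on with
  | empty => simp
  | insert ν T hν ih =>
    -- After division by `e^{ν t}` the coefficient of `ν` is a bare polynomial, and differentiating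
    -- kills it in finitely many steps. Meanwhile each other `p μ` becomes `p' + (μ - ν) p`, and
    -- this operation is injective.
    suffices key : ∀ (n : ℕ) (p : ℂ → Polynomial ℂ), Polynomial.derivative^[n] (p ν) = 0 →
        (∀ t : ℂ, (p ν).eval t + ∑ μ ∈ T, (p μ).eval t * Complex.exp ((μ - ν) * t) = 0) →
        ∀ μ ∈ T, p μ = 0 by
      intro p hp
      have hp' : ∀ t : ℂ, (p ν).eval t +
          ∑ μ ∈ T, (p μ).eval t * Complex.exp ((μ - ν) * t) = 0 := by
        intro t
        have := congrArg (· * Complex.exp (-(ν * t))) (hp t)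
        simp only [Finset.sum_insert hν, add_mul, Finset.sum_mul, mul_assoc, ← Complex.exp_add,
          zero_mul] at this
        rw [← this]
        congr 1
        · simp
        · refine Finset.sum_congr rfl fun μ _ => ?_
          congr 2
          ring
      have hT : ∀ μ ∈ T, p μ = 0 := key ((p ν).natDegree + 1) p
        (Polynomial.iterate_derivative_eq_zero (Nat.lt_succ_self _)) hp'
      intro μ hμ
      rcases Finset.mem_insert.1 hμ with rfl | hμ
      · refine Polynomial.funext fun t => ?_
        have := hp' t
        rw [Finset.sum_eq_zero fun μ hμ => by rw [hT μ hμ]; simp] at this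
        simpa using this
      · exact hT μ hμ
    intro n
    induction n with
    | zero =>
      intro p hp h μ hμ
      refine ih p (fun t => ?_) μ hμ
      have hp0 : p ν = 0 := hp
      have := congrArg (· * Complex.exp (ν * t)) (h t)
      simp only [hp0, Polynomial.eval_zero, zero_add, Finset.sum_mul, mul_assoc,
        ← Complex.exp_add, zero_mul] at this
      rw [← this]
      refine Finset.sum_congr rfl fun μ _ => ?_
      congr 2
      ring
    | succ n ihn =>
      intro p hp h
      let p' : ℂ → Polynomial ℂ := fun μ =>
        Polynomial.derivative (p μ) + Polynomial.C (μ - ν) * p μ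
      have h' : ∀ μ ∈ T, p' μ = 0 := by
        refine ihn p' ?_ fun t => ?_
        · simp only [p', sub_self, map_zero, zero_mul, add_zero]
          exact hp
        · have hd : HasDerivAt (fun t : ℂ => (p ν).eval t +
              ∑ μ ∈ T, (p μ).eval t * Complex.exp ((μ - ν) * t))
              ((Polynomial.derivative (p ν)).eval t +
              ∑ μ ∈ T, ((Polynomial.derivative (p μ)).eval t * Complex.exp ((μ - ν) * t) +
                (p μ).eval t * (Complex.exp ((μ - ν) * t) * (μ - ν)))) t := by
            refine ((p ν).hasDerivAt t).add (HasDerivAt.fun_sum fun μ _ => ?_)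
            refine ((p μ).hasDerivAt t).mul ?_
            simpa using ((hasDerivAt_id t).const_mul (μ - ν)).cexp
          have h0 : (fun t : ℂ => (p ν).eval t +
              ∑ μ ∈ T, (p μ).eval t * Complex.exp ((μ - ν) * t)) = fun _ => 0 :=
            _root_.funext h
          rw [h0] at hd
          have := hd.unique (hasDerivAt_const t (0 : ℂ))
          rw [← this]
          simp only [p', sub_self, map_zero, zero_mul, add_zero]
          congr 1
          refine Finset.sum_congr rfl fun μ _ => ?_
          simp
          ring
      intro μ hμ
      refine Polynomial.eq_zero_of_derivative_add_smul_eq_zero ?_ (h' μ hμ)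
      rw [sub_ne_zero]
      rintro rfl
      exact hν hμ

/-! ### Replicas, Jordan decomposition and the radical of the trace form -/

namespace AlgGroup

variable {M : ℕ}

/-- The evaluation of exponential polynomials, `t ↦ ∑ p_μ(t) e^{μ t}`, with the polynomial variable
and the exponents specialised independently. -/
noncomputable def evalExpPoly (ψ : ℂ →+ ℂ) (τ : ℂ) :
    AddMonoidAlgebra (Polynomial ℂ) ℂ →ₐ[ℂ] ℂ :=
  AddMonoidAlgebra.liftNCAlgHom (Polynomial.aeval τ)
    { toFun := fun μ => Complex.exp (ψ μ.toAdd)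
      map_one' := by simp
      map_mul' := fun a b => by simp [Complex.exp_add] } fun _ _ => Commute.all _ _

theorem evalExpPoly_single (ψ : ℂ →+ ℂ) (τ μ : ℂ) (p : Polynomial ℂ) :
    evalExpPoly ψ τ (AddMonoidAlgebra.single μ p) = p.eval τ * Complex.exp (ψ μ) := by
  simp [evalExpPoly, Polynomial.aeval_def, Polynomial.eval₂_eq_eval_map]

/-- A formal exponential polynomial is determined by the function it defines. An identity along `t`
therefore holds formally, and the variable and the exponents may then be specialised separately. -/
theorem eq_zero_of_forall_evalExpPoly (r : AddMonoidAlgebra (Polynomial ℂ) ℂ)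
    (h : ∀ t : ℂ, evalExpPoly (AddMonoidHom.mulRight t) t r = 0) : r = 0 := by
  have key : ∀ t : ℂ, ∑ μ ∈ r.coeff.support, (r.coeff μ).eval t * Complex.exp (μ * t) = 0 := by
    intro t
    rw [← h t]
    conv_rhs => rw [← AddMonoidAlgebra.sum_coeff_single r]
    rw [Finsupp.sum, map_sum]
    exact Finset.sum_congr rfl fun μ _ => by rw [evalExpPoly_single, AddMonoidHom.mulRight_apply]
  have h0 := Polynomial.eq_zero_of_sum_mul_exp_eq_zero _ _ key
  ext1
  refine Finsupp.ext fun μ => ?_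
  by_cases hμ : μ ∈ r.coeff.support
  · exact h0 μ hμ
  · simpa using hμ

theorem exp_conj_diagonal (P : GeneralLinearGroup (Fin M) ℂ) (μ : Fin M → ℂ) :
    exp (P.val * Matrix.diagonal μ * P⁻¹.val) =
      P.val * Matrix.diagonal (fun i => Complex.exp (μ i)) * P⁻¹.val := by
  have h := Matrix.exp_units_conj P (Matrix.diagonal μ)
  rw [Matrix.exp_diagonal] at h
  rw [h]
  congr 3
  ext i
  rw [Pi.coe_exp, Complex.exp_eq_exp_ℂ]

/-- The replica `φ(s)` of the semisimple part `s` of an element of the Lie algebra of a closed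
linear group belongs to that Lie algebra. -/
theorem replica_mem_tangentSpace {K : Subgroup (GeneralLinearGroup (Fin M) ℂ)}
    {hK : IsClosed[zariski (glRing M)] (K : Set (GeneralLinearGroup (Fin M) ℂ))}
    (P : GeneralLinearGroup (Fin M) ℂ) (μ : Fin M → ℂ) (n : Matrix (Fin M) (Fin M) ℂ)
    (hn : IsNilpotent n) (hcomm : Commute (P.val * Matrix.diagonal μ * P⁻¹.val) n)
    (hx : P.val * Matrix.diagonal μ * P⁻¹.val + n ∈ tangentSpace K hK) (φ : ℂ →+ ℂ) :
    P.val * Matrix.diagonal (fun i => φ (μ i)) * P⁻¹.val ∈ tangentSpace K hK := by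
  obtain ⟨k, hk⟩ := hn
  have hpow : ∀ c τ : ℂ, exp ((c * τ) • n) = ∑ i ∈ Finset.range k,
      ((i.factorial : ℂ)⁻¹) • (c * τ) ^ i • n ^ i := fun c s => by
    rw [NormedSpace.exp_eq_sum_range (k := k) (by rw [smul_pow, hk, smul_zero])]
    simp only [smul_pow]
  -- `E` and `D` are the formal exponentials of the nilpotent and semisimple parts, `c = -1` serving
  -- the inverses. A regular function vanishing on `K` gives an element of `R` that vanishes on the
  -- one-parameter group of `s + n`, hence is zero.
  let R := AddMonoidAlgebra (Polynomial ℂ) ℂ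
  let E : ℂ → Matrix (Fin M) (Fin M) R := fun c => Matrix.of fun a b =>
    AddMonoidAlgebra.single (0 : ℂ) (∑ i ∈ Finset.range k,
      Polynomial.C ((i.factorial : ℂ)⁻¹ * c ^ i * (n ^ i) a b) * Polynomial.X ^ i)
  let D : ℂ → Matrix (Fin M) (Fin M) R := fun c =>
    P.val.map (algebraMap ℂ R) * Matrix.diagonal (fun i => AddMonoidAlgebra.single (c * μ i) 1) *
      P⁻¹.val.map (algebraMap ℂ R)
  have hE : ∀ (c : ℂ) (ψ : ℂ →+ ℂ) (τ : ℂ),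
      (E c).map (evalExpPoly ψ τ) = exp ((c * τ) • n) := by
    intro c ψ τ
    ext a b
    rw [hpow, Matrix.map_apply]
    simp only [E, Matrix.of_apply]
    rw [evalExpPoly_single, map_zero, Complex.exp_zero,
      mul_one, Matrix.sum_apply, Polynomial.eval_finsetSum]
    refine Finset.sum_congr rfl fun i _ => ?_
    simp [mul_pow]
    ring
  have hD : ∀ (c : ℂ) (ψ : ℂ →+ ℂ) (τ : ℂ), (D c).map (evalExpPoly ψ τ) =
      exp (P.val * Matrix.diagonal (fun i => ψ (c * μ i)) * P⁻¹.val) := by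
    intro c ψ τ
    rw [exp_conj_diagonal]
    simp only [D]
    rw [Matrix.map_mul, Matrix.map_mul, Matrix.map_map, Matrix.map_map,
      Matrix.diagonal_map (map_zero _)]
    have hmap : ∀ Q : Matrix (Fin M) (Fin M) ℂ,
        Q.map (evalExpPoly ψ τ ∘ algebraMap ℂ (AddMonoidAlgebra (Polynomial ℂ) ℂ)) = Q := by
      intro Q
      ext a b
      exact (evalExpPoly ψ τ).commutes _
    rw [hmap, hmap]
    congr 3
    ext i
    exact (evalExpPoly_single ψ τ _ 1).trans (by simp)
  have hneg : ∀ ψ : ℂ →+ ℂ, P.val * Matrix.diagonal (fun i => ψ (-1 * μ i)) * P⁻¹.val =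
      -(P.val * Matrix.diagonal (fun i => ψ (1 * μ i)) * P⁻¹.val) := by
    intro ψ
    have : (fun i => ψ (-1 * μ i)) = fun i => -ψ (1 * μ i) := by
      ext i
      simp
    rw [this, ← Matrix.diagonal_neg, mul_neg, neg_mul]
  let g : (ℂ →+ ℂ) × ℂ → GeneralLinearGroup (Fin M) ℂ := fun w =>
    expGL (P.val * Matrix.diagonal (fun i => w.1 (1 * μ i)) * P⁻¹.val) * expGL ((1 * w.2) • n)
  have hsmul : ∀ (t : ℂ) (ψ : ℂ →+ ℂ),
      P.val * Matrix.diagonal (fun i => ((AddMonoidHom.mulRight t).comp ψ) (1 * μ i)) * P⁻¹.val =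
      t • (P.val * Matrix.diagonal (fun i => ψ (μ i)) * P⁻¹.val) := by
    intro t ψ
    rw [← smul_mul_assoc, ← mul_smul_comm, ← Matrix.diagonal_smul]
    congr 3
    ext i
    simp [mul_comm]
  intro t
  by_contra hne
  obtain ⟨q, hq, hqg, h0⟩ := (isClosed_zariski_iff _ _).1 hK _ hne
  obtain ⟨r, hr⟩ := exists_eval_eq (R := R) (fun w : (ℂ →+ ℂ) × ℂ => evalExpPoly w.1 w.2) g
    (D 1 * E 1) (E (-1) * D (-1))
    (fun w i j => by
      rw [← Matrix.map_apply (f := evalExpPoly w.1 w.2), Matrix.map_mul, hE, hD]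
      rfl)
    (fun w i j => by
      rw [← Matrix.map_apply (f := evalExpPoly w.1 w.2), Matrix.map_mul, hE, hD, hneg,
        _root_.mul_inv_rev, Units.val_mul, expGL_inv_val, expGL_inv_val, neg_one_mul, one_mul,
        neg_smul]) hq
  have hr0 : r = 0 := by
    refine eq_zero_of_forall_evalExpPoly r fun s => ?_
    rw [← hr (AddMonoidHom.mulRight s, s)]
    have hg : g (AddMonoidHom.mulRight s, s) =
        expGL (s • (P.val * Matrix.diagonal μ * P⁻¹.val + n)) := by
      have h1 := hsmul s (AddMonoidHom.id ℂ)
      rw [AddMonoidHom.comp_id] at h1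
      simp only [g]
      rw [h1, one_mul, smul_add, expGL_add]
      · rfl
      · exact (hcomm.smul_left s).smul_right s
    rw [hg]
    exact h0 _ (hx s)
  apply hqg
  -- Setting the polynomial variable to `0` removes the nilpotent part, while the exponents are
  -- transformed by `t φ`.
  have hg : g ((AddMonoidHom.mulRight t).comp φ, 0) =
      expGL (t • (P.val * Matrix.diagonal (fun i => φ (μ i)) * P⁻¹.val)) := by
    simp only [g, hsmul]
    rw [mul_zero, zero_smul, expGL_zero, mul_one]
  rw [← hg, hr, hr0, map_zero]

/-- A semisimple complex matrix is diagonalizable. -/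
theorem exists_eq_conj_diagonal (s : Matrix (Fin M) (Fin M) ℂ)
    (hs : Module.End.IsSemisimple (Matrix.toLin' s)) :
    ∃ (P : GeneralLinearGroup (Fin M) ℂ) (μ : Fin M → ℂ),
      s = P.val * Matrix.diagonal μ * P⁻¹.val := by
  classical
  let f : Module.End ℂ (Fin M → ℂ) := Matrix.toLin' s
  let eigenDecomp := DirectSum.isInternal_submodule_of_iSupIndep_of_iSup_eq_top
    f.eigenspaces_iSupIndep hs.iSup_eigenspace_eq_top
  let I := (ν : ℂ) × Fin (Module.finrank ℂ (f.eigenspace ν))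
  let v : Module.Basis I ℂ (Fin M → ℂ) :=
    eigenDecomp.collectedBasis fun μ ↦ Module.finBasis ℂ (f.eigenspace μ)
  have hv (i : I) : f (v i) = i.1 • v i :=
    Module.End.mem_eigenspace_iff.mp (eigenDecomp.collectedBasis_mem _ i)
  let e : I ≃ Fin M := v.indexEquiv (Pi.basisFun ℂ (Fin M))
  let b := v.reindex e
  let μ : Fin M → ℂ := fun i => (e.symm i).1
  have hb (i : Fin M) : f (b i) = μ i • b i := by
    simp only [b, Module.Basis.reindex_apply, μ]
    exact hv _
  let A := (Pi.basisFun ℂ (Fin M)).toMatrix b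
  let B := b.toMatrix (Pi.basisFun ℂ (Fin M))
  have hAB : A * B = 1 := Module.Basis.toMatrix_mul_toMatrix_flip _ _
  have hBA : B * A = 1 := Module.Basis.toMatrix_mul_toMatrix_flip _ _
  refine ⟨⟨A, B, hAB, hBA⟩, μ, ?_⟩
  have hsA : s * A = A * Matrix.diagonal μ := by
    ext i j
    have hA : ∀ i j, A i j = b j i := fun _ _ => rfl
    rw [Matrix.mul_diagonal, Matrix.mul_apply]
    simp only [hA]
    exact (congrFun (hb j) i).trans (mul_comm _ _)
  calc s = s * (A * B) := by rw [hAB, mul_one]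
    _ = A * Matrix.diagonal μ * B := by rw [← mul_assoc, hsA]

/-- The Jordan–Chevalley decomposition of a matrix. -/
theorem exists_jordan (x : Matrix (Fin M) (Fin M) ℂ) :
    ∃ (P : GeneralLinearGroup (Fin M) ℂ) (μ : Fin M → ℂ) (n : Matrix (Fin M) (Fin M) ℂ),
      IsNilpotent n ∧ Commute (P.val * Matrix.diagonal μ * P⁻¹.val) n ∧
      x = P.val * Matrix.diagonal μ * P⁻¹.val + n := by
  obtain ⟨n, hn, s, hs, hnil, hss, he⟩ :=
    Module.End.exists_isNilpotent_isSemisimple (f := Matrix.toLin' x)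
  have hc : Commute n s := Algebra.commute_of_mem_adjoin_singleton_of_commute hs
    (Algebra.commute_of_mem_adjoin_self hn).symm
  obtain ⟨n', rfl⟩ := (Matrix.toLin' (R := ℂ) (m := Fin M) (n := Fin M)).surjective n
  obtain ⟨s', rfl⟩ := (Matrix.toLin' (R := ℂ) (m := Fin M) (n := Fin M)).surjective s
  obtain ⟨P, μ, hP⟩ := exists_eq_conj_diagonal s' hss
  refine ⟨P, μ, n', ?_, ?_, ?_⟩
  · obtain ⟨k, hk⟩ := hnil
    refine ⟨k, Matrix.toLin'.injective ?_⟩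
    rw [Matrix.toLin'_pow, hk, map_zero]
  · rw [← hP]
    refine Matrix.toLin'.injective ?_
    rw [Matrix.toLin'_mul, Matrix.toLin'_mul]
    exact hc.symm
  · rw [← hP, add_comm]
    refine Matrix.toLin'.injective ?_
    rw [he, map_add]

/-- In the eigenbasis, a commuting matrix has nonzero entries only where `μ i = μ j`, and there `φ
(μ i) = φ (μ j)`. -/
theorem commute_conj_diagonal {P : GeneralLinearGroup (Fin M) ℂ} {μ : Fin M → ℂ}
    {n : Matrix (Fin M) (Fin M) ℂ} (h : Commute (P.val * Matrix.diagonal μ * P⁻¹.val) n)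
    (φ : ℂ → ℂ) : Commute (P.val * Matrix.diagonal (fun i => φ (μ i)) * P⁻¹.val) n := by
  have h1 : P⁻¹.val * P.val = 1 := P.inv_mul
  have h2 : P.val * P⁻¹.val = 1 := P.mul_inv
  obtain ⟨m, hn⟩ : ∃ m, n = P.val * m * P⁻¹.val := by
    refine ⟨P⁻¹.val * n * P.val, ?_⟩
    calc n = (P.val * P⁻¹.val) * n * (P.val * P⁻¹.val) := by rw [h2, one_mul, mul_one]
      _ = _ := by noncomm_ring
  have hconj : ∀ a b : Matrix (Fin M) (Fin M) ℂ, (P.val * a * P⁻¹.val) * (P.val * b * P⁻¹.val) =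
      P.val * (a * b) * P⁻¹.val := fun a b => by
    calc _ = P.val * a * (P⁻¹.val * P.val) * b * P⁻¹.val := by noncomm_ring
      _ = _ := by rw [h1, mul_one]; noncomm_ring
  have hinj : ∀ a b : Matrix (Fin M) (Fin M) ℂ, P.val * a * P⁻¹.val = P.val * b * P⁻¹.val →
      a = b := fun a b hab => by
    have := congrArg (fun z => P⁻¹.val * z * P.val) hab
    simp only [← mul_assoc, h1, one_mul] at this
    simpa only [mul_assoc, h1, mul_one] using this
  have hd : Matrix.diagonal μ * m = m * Matrix.diagonal μ := by
    refine hinj _ _ ?_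
    rw [← hconj, ← hconj, ← hn]
    exact h
  rw [hn, Commute, SemiconjBy, hconj, hconj]
  congr 2
  ext i j
  have := congrFun (congrFun hd i) j
  rw [Matrix.diagonal_mul, Matrix.mul_diagonal] at this ⊢
  by_cases h0 : m i j = 0
  · simp [h0]
  · have : μ i = μ j := mul_right_cancel₀ h0 (this.trans (mul_comm _ _))
    rw [this, mul_comm]

/-- An element of the Lie algebra of a closed linear group which is orthogonal to that Lie algebra
for the trace form is nilpotent. -/
theorem isNilpotent_of_trace_eq_zero {K : Subgroup (GeneralLinearGroup (Fin M) ℂ)}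
    {hK : IsClosed[zariski (glRing M)] (K : Set (GeneralLinearGroup (Fin M) ℂ))}
    {x : Matrix (Fin M) (Fin M) ℂ} (hx : x ∈ tangentSpace K hK)
    (h : ∀ y ∈ tangentSpace K hK, (x * y).trace = 0) : IsNilpotent x := by
  obtain ⟨P, μ, n, hn, hc, rfl⟩ := exists_jordan x
  -- Pairing `x` with the complex conjugate replica of its semisimple part gives the sum of the `|μ
  -- i|²`, as the nilpotent part contributes no trace. Hence all eigenvalues vanish.
  have hy := replica_mem_tangentSpace P μ n hn hc hx (starRingEnd ℂ).toAddMonoidHom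
  have h0 := h _ hy
  have hcn := commute_conj_diagonal hc (starRingEnd ℂ)
  have h1 : P⁻¹.val * P.val = 1 := P.inv_mul
  rw [add_mul, Matrix.trace_add] at h0
  have hnt : (n * (P.val * Matrix.diagonal (fun i => (starRingEnd ℂ) (μ i)) * P⁻¹.val)).trace
      = 0 :=
    (Matrix.isNilpotent_trace_of_isNilpotent (hcn.symm.isNilpotent_mul_right hn)).eq_zero
  have hst : (P.val * Matrix.diagonal μ * P⁻¹.val *
      (P.val * Matrix.diagonal (fun i => (starRingEnd ℂ) (μ i)) * P⁻¹.val)).trace =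
      ∑ i, μ i * (starRingEnd ℂ) (μ i) := by
    have : P.val * Matrix.diagonal μ * P⁻¹.val *
        (P.val * Matrix.diagonal (fun i => (starRingEnd ℂ) (μ i)) * P⁻¹.val) =
        P.val * (Matrix.diagonal (fun i => μ i * (starRingEnd ℂ) (μ i)) * P⁻¹.val) := by
      calc _ = P.val * Matrix.diagonal μ * (P⁻¹.val * P.val) *
            Matrix.diagonal (fun i => (starRingEnd ℂ) (μ i)) * P⁻¹.val := by noncomm_ring
        _ = _ := by rw [h1, mul_one, mul_assoc P.val, Matrix.diagonal_mul_diagonal, mul_assoc]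
    rw [this, Matrix.trace_mul_comm, mul_assoc, h1, mul_one, Matrix.trace_diagonal]
  have hsum : ∑ i, Complex.normSq (μ i) = 0 := by
    have h2 : ∑ i, μ i * (starRingEnd ℂ) (μ i) = 0 := by
      rw [← hst, ← h0]
      symm
      exact add_eq_left.2 hnt
    simp only [Complex.mul_conj] at h2
    exact_mod_cast h2
  have hμ : μ = 0 := by
    ext i
    have := (Finset.sum_eq_zero_iff_of_nonneg fun i _ => Complex.normSq_nonneg (μ i)).1 hsum i
      (Finset.mem_univ i)
    simpa using this
  rw [hμ]
  simpa using hn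

/-- The subgroup of the elements of `H` acting trivially on the graded pieces of the flag of `P`. -/
def flagSubgroup (H : Subgroup (GeneralLinearGroup (Fin M) ℂ))
    (P : Submodule ℂ (Matrix (Fin M) (Fin M) ℂ))
    (hH : ∀ g ∈ H, ∀ i, ∀ v ∈ descendingFlag P i, g.val *ᵥ v ∈ descendingFlag P i) :
    Subgroup H where
  carrier := {u | ∀ i, ∀ v ∈ descendingFlag P i, (u.1.val - 1) *ᵥ v ∈ descendingFlag P (i + 1)}
  one_mem' := fun i v _ => by simp
  mul_mem' := by
    intro a b ha hb i v hv
    have h1 : ((a * b : H).1.val - 1) = a.1.val * (b.1.val - 1) + (a.1.val - 1) := by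
      rw [Subgroup.coe_mul, Units.val_mul]
      noncomm_ring
    rw [h1, Matrix.add_mulVec, ← Matrix.mulVec_mulVec]
    exact Submodule.add_mem _ (hH _ a.2 _ _ (hb i v hv)) (ha i v hv)
  inv_mem' := by
    intro a ha i v hv
    have h1 : ((a⁻¹ : H).1.val - 1) = -((a⁻¹ : H).1.val * (a.1.val - 1)) := by
      rw [mul_sub, mul_one, Subgroup.coe_inv, ← Units.val_mul, inv_mul_cancel, Units.val_one]
      abel
    rw [h1, Matrix.neg_mulVec, ← Matrix.mulVec_mulVec]
    exact Submodule.neg_mem _ (hH _ (a⁻¹ : H).2 _ _ (ha i v hv))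

section

variable {H : Subgroup (GeneralLinearGroup (Fin M) ℂ)}
  {P : Submodule ℂ (Matrix (Fin M) (Fin M) ℂ)}
  {hHflag : ∀ g ∈ H, ∀ i, ∀ v ∈ descendingFlag P i, g.val *ᵥ v ∈ descendingFlag P i}

theorem mem_flagSubgroup {u : H} : u ∈ flagSubgroup H P hHflag ↔ ∀ i, ∀ v ∈ descendingFlag P i,
    (u.1.val - 1) *ᵥ v ∈ descendingFlag P (i + 1) := Iff.rfl

/-- Membership in a subspace is tested by the functionals in its annihilator, so the conditions are
affine linear in the entries. -/
theorem isClosed_flagSubgroup :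
    IsClosed[zariski (restrict (glRing M) H)] (flagSubgroup H P hHflag : Set H) := by
  have hdual : ∀ (W : Submodule ℂ (Fin M → ℂ)) (w : Fin M → ℂ), w ∈ W ↔
      ∀ f : Module.Dual ℂ (Fin M → ℂ), f ∈ W.dualAnnihilator → f w = 0 := fun W w =>
    (Subspace.forall_mem_dualAnnihilator_apply_eq_zero_iff W w).symm
  refine isClosed_zariski_of_forall (ι := (i : ℕ) × descendingFlag P i ×
    (descendingFlag P (i + 1)).dualAnnihilator) _ _
    (fun p => fun u : H => p.2.2.1 ((u.1.val - 1) *ᵥ p.2.1.1)) ?_ ?_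
  · rintro ⟨i, v, f⟩
    have : (fun u : H => f.1 ((u.1.val - 1) *ᵥ v.1)) =
        (∑ a, ∑ b, (f.1 (fun j => if a = j then 1 else 0) * v.1 b) • (fun u : H => u.1.val a b)) -
          (fun u : H => f.1 v.1) := by
      ext u
      rw [Matrix.sub_mulVec, Matrix.one_mulVec, map_sub, Pi.sub_apply]
      congr 1
      rw [LinearMap.pi_apply_eq_sum_univ f.1]
      simp only [Finset.sum_apply, Pi.smul_apply, smul_eq_mul, Matrix.mulVec, dotProduct,
        Finset.sum_mul]
      refine Finset.sum_congr rfl fun a _ => Finset.sum_congr rfl fun b _ => ?_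
      ring
    simp only [this]
    refine Subalgebra.sub_mem _ (Subalgebra.sum_mem _ fun a _ => Subalgebra.sum_mem _ fun b _ =>
      Subalgebra.smul_mem _ ?_ _) (Subalgebra.algebraMap_mem _ (f.1 v.1))
    exact entry_mem_pullbackRing H.subtype a b
  · intro u
    rw [SetLike.mem_coe, mem_flagSubgroup]
    constructor
    · rintro hu ⟨i, v, f⟩
      exact (hdual _ _).1 (hu i v.1 v.2) f.1 f.2
    · intro hu i v hv
      exact (hdual _ _).2 fun f hf => hu ⟨i, ⟨v, hv⟩, ⟨f, hf⟩⟩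

theorem flagSubgroup_normal : (flagSubgroup H P hHflag).Normal := by
  refine ⟨fun u hu g i v hv => ?_⟩
  have h1 : ((g * u * g⁻¹ : H).1.val - 1) =
      g.1.val * (u.1.val - 1) * (g⁻¹ : H).1.val := by
    rw [Subgroup.coe_mul, Subgroup.coe_mul, Units.val_mul, Units.val_mul, mul_sub, sub_mul,
      mul_one, ← Units.val_mul _ (g⁻¹ : H).1, ← Subgroup.coe_mul, mul_inv_cancel,
      Subgroup.coe_one, Units.val_one]
  rw [h1, ← Matrix.mulVec_mulVec, ← Matrix.mulVec_mulVec]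
  exact hHflag _ g.2 _ _ (hu i _ (hHflag _ (g⁻¹ : H).2 _ _ hv))

/-- A closed subgroup consisting of unipotent elements is connected. -/
theorem isConnected_of_isNilpotent
    (hH : IsClosed[zariski (glRing M)] (H : Set (GeneralLinearGroup (Fin M) ℂ))) (N : Subgroup H)
    (hN : IsClosed[zariski (restrict (glRing M) H)] (N : Set H))
    (hu : ∀ u ∈ N, IsNilpotent (u.1.val - 1)) :
    @IsConnected H (zariski (restrict (glRing M) H)) (N : Set H) := by
  have hNclosed := isClosed_image_of_isClosed H.subtype
    (by rwa [← MonoidHom.coe_range, Subgroup.range_subtype]) N hN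
  refine isConnected_zariski_of_paths _ N fun u huN => ?_
  obtain ⟨y, hy, hyu⟩ := exists_expGL_eq u.1 (hu u huN)
  have hmem : ∀ t : ℂ, expGL (t • y) ∈ N.map H.subtype := fun t =>
    expGL_smul_mem_of_isNilpotent hNclosed hy (hyu ▸ ⟨u, huN, rfl⟩) t
  choose γ hγN hγ using hmem
  refine ⟨γ, hγN, ?_, ?_, ?_⟩
  · refine Subtype.ext ?_
    have := hγ 0
    rw [zero_smul, expGL_zero] at this
    exact this
  · refine Subtype.ext ?_
    have := hγ 1
    rw [one_smul, hyu] at this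
    exact this
  · rintro f hf
    rw [restrict_glRing] at hf
    obtain ⟨q, hq, rfl⟩ := mem_pullbackRing.1 hf
    simp only [hγ]
    refine continuous_of_mem_glRing (γ := fun t : ℂ => expGL (t • y)) (continuous_exp_smul y) ?_ hq
    simp only [expGL_inv_val, ← smul_neg]
    exact continuous_exp_smul (-y)

/-- Write `exp x - 1` as `x` times a polynomial in `x`: the polynomial preserves the flag and the
factor `x` lowers it. -/
theorem expGL_mem_flagSubgroup (hlie : ∀ a ∈ P, ∀ b ∈ P, a * b - b * a ∈ P)
    {x : Matrix (Fin M) (Fin M) ℂ} (hx : x ∈ P) (hnil : IsNilpotent x) (hxH : expGL x ∈ H) :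
    (⟨expGL x, hxH⟩ : H) ∈ flagSubgroup H P hHflag := by
  intro i v hv
  obtain ⟨k, hk⟩ := hnil
  have hk' : x ^ (k + 1) = 0 := by rw [pow_succ, hk, zero_mul]
  have hst : ∀ j : ℕ, ∀ v ∈ descendingFlag P i, x ^ j *ᵥ v ∈ descendingFlag P i := by
    intro j
    induction j with
    | zero => simp
    | succ j ih =>
      intro v hv
      rw [pow_succ, ← Matrix.mulVec_mulVec]
      refine ih _ (mulVec_mem_descendingFlag_of_normalize (fun a ha => ?_) i v hv)
      exact ⟨a, ha, _, hlie _ hx a ha, by abel⟩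
  have hsum : exp x - 1 =
      x * ∑ j ∈ Finset.range k, (((j + 1).factorial : ℂ)⁻¹) • x ^ j := by
    rw [NormedSpace.exp_eq_sum_range hk', Finset.sum_range_succ', Finset.mul_sum]
    simp [pow_succ']
  change (exp x - 1) *ᵥ v ∈ _
  rw [hsum, ← Matrix.mulVec_mulVec]
  refine mulVec_mem_descendingFlag hx ?_
  rw [Matrix.sum_mulVec]
  refine Submodule.sum_mem _ fun j _ => ?_
  rw [Matrix.smul_mulVec]
  exact Submodule.smul_mem _ _ (hst j v hv)

theorem eq_zero_of_forall_expGL_eq_one {x : Matrix (Fin M) (Fin M) ℂ}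
    (h : ∀ t : ℂ, expGL (t • x) = 1) : x = 0 := by
  have := tendsto_slope_exp x
  have h0 : ∀ t : ℂ, t⁻¹ • (exp (t • x) - 1) = 0 := fun t => by
    rw [← expGL_val, h t, Units.val_one, sub_self, smul_zero]
  simp only [h0] at this
  exact tendsto_nhds_unique this tendsto_const_nhds

end

/-- The radical of the trace form on the Lie algebra of a closed linear group. -/
def traceRadical {H : Subgroup (GeneralLinearGroup (Fin M) ℂ)}
    (hH : IsClosed[zariski (glRing M)] (H : Set (GeneralLinearGroup (Fin M) ℂ))) :
    Submodule ℂ (Matrix (Fin M) (Fin M) ℂ) where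
  carrier := {x | x ∈ tangentSpace H hH ∧ ∀ y ∈ tangentSpace H hH, (x * y).trace = 0}
  zero_mem' := ⟨Submodule.zero_mem _, fun y _ => by simp⟩
  add_mem' := fun {a b} ha hb => ⟨Submodule.add_mem _ ha.1 hb.1, fun y hy => by
    rw [add_mul, Matrix.trace_add, ha.2 y hy, hb.2 y hy, add_zero]⟩
  smul_mem' := fun c a ha => ⟨Submodule.smul_mem _ c ha.1, fun y hy => by
    rw [smul_mul_assoc, Matrix.trace_smul, ha.2 y hy, smul_zero]⟩

/-- The trace form on the Lie algebra of a reductive linear group is nondegenerate. -/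
theorem trace_nondegenerate_of_isReductive {H : Subgroup (GeneralLinearGroup (Fin M) ℂ)}
    (hH : IsClosed[zariski (glRing M)] (H : Set (GeneralLinearGroup (Fin M) ℂ)))
    (hred : IsReductive (restrict (glRing M) H)) {x : Matrix (Fin M) (Fin M) ℂ}
    (hx : x ∈ tangentSpace H hH) (h : ∀ y ∈ tangentSpace H hH, (x * y).trace = 0) : x = 0 := by
  have hHn : ∀ g ∈ H, ∀ n ∈ H, g * n * g⁻¹ ∈ H :=
    fun g hg n hn => H.mul_mem (H.mul_mem hg hn) (H.inv_mem hg)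
  have hPnil : ∀ a ∈ traceRadical hH, IsNilpotent a :=
    fun a ha => isNilpotent_of_trace_eq_zero ha.1 ha.2
  have hPlie : ∀ a ∈ traceRadical hH, ∀ b ∈ traceRadical hH, a * b - b * a ∈ traceRadical hH := by
    intro a ha b hb
    refine ⟨lie_mem_tangentSpace hHn ha.1 hb.1, fun y hy => ?_⟩
    -- Invariance of the trace form, which makes its radical an ideal.
    have h1 : ((a * b - b * a) * y).trace = (a * (b * y - y * b)).trace := by
      rw [sub_mul, mul_sub, Matrix.trace_sub, Matrix.trace_sub, mul_assoc, mul_assoc,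
        ← mul_assoc a y b, Matrix.trace_mul_comm b (a * y)]
    rw [h1]
    exact ha.2 _ (lie_mem_tangentSpace hHn hb.1 hy)
  have hPconj : ∀ g ∈ H, ∀ a ∈ traceRadical hH, g.val * a * g⁻¹.val ∈ traceRadical hH := by
    intro g hg a ha
    refine ⟨conj_mem_tangentSpace (hHn g hg) ha.1, fun y hy => ?_⟩
    have h1 : (g.val * a * g⁻¹.val * y).trace = (a * (g⁻¹.val * y * g⁻¹⁻¹.val)).trace := by
      rw [mul_assoc g.val, mul_assoc g.val, Matrix.trace_mul_comm, inv_inv]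
      simp only [mul_assoc]
    rw [h1]
    exact ha.2 _ (conj_mem_tangentSpace (hHn _ (H.inv_mem hg)) hy)
  have hHflag : ∀ g ∈ H, ∀ i, ∀ v ∈ descendingFlag (traceRadical hH) i,
      g.val *ᵥ v ∈ descendingFlag (traceRadical hH) i := by
    intro g hg i
    refine mulVec_mem_descendingFlag_of_normalize (fun a ha => ?_) i
    refine ⟨_, hPconj g hg a ha, 0, Submodule.zero_mem _, ?_⟩
    rw [add_zero, mul_assoc, ← Units.val_mul, inv_mul_cancel, Units.val_one, mul_one]
  have hNu : ∀ u ∈ flagSubgroup H (traceRadical hH) hHflag, IsNilpotent (u.1.val - 1) :=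
    fun u hu => isNilpotent_of_descendingFlag (exists_descendingFlag_eq_bot _ hPlie hPnil) hu
  -- The flag subgroup of the radical is closed, connected, normal and unipotent, hence trivial, yet
  -- it contains the exponentials of the radical.
  have hbot := hred.isUnipotentRadical_bot.le_of_isConnectedNormalUnipotent
    (flagSubgroup H (traceRadical hH) hHflag) ⟨isClosed_flagSubgroup,
      isConnected_of_isNilpotent hH _ isClosed_flagSubgroup hNu, flagSubgroup_normal,
      fun g hg => (isUnipotentElement_pullbackRing_iff H.subtype g).2 (hNu g hg)⟩
  refine eq_zero_of_forall_expGL_eq_one fun t => ?_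
  have hxP : t • x ∈ traceRadical hH := Submodule.smul_mem _ t ⟨hx, h⟩
  exact congrArg Subtype.val (Subgroup.mem_bot.1
    (hbot (expGL_mem_flagSubgroup hPlie hxP (hPnil _ hxP) (hx t))))

end AlgGroup

end

section

/-! ### Complete reducibility for semisimple Lie algebras -/

namespace LieModule

open LieAlgebra

universe u

variable {L : Type*} [LieRing L] [LieAlgebra ℂ L]

/-- Brackets in the Killing complement of `[L, L]` lie both in `[L, L]` and in the complement, so
the complement is an abelian ideal, hence zero. -/
theorem derivedSeries_one_eq_top [FiniteDimensional ℂ L] [IsKilling ℂ L] :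
    derivedSeries ℂ L 1 = ⊤ := by
  have hD : derivedSeries ℂ L 1 = ⁅(⊤ : LieIdeal ℂ L), (⊤ : LieIdeal ℂ L)⁆ := rfl
  set D := derivedSeries ℂ L 1
  have hc := LieIdeal.isCompl_killingCompl D
  have : IsLieAbelian (LieIdeal.killingCompl ℂ L D) := by
    rw [LieSubmodule.lie_abelian_iff_lie_self_eq_bot, eq_bot_iff]
    refine le_trans (le_inf ?_ ?_) hc.1.eq_bot.le
    · rw [hD]
      exact LieSubmodule.mono_lie le_top le_top
    · exact LieSubmodule.lie_le_right _ _
  have h0 := IsKilling.ideal_eq_bot_of_isLieAbelian (LieIdeal.killingCompl ℂ L D)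
  have := hc.2.eq_top
  rwa [h0, sup_bot_eq] at this

section

variable {W : Type u} [AddCommGroup W] [Module ℂ W] [LieRingModule L W] [LieModule ℂ L W]

/-- The Casimir operator of two families of elements of a Lie algebra. -/
noncomputable def casimir (W : Type u) [AddCommGroup W] [Module ℂ W] [LieRingModule L W]
    [LieModule ℂ L W] {ι : Type*} [Fintype ι] (b b' : ι → L) : Module.End ℂ W :=
  ∑ i, (toEnd ℂ L W (b i)) ∘ₗ (toEnd ℂ L W (b' i))

theorem casimir_apply {ι : Type*} [Fintype ι] (b b' : ι → L) (w : W) :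
    casimir W b b' w = ∑ i, ⁅b i, ⁅b' i, w⁆⁆ := by
  simp [casimir]

/-- The coefficients of `ad z` on `b'` are minus the transpose of those on `b`, as for dual bases of
an invariant form, so the extra Leibniz terms cancel. -/
theorem lie_casimir_apply {ι : Type*} [Fintype ι] (b b' : ι → L) (a : ι → ι → ℂ) (z : L)
    (h : ∀ i, ⁅z, b i⁆ = ∑ j, a i j • b j) (h' : ∀ i, ⁅z, b' i⁆ = -∑ j, a j i • b' j) (w : W) :
    ⁅z, casimir W b b' w⁆ = casimir W b b' ⁅z, w⁆ := by
  rw [casimir_apply, casimir_apply, lie_sum]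
  have h1 : ∀ i, ⁅z, ⁅b i, ⁅b' i, w⁆⁆⁆ =
      ∑ j, a i j • ⁅b j, ⁅b' i, w⁆⁆ - ∑ j, a j i • ⁅b i, ⁅b' j, w⁆⁆ + ⁅b i, ⁅b' i, ⁅z, w⁆⁆⁆ := by
    intro i
    rw [leibniz_lie z (b i), leibniz_lie z (b' i) w, h, h', sum_lie, neg_lie, sum_lie, lie_add,
      lie_neg, lie_sum]
    simp only [smul_lie, lie_smul]
    abel
  simp only [h1]
  rw [Finset.sum_add_distrib, Finset.sum_sub_distrib, Finset.sum_comm, sub_self, zero_add]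

variable (L W) in
/-- The kernel of the trace form. -/
noncomputable def traceFormKer : LieIdeal ℂ L where
  carrier := {x | ∀ y, traceForm ℂ L W x y = 0}
  zero_mem' y := by simp
  add_mem' hx hy z := by rw [map_add, LinearMap.add_apply, hx z, hy z, add_zero]
  smul_mem' c x hx z := by rw [map_smul, LinearMap.smul_apply, hx z, smul_zero]
  lie_mem := by
    intro x y hy z
    rw [traceForm_apply_lie_apply']
    rw [hy, neg_zero]

variable [FiniteDimensional ℂ L] [IsKilling ℂ L]

/-- A zero trace form makes the derived algebra act nilpotently, and here that is all of `L`. Since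
`L = [L, L]`, the image of the action lies in every term of the lower central series, hence is zero.
-/
theorem lie_eq_zero_of_traceForm_eq_zero [FiniteDimensional ℂ W] (h : traceForm ℂ L W = 0)
    (x : L) (w : W) : ⁅x, w⁆ = 0 := by
  have hD := isNilpotent_derivedSeries_of_traceForm_eq_zero h
  rw [isNilpotent_iff_forall' (R := ℂ)] at hD
  have hnil : LieModule.IsNilpotent L W := by
    rw [isNilpotent_iff_forall' (R := ℂ)]
    intro y
    have hy : y ∈ derivedSeries ℂ L 1 := by
      rw [derivedSeries_one_eq_top]
      exact LieSubmodule.mem_top y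
    exact hD ⟨y, hy⟩
  obtain ⟨k, hk⟩ := (isNilpotent_iff ℂ L W).1 hnil
  have key : ∀ n : ℕ, ∀ (x : L) (w : W), ⁅x, w⁆ ∈ lowerCentralSeries ℂ L W n := by
    intro n
    induction n with
    | zero => intro x w; simp
    | succ n ih =>
      intro x w
      have hx : x ∈ (⁅(⊤ : LieIdeal ℂ L), (⊤ : LieIdeal ℂ L)⁆ : LieIdeal ℂ L) := by
        have : derivedSeries ℂ L 1 = ⁅(⊤ : LieIdeal ℂ L), (⊤ : LieIdeal ℂ L)⁆ := rfl
        rw [← this, derivedSeries_one_eq_top]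
        exact LieSubmodule.mem_top x
      rw [← LieSubmodule.mem_toSubmodule, LieSubmodule.lieIdeal_oper_eq_linear_span'] at hx
      rw [lowerCentralSeries_succ]
      induction hx using Submodule.span_induction with
      | mem x hx =>
        obtain ⟨y, -, z, -, rfl⟩ := hx
        rw [lie_lie]
        exact sub_mem
          (LieSubmodule.lie_mem_lie (LieSubmodule.mem_top y) (ih z w))
          (LieSubmodule.lie_mem_lie (LieSubmodule.mem_top z) (ih y w))
      | zero => simp
      | add a b _ _ ha hb =>
        rw [add_lie]
        exact add_mem ha hb
      | smul c a _ ha =>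
        rw [smul_lie]
        exact SMulMemClass.smul_mem c ha
  have := key k x w
  rwa [hk, LieSubmodule.mem_bot] at this

/-- The trace form need not be faithful on `L`, but it is nondegenerate on the Killing complement of
its kernel. Dual bases of that ideal give a Casimir operator whose trace is the dimension of the
ideal. -/
theorem exists_casimir (h : traceForm ℂ L W ≠ 0) : ∃ (n : ℕ) (b b' : Fin n → L), n ≠ 0 ∧
    LinearMap.trace ℂ W (casimir W b b') = n ∧
    ∀ (z : L) (w : W), ⁅z, casimir W b b' w⁆ = casimir W b b' ⁅z, w⁆ := by
  let P := LieIdeal.killingCompl ℂ L (traceFormKer L W)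
  have hc : IsCompl (traceFormKer L W) P := LieIdeal.isCompl_killingCompl _
  let B : LinearMap.BilinForm ℂ P := (traceForm ℂ L W).compl₁₂ P.toSubmodule.subtype
    P.toSubmodule.subtype
  have hB : ∀ x y : P, B x y = traceForm ℂ L W x y := fun x y => rfl
  have hsymm : B.IsSymm := ⟨fun x y => traceForm_comm ℂ L W x y⟩
  have hker : ∀ x : P, (∀ y, B x y = 0) → x = 0 := by
    intro x hx
    have hmem : (x : L) ∈ traceFormKer L W := by
      intro y
      have hy : y ∈ (traceFormKer L W ⊔ P : LieIdeal ℂ L) := by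
        rw [hc.2.eq_top]
        exact LieSubmodule.mem_top y
      obtain ⟨u, hu, v, hv, rfl⟩ := (LieSubmodule.mem_sup _ _ _).1 hy
      rw [map_add, traceForm_comm ℂ L W x u, hu x, zero_add]
      exact hx ⟨v, hv⟩
    have : (x : L) ∈ (traceFormKer L W ⊓ P : LieIdeal ℂ L) := ⟨hmem, x.2⟩
    rw [hc.1.eq_bot, LieSubmodule.mem_bot] at this
    exact Subtype.ext this
  have hnd : B.Nondegenerate := by
    refine ⟨fun x hx => hker x hx, fun x hx => hker x fun y => ?_⟩
    rw [hsymm.eq]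
    exact hx y
  let b := Module.finBasis ℂ P
  let b' := B.dualBasis hnd b
  refine ⟨Module.finrank ℂ P, fun i => b i, fun i => b' i, ?_, ?_, ?_⟩
  · intro h0
    apply h
    have hP : P = ⊥ := by
      rw [← LieSubmodule.toSubmodule_eq_bot]
      exact Submodule.finrank_eq_zero.1 h0
    have htop := hc.2.eq_top
    rw [hP, sup_bot_eq] at htop
    ext x y
    have : x ∈ traceFormKer L W := by
      rw [htop]
      exact LieSubmodule.mem_top x
    exact this y
  · rw [casimir, map_sum]
    have : ∀ i, LinearMap.trace ℂ W ((toEnd ℂ L W (b i)) ∘ₗ (toEnd ℂ L W (b' i))) = 1 := by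
      intro i
      rw [← traceForm_apply_apply, ← hB, LinearMap.BilinForm.apply_dualBasis_right hnd hsymm]
      simp
    rw [Finset.sum_congr rfl fun i _ => this i]
    simp
  · intro z w
    refine lie_casimir_apply _ _ (fun i j => B (b' j) ⁅z, b i⁆) z ?_ ?_ w
    · intro i
      have h1 : b = B.dualBasis hnd b' := (LinearMap.BilinForm.dualBasis_dualBasis hnd hsymm b).symm
      have h2 := (b.sum_repr ⁅z, b i⁆).symm
      have h3 : ∀ j, b.repr ⁅z, b i⁆ j = B (b' j) ⁅z, b i⁆ := by
        intro j
        conv_lhs => rw [h1]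
        rw [LinearMap.BilinForm.dualBasis_repr_apply, hsymm.eq]
        rw [← h1]
      simp only [h3] at h2
      have := congrArg (Subtype.val) h2
      simpa using this
    · intro i
      have h2 := (b'.sum_repr ⁅z, b' i⁆).symm
      have h3 : ∀ j, b'.repr ⁅z, b' i⁆ j = -B (b' i) ⁅z, b j⁆ := by
        intro j
        rw [LinearMap.BilinForm.dualBasis_repr_apply]
        exact traceForm_apply_lie_apply' ℂ L W z (b' i) (b j)
      simp only [h3, neg_smul, Finset.sum_neg_distrib] at h2
      have := congrArg (Subtype.val) h2
      simpa using this

end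

variable [FiniteDimensional ℂ L] [IsKilling ℂ L]

/-- A nonzero invariant functional on a finite-dimensional representation of a semisimple Lie
algebra does not vanish on the invariants. -/
theorem exists_invariant_of_invariant_functional (n : ℕ) :
    ∀ (W : Type u) [AddCommGroup W] [Module ℂ W] [FiniteDimensional ℂ W] [LieRingModule L W]
      [LieModule ℂ L W], Module.finrank ℂ W = n → ∀ l : W →ₗ[ℂ] ℂ, (∀ (x : L) w, l ⁅x, w⁆ = 0) →
      l ≠ 0 → ∃ w : W, (∀ x : L, ⁅x, w⁆ = 0) ∧ l w ≠ 0 := by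
  induction n using Nat.strong_induction_on with
  | _ n ih =>
  intro W _ _ _ _ _ hn l hl hl0
  let W₀ : LieSubmodule ℂ L W :=
    { LinearMap.ker l with
      lie_mem := fun {x w} _ => hl x w }
  have hW₀ : ∀ w, w ∈ W₀ ↔ l w = 0 := fun w => Iff.rfl
  -- If `ker l` has a proper nonzero submodule `U`, an invariant of `W / U` lifts to `w`, and `U + ℂ
  -- w` is a smaller module to which induction applies. Otherwise a Casimir operator produces the
  -- invariant.
  by_cases hU : ∃ U : LieSubmodule ℂ L W, U ≠ ⊥ ∧ U < W₀
  · obtain ⟨U, hU0, hUlt⟩ := hU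
    have hUle : U.toSubmodule ≤ LinearMap.ker l := hUlt.le
    let lq : (W ⧸ U) →ₗ[ℂ] ℂ := U.toSubmodule.liftQ l hUle
    have hlq : ∀ w : W, lq (LieSubmodule.Quotient.mk w) = l w := fun w => rfl
    have hdim : Module.finrank ℂ (W ⧸ U) < n := by
      have h1 := Submodule.finrank_quotient_add_finrank U.toSubmodule
      have h2 : Module.finrank ℂ U.toSubmodule ≠ 0 := fun h0 =>
        hU0 (by rw [← LieSubmodule.toSubmodule_eq_bot]; exact Submodule.finrank_eq_zero.1 h0)
      have h3 : Module.finrank ℂ (W ⧸ U) = Module.finrank ℂ (W ⧸ U.toSubmodule) := rfl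
      omega
    obtain ⟨wq, hwq, hlwq⟩ := ih _ hdim (W ⧸ U) rfl lq
      (by
        intro x w
        obtain ⟨w, rfl⟩ := LieSubmodule.Quotient.surjective_mk' U w
        exact hl x w)
      (by
        intro h0
        apply hl0
        ext w
        exact LinearMap.congr_fun h0 (LieSubmodule.Quotient.mk w))
    obtain ⟨w, rfl⟩ := LieSubmodule.Quotient.surjective_mk' U wq
    have hwU : ∀ x : L, ⁅x, w⁆ ∈ U := by
      intro x
      have h1 : (LieSubmodule.Quotient.mk ⁅x, w⁆ : W ⧸ U) = 0 := hwq x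
      exact LieSubmodule.Quotient.mk_eq_zero'.1 h1
    have hlw : l w ≠ 0 := hlwq
    let W' : LieSubmodule ℂ L W :=
      { U.toSubmodule ⊔ Submodule.span ℂ {w} with
        lie_mem := by
          intro x v hv
          obtain ⟨u, hu, v', hv', rfl⟩ := Submodule.mem_sup.1 hv
          obtain ⟨c, rfl⟩ := Submodule.mem_span_singleton.1 hv'
          rw [lie_add, lie_smul]
          exact Submodule.mem_sup_left (U.add_mem (U.lie_mem hu) (U.smul_mem c (hwU x))) }
    have hW' : ∀ v, v ∈ W' ↔ v ∈ U.toSubmodule ⊔ Submodule.span ℂ {w} := fun v => Iff.rfl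
    have hwW' : w ∈ W' := Submodule.mem_sup_right (Submodule.mem_span_singleton_self w)
    -- An element of `U + ℂ w` killed by `l` lies in `U`, because `l w ≠ 0`; but `U` is smaller than
    -- `ker l`.
    have hne : W'.toSubmodule < ⊤ := by
      rw [lt_top_iff_ne_top]
      intro htop
      obtain ⟨v, hv0, hvU⟩ := SetLike.exists_of_lt hUlt
      have hv : v ∈ W'.toSubmodule := htop ▸ Submodule.mem_top
      obtain ⟨u, hu, v', hv', rfl⟩ := Submodule.mem_sup.1 hv
      obtain ⟨c, rfl⟩ := Submodule.mem_span_singleton.1 hv'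
      have h1 : l (u + c • w) = 0 := hv0
      have h2 : l u = 0 := hUlt.le hu
      rw [map_add, h2, zero_add, map_smul, smul_eq_mul] at h1
      have hc0 : c = 0 := (mul_eq_zero.1 h1).resolve_right hlw
      apply hvU
      rw [hc0, zero_smul, add_zero]
      exact hu
    obtain ⟨v, hv, hlv⟩ := ih (Module.finrank ℂ W') (hn ▸ Submodule.finrank_lt hne.ne) W' rfl
      (l.comp W'.toSubmodule.subtype) (fun x w => hl x w)
      (fun h0 => hlw (LinearMap.congr_fun h0 ⟨w, hwW'⟩))
    refine ⟨v, fun x => ?_, hlv⟩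
    have := congrArg Subtype.val (hv x)
    exact this
  · push Not at hU
    obtain ⟨w₁, hw₁⟩ : ∃ w, l w ≠ 0 := by
      by_contra h
      push Not at h
      exact hl0 (LinearMap.ext h)
    by_cases htf : traceForm ℂ L W = 0
    · exact ⟨w₁, fun x => lie_eq_zero_of_traceForm_eq_zero htf x w₁, hw₁⟩
    · obtain ⟨m, b, b', hm, htr, hcomm⟩ := exists_casimir htf
      set C := casimir W b b' with hC
      have hCl : ∀ w, l (C w) = 0 := by
        intro w
        rw [hC, casimir_apply, map_sum]
        exact Finset.sum_eq_zero fun i _ => hl _ _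
      let U : LieSubmodule ℂ L W :=
        { LinearMap.ker C ⊓ LinearMap.ker l with
          lie_mem := by
            rintro x w ⟨hw, -⟩
            refine ⟨?_, hl x w⟩
            have h1 : C w = 0 := hw
            change C ⁅x, w⁆ = 0
            rw [← hcomm, h1, lie_zero] }
      have hUle : U ≤ W₀ := fun w hw => hw.2
      -- Otherwise `C` kills `ker l`, which contains its image. Then `C ^ 2 = 0` and its trace
      -- vanishes, contrary to the choice of `C`.
      have hU0 : U = ⊥ := by
        by_contra hne
        have hUW : U = W₀ := by
          by_contra hne'
          exact hU U hne (lt_of_le_of_ne hUle hne')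
        have hC2 : C ^ 2 = 0 := by
          ext w
          rw [pow_two, Module.End.mul_apply]
          have : C w ∈ U := by
            rw [hUW]
            exact hCl w
          exact this.1
        have := (LinearMap.isNilpotent_trace_of_isNilpotent (R := ℂ) ⟨2, hC2⟩).eq_zero
        rw [htr] at this
        exact hm (by exact_mod_cast this)
      have hnotinj : ¬ Function.Injective C := by
        intro hinj
        obtain ⟨w, hw⟩ := (LinearMap.injective_iff_surjective.1 hinj) w₁
        exact hw₁ (hw ▸ hCl w)
      obtain ⟨w, hw, hw0⟩ : ∃ w, C w = 0 ∧ w ≠ 0 := by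
        by_contra h
        push Not at h
        exact hnotinj ((injective_iff_map_eq_zero C).2 fun w hw => h w hw)
      have hbot : ∀ v, C v = 0 → l v = 0 → v = 0 := by
        intro v h1 h2
        have : v ∈ U := ⟨h1, h2⟩
        rwa [hU0, LieSubmodule.mem_bot] at this
      -- The kernel of `C` meets `ker l` trivially and is stable under `L`, while `L` maps
      -- everything into `ker l`; so `L` kills the kernel of `C`.
      refine ⟨w, fun x => hbot _ ?_ (hl x w), fun h0 => hw0 (hbot w hw h0)⟩
      rw [← hcomm, hw, lie_zero]

end LieModule

end

section

/-! ### The differential of a holomorphic representation of a complex Lie group -/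

namespace VectorField

variable {E : Type*} [NormedAddCommGroup E] [NormedSpace ℂ E]
  {S : Type*} [TopologicalSpace S] [ChartedSpace E S] [IsManifold 𝓘(ℂ, E) 2 S]
  {F : Type*} [NormedAddCommGroup F] [NormedSpace ℂ F]

/-- The expression of a vector field in the chart at `x`. -/
noncomputable def inChart (x : S) (X : Π s : S, TangentSpace 𝓘(ℂ, E) s) : E → E :=
  fun y => mpullbackWithin 𝓘(ℂ, E) 𝓘(ℂ, E) (extChartAt 𝓘(ℂ, E) x).symm X
        (Set.range 𝓘(ℂ, E)) y

theorem mdifferentiableAt_extChartAt_symm {x : S} {y : E}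
    (hy : y ∈ (extChartAt 𝓘(ℂ, E) x).target) :
    MDifferentiableAt 𝓘(ℂ, E) 𝓘(ℂ, E) (extChartAt 𝓘(ℂ, E) x).symm y :=
  ((contMDiffOn_extChartAt_symm (n := 2) x).contMDiffAt
    ((isOpen_extChartAt_target x).mem_nhds hy)).mdifferentiableAt (by simp)

theorem eq_of_mvfderiv_eq_zero [PreconnectedSpace S] {f : S → F}
    (hf : MDifferentiable 𝓘(ℂ, E) 𝓘(ℂ, F) f)
    (h : ∀ s v, mvfderiv 𝓘(ℂ, E) f s v = 0) (x y : S) : f x = f y := by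
  suffices hl : IsLocallyConstant f from hl.apply_eq_of_preconnectedSpace x y
  rw [IsLocallyConstant.iff_eventually_eq]
  intro x
  set φ := extChartAt 𝓘(ℂ, E) x with hφ
  have hopen : IsOpen φ.target := isOpen_extChartAt_target x
  have hx : φ x ∈ φ.target := mem_extChartAt_target x
  obtain ⟨r, hr, hball⟩ := Metric.isOpen_iff.1 hopen _ hx
  have hd : ∀ y ∈ φ.target, DifferentiableAt ℂ (f ∘ φ.symm) y ∧ fderiv ℂ (f ∘ φ.symm) y = 0 := by
    intro y hy
    have hmφ : MDifferentiableAt 𝓘(ℂ, E) 𝓘(ℂ, E) φ.symm y := mdifferentiableAt_extChartAt_symm hy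
    refine ⟨((hf (φ.symm y)).comp y hmφ).differentiableAt, ?_⟩
    ext v
    have h2 := mfderiv_comp_apply y (hf (φ.symm y)) hmφ v
    rw [mfderiv_eq_fderiv] at h2
    exact h2.trans (h _ _)
  have hcont : ContinuousAt φ x := continuousAt_extChartAt x
  filter_upwards [extChartAt_source_mem_nhds (I := 𝓘(ℂ, E)) x,
    hcont.preimage_mem_nhds (Metric.ball_mem_nhds _ hr)] with s hs hsb
  have := (convex_ball (φ x) r).is_const_of_fderivWithin_eq_zero (𝕜 := ℂ)
    (f := f ∘ φ.symm)
    (fun y hy => (hd y (hball hy)).1.differentiableWithinAt)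
    (fun y hy => by
      rw [fderivWithin_of_isOpen Metric.isOpen_ball hy]
      exact (hd y (hball hy)).2) hsb (Metric.mem_ball_self hr)
  simp only [Function.comp_apply] at this
  rwa [φ.left_inv hs, φ.left_inv (mem_extChartAt_source x)] at this

theorem fderiv_comp_extChartAt_symm_inChart {f : S → F} {x : S} {y : E}
    (hy : y ∈ (extChartAt 𝓘(ℂ, E) x).target)
    (hf : MDifferentiableAt 𝓘(ℂ, E) 𝓘(ℂ, F) f ((extChartAt 𝓘(ℂ, E) x).symm y))
    (X : Π s : S, TangentSpace 𝓘(ℂ, E) s) :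
    fderiv ℂ (f ∘ (extChartAt 𝓘(ℂ, E) x).symm) y (inChart x X y) =
      mvfderiv 𝓘(ℂ, E) f ((extChartAt 𝓘(ℂ, E) x).symm y)
        (X ((extChartAt 𝓘(ℂ, E) x).symm y)) := by
  have hinv := isInvertible_mfderivWithin_extChartAt_symm (I := 𝓘(ℂ, E)) hy
  have hφ := mdifferentiableAt_extChartAt_symm hy
  set w : E := inChart x X y with hw
  have h1 : w = (mfderiv 𝓘(ℂ, E) 𝓘(ℂ, E) (extChartAt 𝓘(ℂ, E) x).symm y).inverse
      (X ((extChartAt 𝓘(ℂ, E) x).symm y)) := by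
    rw [hw, inChart, mpullbackWithin_apply, ModelWithCorners.range_eq_univ, mfderivWithin_univ]
  rw [ModelWithCorners.range_eq_univ, mfderivWithin_univ] at hinv
  obtain ⟨A, hA⟩ := hinv
  have h2 : mfderiv 𝓘(ℂ, E) 𝓘(ℂ, E) (extChartAt 𝓘(ℂ, E) x).symm y w =
      X ((extChartAt 𝓘(ℂ, E) x).symm y) := by
    rw [h1, ← hA, ContinuousLinearMap.inverse_equiv]
    exact A.apply_symm_apply _
  have h3 := mfderiv_comp_apply y hf hφ w
  rw [h2, mfderiv_eq_fderiv] at h3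
  exact h3

theorem mvfderiv_eq_fderiv_comp {f : S → F} {x : S}
    (hf : MDifferentiableAt 𝓘(ℂ, E) 𝓘(ℂ, F) f x) (X : Π s : S, TangentSpace 𝓘(ℂ, E) s) :
    mvfderiv 𝓘(ℂ, E) f x (X x) = fderiv ℂ (f ∘ (extChartAt 𝓘(ℂ, E) x).symm)
      (extChartAt 𝓘(ℂ, E) x x) (inChart x X (extChartAt 𝓘(ℂ, E) x x)) := by
  have hxx : (extChartAt 𝓘(ℂ, E) x).symm (extChartAt 𝓘(ℂ, E) x x) = x := extChartAt_to_inv x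
  rw [fderiv_comp_extChartAt_symm_inChart (mem_extChartAt_target x) (hxx.symm ▸ hf)]
  rw [hxx]

/-- The bracket on the manifold is transported from the chart; the content is that the inverse
differentials of the chart and of its inverse cancel. -/
theorem inChart_mlieBracket (x : S) (X Y : Π s : S, TangentSpace 𝓘(ℂ, E) s) :
    inChart x (mlieBracket 𝓘(ℂ, E) X Y) (extChartAt 𝓘(ℂ, E) x x) =
      lieBracket ℂ (inChart x X) (inChart x Y) (extChartAt 𝓘(ℂ, E) x x) := by
  have hxx : (extChartAt 𝓘(ℂ, E) x).symm (extChartAt 𝓘(ℂ, E) x x) = x := extChartAt_to_inv x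
  set b : E := lieBracket ℂ (inChart x X) (inChart x Y) (extChartAt 𝓘(ℂ, E) x x) with hbdef
  have hb : mlieBracket 𝓘(ℂ, E) X Y x =
      (mfderiv 𝓘(ℂ, E) 𝓘(ℂ, E) (extChartAt 𝓘(ℂ, E) x) x).inverse b := by
    rw [← mlieBracketWithin_univ, mlieBracketWithin_apply, Set.preimage_univ, Set.univ_inter]
    have : lieBracket ℂ (inChart x X) (inChart x Y) =
        lieBracketWithin ℂ (inChart x X) (inChart x Y) (Set.range 𝓘(ℂ, E)) := by
      rw [ModelWithCorners.range_eq_univ, lieBracketWithin_univ]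
    rw [hbdef, this]
    rfl
  have h1 : inChart x (mlieBracket 𝓘(ℂ, E) X Y) (extChartAt 𝓘(ℂ, E) x x) =
      (mfderivWithin 𝓘(ℂ, E) 𝓘(ℂ, E) (extChartAt 𝓘(ℂ, E) x).symm (Set.range 𝓘(ℂ, E))
        (extChartAt 𝓘(ℂ, E) x x)).inverse (mlieBracket 𝓘(ℂ, E) X Y x) := by
    rw [inChart, mpullbackWithin_apply, hxx]
  rw [h1, hb]
  have hi1 := isInvertible_mfderiv_extChartAt (I := 𝓘(ℂ, E)) (mem_extChartAt_source x)
  have hi2 := isInvertible_mfderivWithin_extChartAt_symm (I := 𝓘(ℂ, E)) (mem_extChartAt_target x)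
  have hc := mfderiv_extChartAt_comp_mfderivWithin_extChartAt_symm (I := 𝓘(ℂ, E))
    (mem_extChartAt_target x)
  rw [hxx] at hc
  obtain ⟨A, hA⟩ := hi1
  obtain ⟨B, hB⟩ := hi2
  rw [← hA, ← hB] at hc ⊢
  have hc' : ∀ e : E, A (B e) = e := fun e => DFunLike.congr_fun hc e
  rw [ContinuousLinearMap.inverse_equiv, ContinuousLinearMap.inverse_equiv]
  have h2 : A.symm b = B b := (congrArg A.symm (hc' b)).symm.trans (A.symm_apply_apply (B b))
  exact (congrArg B.symm h2).trans (B.symm_apply_apply b)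

/-- The derivation of a Lie bracket is the commutator of the derivations. -/
theorem mvfderiv_mlieBracket_apply [CompleteSpace E] {f : S → F} {x : S}
    (hf : ContMDiff 𝓘(ℂ, E) 𝓘(ℂ, F) 2 f) {X Y : Π s : S, TangentSpace 𝓘(ℂ, E) s}
    (hX : MDifferentiableAt 𝓘(ℂ, E) 𝓘(ℂ, E).tangent
      (fun s => (X s : TangentBundle 𝓘(ℂ, E) S)) x)
    (hY : MDifferentiableAt 𝓘(ℂ, E) 𝓘(ℂ, E).tangent
      (fun s => (Y s : TangentBundle 𝓘(ℂ, E) S)) x)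
    (hfX : MDifferentiableAt 𝓘(ℂ, E) 𝓘(ℂ, F) (fun s => mvfderiv 𝓘(ℂ, E) f s (X s)) x)
    (hfY : MDifferentiableAt 𝓘(ℂ, E) 𝓘(ℂ, F) (fun s => mvfderiv 𝓘(ℂ, E) f s (Y s)) x) :
    mvfderiv 𝓘(ℂ, E) f x (mlieBracket 𝓘(ℂ, E) X Y x) =
      mvfderiv 𝓘(ℂ, E) (fun s => mvfderiv 𝓘(ℂ, E) f s (Y s)) x (X x) -
      mvfderiv 𝓘(ℂ, E) (fun s => mvfderiv 𝓘(ℂ, E) f s (X s)) x (Y x) := by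
  have hx : extChartAt 𝓘(ℂ, E) x x ∈ (extChartAt 𝓘(ℂ, E) x).target := mem_extChartAt_target x
  have hopen : IsOpen (extChartAt 𝓘(ℂ, E) x).target := isOpen_extChartAt_target x
  have hmd : ∀ s, MDifferentiableAt 𝓘(ℂ, E) 𝓘(ℂ, F) f s := fun s =>
    hf.contMDiffAt.mdifferentiableAt (by simp)
  have hd : ∀ {Z : Π s : S, TangentSpace 𝓘(ℂ, E) s}, MDifferentiableAt 𝓘(ℂ, E) 𝓘(ℂ, E).tangent
      (fun s => (Z s : TangentBundle 𝓘(ℂ, E) S)) x →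
      DifferentiableAt ℂ (inChart x Z) (extChartAt 𝓘(ℂ, E) x x) := by
    intro Z hZ
    have := (mdifferentiableWithinAt_univ.2 hZ).differentiableWithinAt_mpullbackWithin_vectorField
    rw [Set.preimage_univ, Set.univ_inter] at this
    refine this.differentiableAt ?_
    rw [ModelWithCorners.range_eq_univ]
    exact Filter.univ_mem
  have hu : ContDiffAt ℂ 2 (f ∘ (extChartAt 𝓘(ℂ, E) x).symm) (extChartAt 𝓘(ℂ, E) x x) := by
    rw [← contMDiffAt_iff_contDiffAt]
    exact hf.contMDiffAt.comp _
      ((contMDiffOn_extChartAt_symm (n := 2) x).contMDiffAt (hopen.mem_nhds hx))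
  have hev : ∀ Z : Π s : S, TangentSpace 𝓘(ℂ, E) s,
      (fun y => fderiv ℂ (f ∘ (extChartAt 𝓘(ℂ, E) x).symm) y (inChart x Z y))
        =ᶠ[𝓝 (extChartAt 𝓘(ℂ, E) x x)]
      (fun s => mvfderiv 𝓘(ℂ, E) f s (Z s)) ∘ (extChartAt 𝓘(ℂ, E) x).symm := by
    intro Z
    filter_upwards [hopen.mem_nhds hx] with y hy
    exact fderiv_comp_extChartAt_symm_inChart hy (hmd _) Z
  rw [mvfderiv_eq_fderiv_comp (hmd x) (mlieBracket 𝓘(ℂ, E) X Y), inChart_mlieBracket,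
    fderiv_apply_lieBracket hu (by simp) (hd hY) (hd hX), (hev Y).fderiv_eq,
    (hev X).fderiv_eq, mvfderiv_eq_fderiv_comp hfY, mvfderiv_eq_fderiv_comp hfX]

end VectorField

/-! ### The differential of a multiplicative map into an algebra -/

namespace AlgGroup

open VectorField

section

variable {E : Type*} [NormedAddCommGroup E] [NormedSpace ℂ E]
  {S : Type*} [TopologicalSpace S] [ChartedSpace E S]
  {R : Type*} [NormedRing R] [NormedAlgebra ℂ R]

theorem mvfderiv_mul_apply {p q : S → R} {x : S} (hp : MDifferentiableAt 𝓘(ℂ, E) 𝓘(ℂ, R) p x)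
    (hq : MDifferentiableAt 𝓘(ℂ, E) 𝓘(ℂ, R) q x) (v : TangentSpace 𝓘(ℂ, E) x) :
    mvfderiv 𝓘(ℂ, E) (p * q) x v =
      p x * mvfderiv 𝓘(ℂ, E) q x v + mvfderiv 𝓘(ℂ, E) p x v * q x :=
  DFunLike.congr_fun (hp.hasMFDerivAt.mul' hq.hasMFDerivAt).mfderiv v

theorem contMDiff_of_forall_linearMap [FiniteDimensional ℂ R] {t : S → R}
    (hT : ∀ l : R →ₗ[ℂ] ℂ, ContMDiff 𝓘(ℂ, E) 𝓘(ℂ) ω (fun s => l (t s))) :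
    ContMDiff 𝓘(ℂ, E) 𝓘(ℂ, R) 2 t := by
  let b := Module.finBasis ℂ R
  have : (t : S → R) = fun s => ∑ i, b.coord i (t s) • b i := by
    funext s
    exact (b.sum_repr (t s)).symm
  rw [this]
  exact contMDiff_finsetSum fun i _ => ((hT (b.coord i)).of_le le_top).smul contMDiff_const

variable [Group S] [LieGroup 𝓘(ℂ, E) ω S]

/-- Differentiate `T (g s) = T g * T s` at `s = 1`: a left invariant field acts on `T` by right
multiplication by a constant. -/
theorem mvfderiv_mulInvariantVectorField {T : S → R} (hT : ContMDiff 𝓘(ℂ, E) 𝓘(ℂ, R) 2 T)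
    (hmul : ∀ s t, T (s * t) = T s * T t) (v : GroupLieAlgebra 𝓘(ℂ, E) S) (g : S) :
    mvfderiv 𝓘(ℂ, E) T g (mulInvariantVectorField v g) = T g * mvfderiv 𝓘(ℂ, E) T 1 v := by
  have hmd : ∀ s, MDifferentiableAt 𝓘(ℂ, E) 𝓘(ℂ, R) T s := fun s =>
    hT.contMDiffAt.mdifferentiableAt (by simp)
  have hL : MDifferentiableAt 𝓘(ℂ, E) 𝓘(ℂ, E) (g * ·) 1 :=
    (contMDiff_mul_left (I := 𝓘(ℂ, E)) (n := ω)).contMDiffAt.mdifferentiableAt (by simp)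
  have h1 := mfderiv_comp_apply_of_eq _ (hmd g) hL (mul_one g) v
  have h2 : T ∘ (g * ·) = (fun _ => T g) * T := by
    funext s
    exact hmul g s
  have h3 := mvfderiv_mul_apply (p := fun _ => T g) (q := T) (x := (1 : S))
    mdifferentiableAt_const (hmd 1) v
  rw [mvfderiv_const, zero_apply, zero_mul, add_zero, ← h2] at h3
  exact h1.symm.trans h3

/-- Each invariant field multiplies `T` on the right by a constant, so the commutator of two such
derivations, evaluated at `1`, is the commutator of the constants. -/
theorem mvfderiv_lie {T : S → R} [CompleteSpace E] (hT : ContMDiff 𝓘(ℂ, E) 𝓘(ℂ, R) 2 T)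
    (hmul : ∀ s t, T (s * t) = T s * T t) (v w : GroupLieAlgebra 𝓘(ℂ, E) S) :
    mvfderiv 𝓘(ℂ, E) T 1 ⁅v, w⁆ =
      mvfderiv 𝓘(ℂ, E) T 1 v * mvfderiv 𝓘(ℂ, E) T 1 w -
      mvfderiv 𝓘(ℂ, E) T 1 w * mvfderiv 𝓘(ℂ, E) T 1 v := by
  have hmd : ∀ s, MDifferentiableAt 𝓘(ℂ, E) 𝓘(ℂ, R) T s := fun s =>
    hT.contMDiffAt.mdifferentiableAt (by simp)
  have hX : ∀ u : GroupLieAlgebra 𝓘(ℂ, E) S,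
      (fun s => mvfderiv 𝓘(ℂ, E) T s (mulInvariantVectorField u s)) =
      T * fun _ => mvfderiv 𝓘(ℂ, E) T 1 u := by
    intro u
    funext s
    exact mvfderiv_mulInvariantVectorField hT hmul u s
  have hXd : ∀ u : GroupLieAlgebra 𝓘(ℂ, E) S, MDifferentiableAt 𝓘(ℂ, E) 𝓘(ℂ, R)
      (fun s => mvfderiv 𝓘(ℂ, E) T s (mulInvariantVectorField u s)) 1 := by
    intro u
    rw [hX]
    exact (hmd 1).mul mdifferentiableAt_const
  have hone : ∀ u : GroupLieAlgebra 𝓘(ℂ, E) S, mulInvariantVectorField u (1 : S) = u := by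
    intro u
    rw [mulInvariantVectorField]
    have : ((1 : S) * ·) = id := by
      funext s
      exact one_mul s
    have h2 : ∀ w : E, mfderiv 𝓘(ℂ, E) 𝓘(ℂ, E) ((1 : S) * ·) 1 w = w := by
      rw [this, mfderiv_id]
      exact fun w => rfl
    exact h2 u
  rw [GroupLieAlgebra.bracket_def, mvfderiv_mlieBracket_apply hT
    (mdifferentiableAt_mulInvariantVectorField v) (mdifferentiableAt_mulInvariantVectorField w)
    (hXd v) (hXd w), hX, hX, mvfderiv_mul_apply (hmd 1) mdifferentiableAt_const,
    mvfderiv_mul_apply (hmd 1) mdifferentiableAt_const, mvfderiv_const, mvfderiv_const,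
    hone, hone]
  simp


variable (t : S →* R)

variable [CompleteSpace E] [PreconnectedSpace S]

/-- The differential of a holomorphic representation of a connected Lie group determines its
invariants. -/
theorem exists_differential_of_normedAlgebra [FiniteDimensional ℂ R]
    (hT : ∀ l : R →ₗ[ℂ] ℂ, ContMDiff 𝓘(ℂ, E) 𝓘(ℂ) ω (fun s => l (t s))) :
    ∃ D : GroupLieAlgebra 𝓘(ℂ, E) S →ₗ[ℂ] R,
      (∀ v w, D ⁅v, w⁆ = D v * D w - D w * D v) ∧
      (∀ (l : R →ₗ[ℂ] ℂ) (x : R),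
        (∀ s, l (t s * x * t s⁻¹) = l x) → ∀ v, l (D v * x - x * D v) = 0) ∧
      (∀ x : R, (∀ v, Commute x (D v)) → ∀ s, Commute x (t s)) := by
  have hcont := contMDiff_of_forall_linearMap hT
  have hcontinv : ContMDiff 𝓘(ℂ, E) 𝓘(ℂ, R) 2 (fun s => t s⁻¹) :=
    hcont.comp ((contMDiff_inv 𝓘(ℂ, E) ω).of_le le_top)
  have hinv : ∀ s, t s * t s⁻¹ = 1 := fun s => by rw [← map_mul, mul_inv_cancel, map_one]
  have hmd : ∀ s, MDifferentiableAt 𝓘(ℂ, E) 𝓘(ℂ, R) t s := fun s =>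
    hcont.contMDiffAt.mdifferentiableAt (by simp)
  have hmdi : ∀ s, MDifferentiableAt 𝓘(ℂ, E) 𝓘(ℂ, R)
      (fun s => t s⁻¹) s := fun s => hcontinv.contMDiffAt.mdifferentiableAt (by simp)
  set D := mvfderiv 𝓘(ℂ, E) t 1 with hD
  have hDinv : ∀ v, mvfderiv 𝓘(ℂ, E) (fun s => t s⁻¹) 1 v = -D v := by
    intro v
    have h2 : ⇑t * (fun s => t s⁻¹) = fun _ => 1 := by
      funext s
      exact hinv s
    have h3 := mvfderiv_mul_apply (hmd 1) (hmdi 1) v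
    rw [h2, mvfderiv_const, inv_one, map_one] at h3
    simp only [zero_apply, one_mul, mul_one] at h3
    exact eq_neg_of_add_eq_zero_left h3.symm
  have hconjmd : ∀ (x : R) (s : S),
      MDifferentiableAt 𝓘(ℂ, E) 𝓘(ℂ, R) (⇑t * (fun _ => x) * fun s => t s⁻¹) s := fun x s =>
    ((hmd s).mul mdifferentiableAt_const).mul (hmdi s)
  have hconj : ∀ (x : R) (v : GroupLieAlgebra 𝓘(ℂ, E) S),
      mvfderiv 𝓘(ℂ, E) (⇑t * (fun _ => x) * fun s => t s⁻¹) 1 v = D v * x - x * D v := by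
    intro x v
    rw [mvfderiv_mul_apply ((hmd 1).mul mdifferentiableAt_const) (hmdi 1),
      mvfderiv_mul_apply (hmd 1) mdifferentiableAt_const, mvfderiv_const, hDinv]
    simp only [Pi.mul_apply, inv_one, map_one, zero_apply]
    noncomm_ring
  refine ⟨D.toLinearMap, mvfderiv_lie hcont (map_mul t), ?_, ?_⟩
  · intro l x hl v
    let l' : R →L[ℂ] ℂ := LinearMap.toContinuousLinearMap l
    have h2 := mfderiv_comp_apply (1 : S) (g := l') l'.differentiableAt.mdifferentiableAt
      (hconjmd x 1) v
    have h3 : (l' : R → ℂ) ∘ (⇑t * (fun _ => x) * fun s => t s⁻¹) = fun _ => l x := by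
      funext s
      exact hl s
    rw [h3, mfderiv_const, mfderiv_eq_fderiv] at h2
    have h4 : ∀ y : R, fderiv ℂ l' y = l' := fun y => l'.fderiv
    have h5 := DFunLike.congr_fun (h4 ((⇑t * (fun _ => x) * fun s => t s⁻¹ : S → R) 1))
      (D v * x - x * D v)
    rw [← hconj x v] at h5
    exact (congrArg l (hconj x v)).symm.trans (h5.symm.trans h2.symm)
  · intro x hx s
    have hzero : ∀ g v, mvfderiv 𝓘(ℂ, E) (⇑t * (fun _ => x) * fun s => t s⁻¹) g v = 0 := by
      intro g v
      have hLg : MDifferentiableAt 𝓘(ℂ, E) 𝓘(ℂ, E) (g⁻¹ * ·) g :=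
        (contMDiff_mul_left (I := 𝓘(ℂ, E)) (n := ω)).contMDiffAt.mdifferentiableAt (by simp)
      -- The orbit map of `x` under conjugation is its own translate by `g⁻¹` conjugated by `t g`,
      -- so its derivative at `g` reduces to the one at `1`, which is a commutator with `x`.
      have h2 : (⇑t * (fun _ => x) * fun s => t s⁻¹) =
          ((fun _ => t g) * (⇑t * (fun _ => x) * fun s => t s⁻¹) * (fun _ => t g⁻¹)) ∘
            (g⁻¹ * ·) := by
        funext s
        simp only [Pi.mul_apply, Function.comp_apply, map_mul, mul_inv_rev, inv_inv]
        rw [show t g * (t g⁻¹ * t s * x * (t s⁻¹ * t g)) * t g⁻¹ =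
          (t g * t g⁻¹) * (t s * x * t s⁻¹) * (t g * t g⁻¹) by simp only [mul_assoc], hinv,
          one_mul, mul_one]
      rw [h2]
      have h3 := mfderiv_comp_apply_of_eq _
        (((mdifferentiableAt_const (c := t g)).mul (hconjmd x 1)).mul
          (mdifferentiableAt_const (c := t g⁻¹))) hLg (inv_mul_cancel g) v
      refine h3.trans ?_
      set w : GroupLieAlgebra 𝓘(ℂ, E) S := mfderiv 𝓘(ℂ, E) 𝓘(ℂ, E) (g⁻¹ * ·) g v
      have h4 := mvfderiv_mul_apply
        ((mdifferentiableAt_const (c := t g)).mul (hconjmd x 1))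
        (mdifferentiableAt_const (c := t g⁻¹)) w
      rw [mvfderiv_mul_apply mdifferentiableAt_const (hconjmd x 1), mvfderiv_const,
        mvfderiv_const, hconj] at h4
      have : D w * x - x * D w = 0 := sub_eq_zero.2 (hx w).eq.symm
      simp only [this, zero_apply, mul_zero, zero_mul, add_zero] at h4
      exact h4
    have h2 := eq_of_mvfderiv_eq_zero (hconjmd x) hzero s 1
    simp only [Pi.mul_apply, inv_one, map_one, one_mul, mul_one] at h2
    have h3 : t s⁻¹ * t s = 1 := by rw [← map_mul, inv_mul_cancel, map_one]
    change x * t s = t s * x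
    rw [← h2, mul_assoc _ _ (t s), h3, mul_one, h2]

end

open scoped Matrix.Norms.Operator in
-- Stating the second clause for one functional and one matrix yields both stability of subspaces,
-- through annihilators, and invariance of functionals.
theorem exists_differential {M : ℕ} {E : Type*} [NormedAddCommGroup E] [NormedSpace ℂ E]
    [CompleteSpace E] {S : Type*} [TopologicalSpace S] [ChartedSpace E S] [Group S]
    [LieGroup 𝓘(ℂ, E) ω S] [PreconnectedSpace S]
    (T : S →* Matrix.GeneralLinearGroup (Fin M) ℂ)
    (hT : ∀ i j, ContMDiff 𝓘(ℂ, E) 𝓘(ℂ) ω (fun s => (T s).val i j)) :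
    ∃ D : GroupLieAlgebra 𝓘(ℂ, E) S →ₗ[ℂ] Matrix (Fin M) (Fin M) ℂ,
      (∀ v w, D ⁅v, w⁆ = D v * D w - D w * D v) ∧
      (∀ (l : Matrix (Fin M) (Fin M) ℂ →ₗ[ℂ] ℂ) (x : Matrix (Fin M) (Fin M) ℂ),
        (∀ s, l ((T s).val * x * (T s)⁻¹.val) = l x) → ∀ v, l (D v * x - x * D v) = 0) ∧
      (∀ x : Matrix (Fin M) (Fin M) ℂ, (∀ v, Commute x (D v)) → ∀ s, Commute x (T s).val) := by
  have h := exists_differential_of_normedAlgebra (E := E) (R := Matrix (Fin M) (Fin M) ℂ)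
    ((Units.coeHom _).comp T) ?_
  · simpa [-Matrix.coe_units_inv] using h
  · intro l
    have : (fun s => l (((Units.coeHom _).comp T) s)) =
        fun s => ∑ i, ∑ j, (T s).val i j * l (Matrix.single i j 1) := by
      funext s
      simp only [MonoidHom.comp_apply, Units.coeHom_apply]
      conv_lhs => rw [Matrix.matrix_eq_sum_single (T s).val]
      simp only [map_sum]
      refine Finset.sum_congr rfl fun i _ => Finset.sum_congr rfl fun j _ => ?_
      rw [← mul_one ((T s).val i j), ← smul_eq_mul, ← Matrix.smul_single, map_smul, smul_eq_mul,
        smul_eq_mul, mul_one]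
    rw [this]
    exact contMDiff_finsetSum fun i _ => contMDiff_finsetSum fun j _ =>
      (hT i j).mul contMDiff_const

end AlgGroup

end

/-! ### One-parameter matrix groups, semisimple matrices and their commutants -/

section

namespace AlgGroup

open Matrix NormedSpace

variable {M : ℕ}

/-- Additivity gives `φ' = φ A`, so `φ t * exp (-t A)` has zero derivative. -/
theorem eq_exp_of_map_add {φ : ℂ → Matrix (Fin M) (Fin M) ℂ}
    (hd : ∀ i j, Differentiable ℂ fun t => φ t i j) (h0 : φ 0 = 1)
    (hadd : ∀ s t, φ (s + t) = φ s * φ t) (t : ℂ) :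
    φ t = exp (t • Matrix.of fun i j => deriv (fun t => φ t i j) 0) := by
  set A : Matrix (Fin M) (Fin M) ℂ := Matrix.of fun i j => deriv (fun t => φ t i j) 0 with hA
  have h1 : ∀ t i j, HasDerivAt (fun s => φ s i j) ((φ t * A) i j) t := by
    intro t i j
    have h2 : (fun s => φ s i j) = fun s => ∑ l, φ t i l * φ (s - t) l j := by
      funext s
      rw [← Matrix.mul_apply, ← hadd, add_sub_cancel]
    rw [h2, Matrix.mul_apply]
    refine HasDerivAt.fun_sum fun l _ => HasDerivAt.const_mul _ ?_
    have h3 : HasDerivAt (fun s => φ s l j) (A l j) (t - t) := by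
      rw [sub_self]
      exact (hd l j 0).hasDerivAt
    exact HasDerivAt.comp_sub_const t t h3
  have h4 : φ t * exp (t • -A) = 1 := by
    ext i j
    have h5 : ∀ t, HasDerivAt (fun s => (φ s * exp (s • -A)) i j) 0 t := by
      intro t
      have h6 : HasDerivAt (fun s => ∑ l, φ s i l * exp (s • -A) l j)
          (∑ l, ((φ t * A) i l * exp (t • -A) l j + φ t i l * (-A * exp (t • -A)) l j)) t :=
        HasDerivAt.fun_sum fun l _ => (h1 t i l).mul (hasDerivAt_exp_entry (-A) t l j)
      have h7 : (∑ l, ((φ t * A) i l * exp (t • -A) l j + φ t i l * (-A * exp (t • -A)) l j)) =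
          0 := by
        rw [Finset.sum_add_distrib, ← Matrix.mul_apply, ← Matrix.mul_apply, ← Matrix.add_apply]
        simp [Matrix.mul_assoc]
      rw [h7] at h6
      simpa only [Matrix.mul_apply] using h6
    have h8 := is_const_of_deriv_eq_zero (fun t => (h5 t).differentiableAt)
      (fun t => (h5 t).deriv) t 0
    rw [h8, h0]
    simp
  rw [smul_neg] at h4
  calc φ t = φ t * (exp (-(t • A)) * exp (t • A)) := by
        have := exp_mul_exp_neg (-(t • A))
        rw [neg_neg] at this
        rw [this, mul_one]
    _ = exp (t • A) := by rw [← mul_assoc, h4, one_mul]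

theorem isSemisimple_conj_diagonal (P : GeneralLinearGroup (Fin M) ℂ) (μ : Fin M → ℂ) :
    Module.End.IsSemisimple (Matrix.toLin' (P.val * Matrix.diagonal μ * P⁻¹.val)) := by
  classical
  let Φ : (Fin M → ℂ) →ₐ[ℂ] Module.End ℂ (Fin M → ℂ) :=
    ((Matrix.toLinAlgEquiv' : Matrix (Fin M) (Fin M) ℂ ≃ₐ[ℂ] _).toAlgHom.comp
      (MulSemiringAction.toAlgHom ℂ (Matrix (Fin M) (Fin M) ℂ) (ConjAct.toConjAct P))).comp
      (Matrix.diagonalAlgHom ℂ)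
  have hΦ : Φ μ = Matrix.toLin' (P.val * Matrix.diagonal μ * P⁻¹.val) := rfl
  rw [← hΦ]
  let p : Polynomial ℂ := ∏ c ∈ Finset.univ.image μ, (Polynomial.X - Polynomial.C c)
  refine Module.End.isSemisimple_of_squarefree_aeval_eq_zero (p := p) ?_ ?_
  · exact (Polynomial.separable_prod_X_sub_C_iff' (f := id)).2
      (fun x _ y _ h => h) |>.squarefree
  · rw [Polynomial.aeval_algHom_apply]
    have : Polynomial.aeval μ p = 0 := by
      funext i
      have h1 : Polynomial.aeval μ p i = Polynomial.aeval (μ i) p :=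
        (Polynomial.aeval_algHom_apply (Pi.evalAlgHom ℂ (fun _ => ℂ) i) μ p).symm
      rw [h1]
      simp only [p, map_prod, map_sub, Polynomial.aeval_X, Polynomial.aeval_C, Pi.zero_apply]
      exact Finset.prod_eq_zero (Finset.mem_image_of_mem μ (Finset.mem_univ i)) (by simp)
    rw [this, map_zero]

/-- With `x = s + n`, the Jordan decomposition of `exp (c x)` has semisimple part `exp (c s)` and
nilpotent part `exp (c s) (exp (c n) - 1)`. By uniqueness `exp (c n) = 1`, and this forces `n = 0`.
-/
theorem isSemisimple_of_isSemisimple_exp {x : Matrix (Fin M) (Fin M) ℂ} {c : ℂ} (hc : c ≠ 0)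
    (h : Module.End.IsSemisimple (Matrix.toLin' (exp (c • x)))) :
    Module.End.IsSemisimple (Matrix.toLin' x) := by
  obtain ⟨P, μ, n, hn, hcomm, rfl⟩ := exists_jordan x
  set s := P.val * Matrix.diagonal μ * P⁻¹.val with hs
  suffices n = 0 by
    rw [this, add_zero]
    exact isSemisimple_conj_diagonal P μ
  have hcs : c • s = P.val * Matrix.diagonal (c • μ) * P⁻¹.val := by
    rw [hs, Matrix.diagonal_smul, Matrix.mul_smul, Matrix.smul_mul]
  have hcomm' : Commute (c • s) (c • n) := (hcomm.smul_left c).smul_right c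
  have hexp : exp (c • (s + n)) = exp (c • s) * exp (c • n) := by
    rw [smul_add]
    exact congrArg Units.val (expGL_add hcomm')
  have hc2 : Commute (exp (c • s)) (exp (c • n)) := by
    have h1 := congrArg Units.val (expGL_add hcomm')
    have h2 := congrArg Units.val (expGL_add hcomm'.symm)
    rw [add_comm] at h2
    exact h1.symm.trans h2
  have hcn : IsNilpotent (c • n) := hn.smul c
  have hc3 : Commute (exp (c • s)) (exp (c • n) - 1) := hc2.sub_right (Commute.one_right _)
  have hnil : IsNilpotent (exp (c • s) * (exp (c • n) - 1)) :=
    hc3.isNilpotent_mul_left (isNilpotent_exp_sub_one hcn)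
  have hss : Module.End.IsSemisimple (Matrix.toLin' (exp (c • s))) := by
    rw [hcs, exp_conj_diagonal]
    exact isSemisimple_conj_diagonal P _
  have hu := Module.End.isNilpotent_isSemisimple_unique
    (n₁ := 0) (n₂ := Matrix.toLinAlgEquiv' (exp (c • s) * (exp (c • n) - 1)))
    IsNilpotent.zero h (hnil.map _) hss
    (Commute.zero_left _) ((((Commute.refl _).mul_right hc3).symm).map
      (Matrix.toLinAlgEquiv' : Matrix (Fin M) (Fin M) ℂ ≃ₐ[ℂ] _)) ?_
  · have h3 : exp (c • s) * (exp (c • n) - 1) = 0 := by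
      apply (Matrix.toLinAlgEquiv' : Matrix (Fin M) (Fin M) ℂ ≃ₐ[ℂ] _).injective
      rw [map_zero]
      exact hu.1.symm
    have h4 : exp (c • n) = 1 := by
      have h5 := congrArg (fun y => exp (-(c • s)) * y) h3
      have h6 := exp_mul_exp_neg (-(c • s))
      rw [neg_neg] at h6
      simp only [mul_zero, ← mul_assoc, h6, one_mul] at h5
      exact sub_eq_zero.1 h5
    -- Closedness of the trivial group upgrades `exp (c n) = 1` to `exp (t c n) = 1` for all `t`,
    -- since `c n` is nilpotent.
    have hbot : IsClosed[zariski (glRing M)]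
        ((⊥ : Subgroup (GeneralLinearGroup (Fin M) ℂ)) : Set (GeneralLinearGroup (Fin M) ℂ)) := by
      refine isClosed_zariski_of_forall (ι := Fin M × Fin M) _ _
        (fun p g => g.val p.1 p.2 - (1 : Matrix (Fin M) (Fin M) ℂ) p.1 p.2) (fun p => ?_)
        fun g => ?_
      · exact Subalgebra.sub_mem _ (entry_mem_glRing _ _) (Subalgebra.algebraMap_mem _
          ((1 : Matrix (Fin M) (Fin M) ℂ) p.1 p.2))
      · rw [SetLike.mem_coe, Subgroup.mem_bot, Units.ext_iff, ← Matrix.ext_iff]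
        simp [sub_eq_zero]
    have h7 : c • n = 0 := eq_zero_of_forall_expGL_eq_one fun t => by
      have := expGL_smul_mem_of_isNilpotent hbot hcn (Subgroup.mem_bot.2 (Units.ext h4)) t
      exact Subgroup.mem_bot.1 this
    exact (smul_eq_zero.1 h7).resolve_left hc
  · change 0 + Matrix.toLinAlgEquiv' _ = _ + Matrix.toLinAlgEquiv' _
    rw [← map_add, zero_add, hexp]
    congr 1
    noncomm_ring

/-- In an eigenbasis of `A`, `ad A` multiplies the entry `(i, j)` by `μ i - μ j`, so it has the same
kernel as its square. -/
theorem lie_eq_zero_of_lie_lie_eq_zero {A y : Matrix (Fin M) (Fin M) ℂ}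
    (hA : Module.End.IsSemisimple (Matrix.toLin' A))
    (h : A * (A * y - y * A) - (A * y - y * A) * A = 0) : A * y - y * A = 0 := by
  obtain ⟨P, μ, rfl⟩ := exists_eq_conj_diagonal A hA
  set D := Matrix.diagonal μ with hD
  set z := P⁻¹.val * y * P.val with hz
  have hPP : P.val * P⁻¹.val = 1 := P.mul_inv
  have hPP' : P⁻¹.val * P.val = 1 := P.inv_mul
  have hy : y = P.val * z * P⁻¹.val := by
    rw [hz]
    calc y = (P.val * P⁻¹.val) * y * (P.val * P⁻¹.val) := by rw [hPP]; simp
      _ = _ := by simp only [mul_assoc]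
  have key : ∀ w : Matrix (Fin M) (Fin M) ℂ,
      P.val * D * P⁻¹.val * (P.val * w * P⁻¹.val) - P.val * w * P⁻¹.val * (P.val * D * P⁻¹.val) =
      P.val * (D * w - w * D) * P⁻¹.val := by
    intro w
    have h1 : ∀ a b : Matrix (Fin M) (Fin M) ℂ,
        P.val * a * P⁻¹.val * (P.val * b * P⁻¹.val) = P.val * (a * b) * P⁻¹.val := by
      intro a b
      calc _ = P.val * a * (P⁻¹.val * P.val) * b * P⁻¹.val := by simp only [mul_assoc]
        _ = _ := by rw [hPP']; simp only [mul_one, mul_assoc]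
    rw [h1, h1]
    noncomm_ring
  rw [hy, key, key] at h
  rw [hy, key]
  have h2 : D * (D * z - z * D) - (D * z - z * D) * D = 0 := by
    have := congrArg (fun w => P⁻¹.val * w * P.val) h
    simp only [mul_zero, zero_mul] at this
    rw [← this]
    set w := D * (D * z - z * D) - (D * z - z * D) * D
    calc w = (P⁻¹.val * P.val) * w * (P⁻¹.val * P.val) := by rw [hPP']; simp
      _ = _ := by simp only [mul_assoc]
  have h3 : D * z - z * D = 0 := by
    ext i j
    have h4 := congrFun (congrFun h2 i) j
    simp only [hD, Matrix.sub_apply, Matrix.diagonal_mul, Matrix.mul_diagonal,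
      Matrix.zero_apply] at h4 ⊢
    have h5 : (μ i - μ j) * ((μ i - μ j) * z i j) = 0 := by linear_combination h4
    have h6 : (μ i - μ j) * z i j = 0 := by
      rcases mul_eq_zero.1 h5 with h | h
      · rw [h, zero_mul]
      · exact h
    linear_combination h6
  rw [h3]
  simp

/-- A functional on an `ad A`-stable space of matrices which is killed by `ad A`, with `A`
semisimple, vanishes if it vanishes on the commutant of `A`. -/
theorem eq_zero_of_commutant {A : Matrix (Fin M) (Fin M) ℂ}
    (hA : Module.End.IsSemisimple (Matrix.toLin' A))
    (U : Submodule ℂ (Matrix (Fin M) (Fin M) ℂ)) (hU : ∀ y ∈ U, A * y - y * A ∈ U)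
    (l : Matrix (Fin M) (Fin M) ℂ →ₗ[ℂ] ℂ) (hl : ∀ y ∈ U, l (A * y - y * A) = 0)
    (h : ∀ y ∈ U, Commute A y → l y = 0) : ∀ y ∈ U, l y = 0 := by
  let B : U →ₗ[ℂ] U :=
    { toFun := fun y => ⟨A * y - y * A, hU y y.2⟩
      map_add' := fun y z => Subtype.ext (by simp; noncomm_ring)
      map_smul' := fun c y => Subtype.ext (by simp [smul_sub]) }
  -- Disjointness and rank-nullity split `U` as kernel plus range of `ad A`; the functional vanishes
  -- on each.
  have hdisj : Disjoint (LinearMap.ker B) (LinearMap.range B) := by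
    rw [Submodule.disjoint_def]
    rintro _ hx ⟨y, rfl⟩
    have h1 := congrArg Subtype.val (LinearMap.mem_ker.1 hx)
    exact Subtype.ext (lie_eq_zero_of_lie_lie_eq_zero hA h1)
  have htop : LinearMap.ker B ⊔ LinearMap.range B = ⊤ :=
    Submodule.eq_top_of_disjoint _ _ (by
      rw [add_comm, LinearMap.finrank_range_add_finrank_ker]) hdisj
  intro y hy
  have hmem : (⟨y, hy⟩ : U) ∈ LinearMap.ker B ⊔ LinearMap.range B := htop ▸ Submodule.mem_top
  obtain ⟨a, ha, _, ⟨b, rfl⟩, hab⟩ := Submodule.mem_sup.1 hmem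
  have hab' : (a : Matrix (Fin M) (Fin M) ℂ) + (A * b - b * A) = y := congrArg Subtype.val hab
  have h1 : A * a - a * A = 0 := congrArg Subtype.val (LinearMap.mem_ker.1 ha)
  rw [← hab', map_add, hl b b.2, h a a.2 (sub_eq_zero.1 h1), add_zero]

/-- Impose the commutation conditions one at a time: as the `A i` commute, the commutant of some of
them is stable under the bracket with the next. -/
theorem eq_zero_of_commutant_family {κ : Type*} {A : κ → Matrix (Fin M) (Fin M) ℂ}
    (hA : ∀ i, Module.End.IsSemisimple (Matrix.toLin' (A i))) (hAA : ∀ i j, Commute (A i) (A j))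
    (U : Submodule ℂ (Matrix (Fin M) (Fin M) ℂ)) (hU : ∀ i, ∀ y ∈ U, A i * y - y * A i ∈ U)
    (l : Matrix (Fin M) (Fin M) ℂ →ₗ[ℂ] ℂ) (hl : ∀ i, ∀ y ∈ U, l (A i * y - y * A i) = 0)
    (T : Finset κ) : (∀ y ∈ U, (∀ i ∈ T, Commute (A i) y) → l y = 0) → ∀ y ∈ U, l y = 0 := by
  classical
  induction T using Finset.induction_on with
  | empty => exact fun h y hy => h y hy (by simp)
  | insert i T _ ih =>
    intro h
    refine ih ?_
    let W : Submodule ℂ (Matrix (Fin M) (Fin M) ℂ) :=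
      { carrier := {y | y ∈ U ∧ ∀ j ∈ T, Commute (A j) y}
        zero_mem' := ⟨U.zero_mem, fun j _ => Commute.zero_right _⟩
        add_mem' := fun hy hz => ⟨U.add_mem hy.1 hz.1, fun j hj =>
          (hy.2 j hj).add_right (hz.2 j hj)⟩
        smul_mem' := fun c y hy => ⟨U.smul_mem c hy.1, fun j hj => (hy.2 j hj).smul_right c⟩ }
    have := eq_zero_of_commutant (hA i) W
      (fun y hy => ⟨hU i y hy.1, fun j hj =>
        ((hAA j i).mul_right (hy.2 j hj)).sub_right ((hy.2 j hj).mul_right (hAA j i))⟩) l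
      (fun y hy => hl i y hy.1)
      (fun y hy hc => h y hy.1 fun j hj => by
        rcases Finset.mem_insert.1 hj with rfl | hj
        · exact hc
        · exact hy.2 j hj)
    exact fun y hy hT => this y ⟨hy, hT⟩

end AlgGroup

end

section

/-! ### The residues and the group `Aut(F)` -/

namespace HomogeneousRep

open Matrix NormedSpace

section

variable {k M : ℕ} {S : Type*} [Group S] {H : Subgroup (GeneralLinearGroup (Fin M) ℂ)}
  {F : Gtilde k S →* H}

/-- The image of `Aut(F)` in `GL_M(ℂ)`. -/
def autFImage (F : Gtilde k S →* H) : Subgroup (GeneralLinearGroup (Fin M) ℂ) :=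
  (AutF F).map H.subtype

theorem commute_iff_commute_mat {x y : H} : Commute x y ↔ Commute (mat x) (mat y) := by
  constructor
  · intro h
    exact congrArg (fun z : H => mat z) h.eq
  · intro h
    exact Subtype.ext (Units.ext h.eq)

theorem mem_AutF_iff {x : H} : x ∈ AutF F ↔ ∀ g, Commute (mat x) (mat (F g)) := by
  rw [AutF, Subgroup.mem_centralizer_iff]
  constructor
  · intro h g
    exact (commute_iff_commute_mat.1 (h _ ⟨g, rfl⟩)).symm
  · rintro h _ ⟨g, rfl⟩
    exact (commute_iff_commute_mat.2 (h g)).symm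

theorem mem_autFImage_iff {x : GeneralLinearGroup (Fin M) ℂ} :
    x ∈ autFImage F ↔ x ∈ H ∧ ∀ g, Commute x.val (mat (F g)) := by
  constructor
  · rintro ⟨y, hy, rfl⟩
    exact ⟨y.2, mem_AutF_iff.1 hy⟩
  · rintro ⟨hx, h⟩
    exact ⟨⟨x, hx⟩, mem_AutF_iff.2 h, rfl⟩

theorem isClosed_AutF : IsClosed[zariski (restrict (glRing M) H)] (AutF F : Set H) := by
  refine isClosed_zariski_of_forall (ι := Gtilde k S × Fin M × Fin M) _ _
    (fun p x => (mat x * mat (F p.1)) p.2.1 p.2.2 - (mat (F p.1) * mat x) p.2.1 p.2.2)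
    (fun p => ?_) fun x => ?_
  · have h1 : ∀ i j, (fun x : H => mat x i j) ∈ restrict (glRing M) H := fun i j =>
      entry_mem_pullbackRing H.subtype i j
    have h2 : ∀ i j, (fun _ : H => mat (F p.1) i j) ∈ restrict (glRing M) H := fun i j =>
      Subalgebra.algebraMap_mem _ (mat (F p.1) i j)
    exact Subalgebra.sub_mem _ (polynomial_mem_of_entries h1 h2 _ _)
      (polynomial_mem_of_entries h2 h1 _ _)
  · rw [SetLike.mem_coe, mem_AutF_iff]
    constructor
    · rintro h ⟨g, i, j⟩
      rw [(h g).eq, sub_self]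
    · intro h g
      ext i j
      exact sub_eq_zero.1 (h (g, i, j))

theorem isClosed_autFImage
    (hH : IsClosed[zariski (glRing M)] (H : Set (GeneralLinearGroup (Fin M) ℂ))) :
    IsClosed[zariski (glRing M)] (autFImage F : Set (GeneralLinearGroup (Fin M) ℂ)) := by
  refine isClosed_image_of_isClosed H.subtype ?_ _ isClosed_AutF
  rwa [Subgroup.coe_subtype, Subtype.range_coe_subtype]

/-- Commuting with `F g` is equivalent for `x` and for its whole one-parameter group, one direction
by differentiating at `0`. -/
theorem mem_tangentSpace_autFImage_iff
    (hH : IsClosed[zariski (glRing M)] (H : Set (GeneralLinearGroup (Fin M) ℂ)))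
    {x : Matrix (Fin M) (Fin M) ℂ} : x ∈ tangentSpace (autFImage F) (isClosed_autFImage hH) ↔
      x ∈ tangentSpace H hH ∧ ∀ g, Commute x (mat (F g)) := by
  simp only [mem_tangentSpace, mem_autFImage_iff]
  constructor
  · intro h
    exact ⟨fun t => (h t).1, fun g =>
      (commute_of_forall_commute_exp fun t => ((h t).2 g).symm).symm⟩
  · rintro ⟨h1, h2⟩ t
    refine ⟨h1 t, fun g => ?_⟩
    have : (F g : GeneralLinearGroup (Fin M) ℂ) * expGL (t • x) *
        (F g : GeneralLinearGroup (Fin M) ℂ)⁻¹ = expGL (t • x) := by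
      rw [← expGL_conj]
      congr 1
      have h3 := ((h2 g).smul_left t).symm.eq
      have h4 : mat (F g) * (t • x) * (F g : GeneralLinearGroup (Fin M) ℂ)⁻¹.val = t • x := by
        rw [h3, mul_assoc]
        have : mat (F g) * (F g : GeneralLinearGroup (Fin M) ℂ)⁻¹.val = 1 := Units.mul_inv _
        rw [this, mul_one]
      exact h4
    have h5 := mul_inv_eq_iff_eq_mul.1 this
    exact (congrArg Units.val h5).symm

end

section

variable {k d M : ℕ} {S : Type*} [TopologicalSpace S] [ChartedSpace (Fin d → ℂ) S] [Group S]
  {H : Subgroup (GeneralLinearGroup (Fin M) ℂ)} {F : Gtilde k S →* H}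

theorem differentiable_of_holomorphicOnGtilde {f : Gtilde k S → ℂ}
    (hf : HolomorphicOnGtilde (d := d) f) (a : Fin k → ℂ) :
    Differentiable ℂ fun t : ℂ => f (Multiplicative.ofAdd (t • a), 1) := by
  have h1 : ContMDiff 𝓘(ℂ) (𝓘(ℂ, Fin k → ℂ).prod 𝓘(ℂ, Fin d → ℂ)) ω
      (fun t : ℂ => ((t • a, 1) : (Fin k → ℂ) × S)) :=
    ContMDiff.prodMk (contDiff_id.smul contDiff_const).contMDiff contMDiff_const
  exact (ContMDiff.contDiff (hf.comp h1)).differentiable (by simp)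

theorem exists_mat_eq_exp
    (hF : ∀ i j : Fin M, HolomorphicOnGtilde (d := d) (fun g : Gtilde k S => mat (F g) i j))
    (a : Fin k → ℂ) : ∃ A : Matrix (Fin M) (Fin M) ℂ,
    (∀ i j, A i j = deriv (fun t : ℂ => mat (F (Multiplicative.ofAdd (t • a), 1)) i j) 0) ∧
    ∀ t : ℂ, mat (F (Multiplicative.ofAdd (t • a), 1)) = exp (t • A) := by
  refine ⟨_, fun i j => rfl, eq_exp_of_map_add
    (φ := fun t : ℂ => mat (F (Multiplicative.ofAdd (t • a), 1)))
    (fun i j => differentiable_of_holomorphicOnGtilde (hF i j) a) ?_ ?_⟩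
  · have : ((Multiplicative.ofAdd ((0 : ℂ) • a), 1) : Gtilde k S) = 1 := by
      rw [zero_smul]
      rfl
    rw [this, map_one]
    rfl
  · intro s t
    have : ((Multiplicative.ofAdd ((s + t) • a), 1) : Gtilde k S) =
        (Multiplicative.ofAdd (s • a), 1) * (Multiplicative.ofAdd (t • a), 1) := by
      rw [add_smul, Prod.mk_mul_mk, ofAdd_add, one_mul]
    rw [this, map_mul]
    rfl

theorem mat_single_eq_exp
    (hF : ∀ i j : Fin M, HolomorphicOnGtilde (d := d) (fun g : Gtilde k S => mat (F g) i j))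
    (i : Fin k) (t : ℂ) :
    mat (F (Multiplicative.ofAdd (Pi.single i t : Fin k → ℂ), 1)) = exp (t • residue F i) := by
  have hs : ∀ t : ℂ, (Pi.single i t : Fin k → ℂ) = t • Pi.single i 1 := fun t => by
    rw [← Pi.single_smul, smul_eq_mul, mul_one]
  obtain ⟨A, hA, h⟩ := exists_mat_eq_exp hF (Pi.single i 1)
  have : residue F i = A := by
    ext a b
    rw [hA, residue, Matrix.of_apply]
    congr 1
    funext t
    rw [hs t]
  rw [this, hs, h]

theorem commute_residue_iff
    (hF : ∀ i j : Fin M, HolomorphicOnGtilde (d := d) (fun g : Gtilde k S => mat (F g) i j))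
    (x : Matrix (Fin M) (Fin M) ℂ) (i : Fin k) :
    Commute x (residue F i) ↔
      ∀ t : ℂ, Commute x (mat (F (Multiplicative.ofAdd (Pi.single i t : Fin k → ℂ), 1))) := by
  simp only [mat_single_eq_exp hF]
  constructor
  · intro h t
    exact (h.smul_right t).exp_right
  · exact commute_of_forall_commute_exp

theorem residue_commute
    (hF : ∀ i j : Fin M, HolomorphicOnGtilde (d := d) (fun g : Gtilde k S => mat (F g) i j))
    (i j : Fin k) : Commute (residue F i) (residue F j) := by
  rw [commute_residue_iff hF]
  intro t
  refine Commute.symm ((commute_residue_iff hF _ _).2 fun s => ?_)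
  rw [← commute_iff_commute_mat]
  refine Commute.map (f := F) ?_
  change _ * _ = _ * _
  rw [Prod.mk_mul_mk, Prod.mk_mul_mk, mul_comm]

theorem commute_residue_mat
    (hF : ∀ i j : Fin M, HolomorphicOnGtilde (d := d) (fun g : Gtilde k S => mat (F g) i j))
    (i : Fin k) (s : S) :
    Commute (residue F i) (mat (F (1, s))) := by
  refine Commute.symm ((commute_residue_iff hF _ _).2 fun t => ?_)
  rw [← commute_iff_commute_mat]
  refine Commute.map (f := F) ?_
  change _ * _ = _ * _
  rw [Prod.mk_mul_mk, Prod.mk_mul_mk, mul_comm]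
  simp

/-- The coordinate lines of `ℂ^k` and the factor `S` generate `G̃`, and on the `i`-th line `F` is
the exponential of `S_i`. -/
theorem forall_commute_iff
    (hF : ∀ i j : Fin M, HolomorphicOnGtilde (d := d) (fun g : Gtilde k S => mat (F g) i j))
    (x : Matrix (Fin M) (Fin M) ℂ) : (∀ g, Commute x (mat (F g))) ↔
    (∀ i, Commute x (residue F i)) ∧ ∀ s : S, Commute x (mat (F (1, s))) := by
  constructor
  · exact fun h => ⟨fun i => (commute_residue_iff hF x i).2 fun t => h _, fun s => h _⟩
  · rintro ⟨h1, h2⟩ ⟨a, s⟩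
    have key : ∀ T : Finset (Fin k), Commute x
        (mat (F (Multiplicative.ofAdd (∑ i ∈ T, Pi.single i (a.toAdd i) : Fin k → ℂ), 1))) := by
      classical
      intro T
      induction T using Finset.induction_on with
      | empty =>
        have : ((Multiplicative.ofAdd (∑ i ∈ (∅ : Finset (Fin k)),
            Pi.single i (a.toAdd i) : Fin k → ℂ), 1) : Gtilde k S) = 1 := by
          rw [Finset.sum_empty]
          rfl
        rw [this, map_one]
        exact Commute.one_right x
      | insert i T hi ih =>
        have : ((Multiplicative.ofAdd (∑ j ∈ insert i T,
            Pi.single j (a.toAdd j) : Fin k → ℂ), 1) : Gtilde k S) =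
            (Multiplicative.ofAdd (Pi.single i (a.toAdd i) : Fin k → ℂ), 1) *
            (Multiplicative.ofAdd (∑ j ∈ T, Pi.single j (a.toAdd j) : Fin k → ℂ), 1) := by
          rw [Finset.sum_insert hi, Prod.mk_mul_mk, ofAdd_add, one_mul]
        rw [this, map_mul]
        exact ((commute_residue_iff hF x i).1 (h1 i) _).mul_right ih
    have h3 := key Finset.univ
    rw [Finset.univ_sum_single] at h3
    have h4 : ((a, s) : Gtilde k S) = (Multiplicative.ofAdd (a.toAdd), 1) * (1, s) := by
      rw [Prod.mk_mul_mk, mul_one, one_mul]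
      rfl
    rw [h4, map_mul]
    exact h3.mul_right (h2 s)

/-- The monodromy around the `i`-th factor is `exp (2πi S_i)`. -/
theorem residue_isSemisimple
    (hF : ∀ i j : Fin M, HolomorphicOnGtilde (d := d) (fun g : Gtilde k S => mat (F g) i j))
    (hFss : ∀ n : Fin k → ℤ, Module.End.IsSemisimple (Matrix.toLin' (mat (monodromy F n))))
    (i : Fin k) : Module.End.IsSemisimple (Matrix.toLin' (residue F i)) := by
  refine isSemisimple_of_isSemisimple_exp (c := 2 * (Real.pi : ℂ) * Complex.I) ?_ ?_
  · exact Complex.two_pi_I_ne_zero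
  · have h := hFss (Pi.single i 1)
    have h2 : (fun j => 2 * (Real.pi : ℂ) * Complex.I * ((Pi.single i 1 : Fin k → ℤ) j : ℂ)) =
        (Pi.single i (2 * (Real.pi : ℂ) * Complex.I) : Fin k → ℂ) := by
      funext j
      by_cases hj : j = i
      · subst hj
        simp
      · simp [hj]
    rwa [monodromy, h2, mat_single_eq_exp hF] at h

end

end HomogeneousRep

end

section

/-! ### Reductivity of `Aut(F)` -/

namespace AlgGroup

open Matrix

variable {M : ℕ}

/-- An invariant functional on a space of matrices stable under the adjoint action of a
semisimple Lie algebra vanishes if it vanishes on the invariants. -/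
theorem eq_zero_of_invariants {L : Type*} [LieRing L] [LieAlgebra ℂ L] [FiniteDimensional ℂ L]
    [LieAlgebra.IsKilling ℂ L] (D : L →ₗ[ℂ] Matrix (Fin M) (Fin M) ℂ)
    (hD : ∀ v w, D ⁅v, w⁆ = D v * D w - D w * D v)
    (U : Submodule ℂ (Matrix (Fin M) (Fin M) ℂ)) (hU : ∀ v, ∀ y ∈ U, D v * y - y * D v ∈ U)
    (l : Matrix (Fin M) (Fin M) ℂ →ₗ[ℂ] ℂ) (hl : ∀ v, ∀ y ∈ U, l (D v * y - y * D v) = 0)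
    (h : ∀ y ∈ U, (∀ v, Commute y (D v)) → l y = 0) : ∀ y ∈ U, l y = 0 := by
  -- `U` becomes a representation by letting `v` act as the commutator with `D v`.
  let _ : LieRingModule L U :=
    { bracket := fun v y => ⟨D v * y - y * D v, hU v y y.2⟩
      add_lie := fun v w y => Subtype.ext (by
        change D (v + w) * y.1 - y.1 * D (v + w) =
          (D v * y.1 - y.1 * D v) + (D w * y.1 - y.1 * D w)
        rw [map_add]
        noncomm_ring)
      lie_add := fun v y z => Subtype.ext (by
        change D v * (y.1 + z.1) - (y.1 + z.1) * D v =
          (D v * y.1 - y.1 * D v) + (D v * z.1 - z.1 * D v)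
        noncomm_ring)
      leibniz_lie := fun v w y => Subtype.ext (by
        change D v * (D w * y.1 - y.1 * D w) - (D w * y.1 - y.1 * D w) * D v =
          (D ⁅v, w⁆ * y.1 - y.1 * D ⁅v, w⁆) +
          (D w * (D v * y.1 - y.1 * D v) - (D v * y.1 - y.1 * D v) * D w)
        rw [hD]
        noncomm_ring) }
  have hbr : ∀ (v : L) (y : U), ((⁅v, y⁆ : U) : Matrix (Fin M) (Fin M) ℂ) = D v * y - y * D v :=
    fun v y => rfl
  let _ : LieModule ℂ L U :=
    { smul_lie := fun c v y => Subtype.ext (by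
        rw [hbr, map_smul, Submodule.coe_smul, hbr, smul_sub, smul_mul_assoc, mul_smul_comm])
      lie_smul := fun c v y => Subtype.ext (by
        rw [hbr, Submodule.coe_smul, Submodule.coe_smul, hbr, smul_sub, smul_mul_assoc,
          mul_smul_comm]) }
  by_contra hne
  push Not at hne
  obtain ⟨y, hy, hly⟩ := hne
  obtain ⟨w, hw, hlw⟩ := LieModule.exists_invariant_of_invariant_functional (L := L) _ U rfl
    (l.comp U.subtype) (fun v w => hl v w w.2)
    (fun h0 => hly (LinearMap.congr_fun h0 ⟨y, hy⟩))
  refine hlw (h w w.2 fun v => ?_)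
  have := congrArg Subtype.val (hw v)
  exact (sub_eq_zero.1 this).symm

end AlgGroup

namespace HomogeneousRep

open Matrix

variable {k d M : ℕ} {S : Type*} [TopologicalSpace S] [ChartedSpace (Fin d → ℂ) S] [Group S]
  [LieGroup 𝓘(ℂ, Fin d → ℂ) ω S] [PreconnectedSpace S]
  {H : Subgroup (GeneralLinearGroup (Fin M) ℂ)} {F : Gtilde k S →* H}

theorem conj_mem_tangentSpace_of_mem
    (hH : IsClosed[zariski (glRing M)] (H : Set (GeneralLinearGroup (Fin M) ℂ)))
    {g : GeneralLinearGroup (Fin M) ℂ} (hg : g ∈ H) {x : Matrix (Fin M) (Fin M) ℂ}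
    (hx : x ∈ tangentSpace H hH) : g.val * x * g⁻¹.val ∈ tangentSpace H hH :=
  conj_mem_tangentSpace (fun _ hn => H.mul_mem (H.mul_mem hg hn) (H.inv_mem hg)) hx

/-- For `x` orthogonal to `Lie(Aut F)`, the functional `tr(x ·)` on `Lie(H)` is invariant and
vanishes on invariants, hence vanishes; nondegeneracy for `H` gives `x = 0`. -/
theorem trace_nondegenerate_autFImage
    (hH : IsClosed[zariski (glRing M)] (H : Set (GeneralLinearGroup (Fin M) ℂ)))
    (hred : IsReductive (restrict (glRing M) H))
    (hS : LieAlgebra.IsSemisimple ℂ (GroupLieAlgebra 𝓘(ℂ, Fin d → ℂ) S))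
    (hF : ∀ i j : Fin M, HolomorphicOnGtilde (d := d) (fun g : Gtilde k S => mat (F g) i j))
    (hFss : ∀ n : Fin k → ℤ, Module.End.IsSemisimple (Matrix.toLin' (mat (monodromy F n))))
    {x : Matrix (Fin M) (Fin M) ℂ} (hx : x ∈ tangentSpace (autFImage F) (isClosed_autFImage hH))
    (h : ∀ y ∈ tangentSpace (autFImage F) (isClosed_autFImage hH), (x * y).trace = 0) :
    x = 0 := by
  obtain ⟨hxH, hxF⟩ := (mem_tangentSpace_autFImage_iff hH).1 hx
  obtain ⟨hxA, hxS⟩ := (forall_commute_iff hF x).1 hxF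
  let T : S →* GeneralLinearGroup (Fin M) ℂ :=
    H.subtype.comp (F.comp (MonoidHom.inr (Multiplicative (Fin k → ℂ)) S))
  have hT : ∀ s, (T s).val = mat (F (1, s)) := fun s => rfl
  have hThol : ∀ i j, ContMDiff 𝓘(ℂ, Fin d → ℂ) 𝓘(ℂ) ω (fun s => (T s).val i j) := by
    intro i j
    have h1 : ContMDiff 𝓘(ℂ, Fin d → ℂ) (𝓘(ℂ, Fin k → ℂ).prod 𝓘(ℂ, Fin d → ℂ)) ω
        (fun s : S => ((0, s) : (Fin k → ℂ) × S)) := contMDiff_const.prodMk contMDiff_id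
    exact (hF i j).comp h1
  obtain ⟨D, hDlie, hDinv, hDcomm⟩ := exists_differential T hThol
  have hstable : ∀ U : Submodule ℂ (Matrix (Fin M) (Fin M) ℂ),
      (∀ s, ∀ y ∈ U, (T s).val * y * (T s)⁻¹.val ∈ U) →
      ∀ v, ∀ y ∈ U, D v * y - y * D v ∈ U := by
    intro U hU v y hy
    rw [← Subspace.forall_mem_dualAnnihilator_apply_eq_zero_iff]
    intro f hf
    rw [Submodule.mem_dualAnnihilator] at hf
    exact hDinv f y (fun s => by rw [hf _ (hU s y hy), hf _ hy]) v
  have : FiniteDimensional ℂ (GroupLieAlgebra 𝓘(ℂ, Fin d → ℂ) S) :=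
    inferInstanceAs (FiniteDimensional ℂ (Fin d → ℂ))
  let l : Matrix (Fin M) (Fin M) ℂ →ₗ[ℂ] ℂ :=
    (Matrix.traceLinearMap (Fin M) ℂ ℂ).comp (LinearMap.mulLeft ℂ x)
  have hl : ∀ y, l y = (x * y).trace := fun y => rfl
  -- By cyclicity `tr(x [a, y]) = tr([x, a] y)`.
  have hlcomm : ∀ a y, Commute x a → l (a * y - y * a) = 0 := by
    intro a y ha
    rw [hl, mul_sub, Matrix.trace_sub, ← mul_assoc, ha.eq, mul_assoc, Matrix.trace_mul_comm,
      mul_assoc, sub_self]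
  have hxinv : ∀ s, (T s)⁻¹.val * x * (T s).val = x := by
    intro s
    rw [mul_assoc, show x * (T s).val = (T s).val * x from (hxS s).eq, ← mul_assoc,
      Units.inv_mul, one_mul]
  refine trace_nondegenerate_of_isReductive hH hred hxH fun y hy => ?_
  have hAH : ∀ i, residue F i ∈ tangentSpace H hH := by
    intro i t
    have h1 := mat_single_eq_exp hF i t
    have h2 : expGL (t • residue F i) =
        (F (Multiplicative.ofAdd (Pi.single i t : Fin k → ℂ), 1) : GeneralLinearGroup _ ℂ) :=
      Units.ext h1.symm
    rw [h2]
    exact SetLike.coe_mem _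
  -- The reduction to invariants has two stages: to the commutant of the `S_i` in `Lie(H)`, then,
  -- inside that commutant `W`, to the invariants of `S`.
  refine eq_zero_of_commutant_family (residue_isSemisimple hF hFss) (residue_commute hF)
    (tangentSpace H hH)
    (fun i y hy => lie_mem_tangentSpace (fun g hg n hn =>
      H.mul_mem (H.mul_mem hg hn) (H.inv_mem hg)) (hAH i) hy) l
    (fun i y _ => hlcomm _ y (hxA i)) Finset.univ ?_ y hy
  let W : Submodule ℂ (Matrix (Fin M) (Fin M) ℂ) :=
    { carrier := {y | y ∈ tangentSpace H hH ∧ ∀ i, Commute (residue F i) y}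
      zero_mem' := ⟨Submodule.zero_mem _, fun j => Commute.zero_right _⟩
      add_mem' := fun hy hz => ⟨Submodule.add_mem _ hy.1 hz.1, fun j =>
        (hy.2 j).add_right (hz.2 j)⟩
      smul_mem' := fun c y hy => ⟨Submodule.smul_mem _ c hy.1, fun j => (hy.2 j).smul_right c⟩ }
  have hWl := eq_zero_of_invariants D hDlie W (hstable W fun s y hy => by
      refine ⟨conj_mem_tangentSpace_of_mem hH (SetLike.coe_mem _) hy.1, fun i => ?_⟩
      have h1 := commute_residue_mat hF i s
      have h2 : Commute (residue F i) (T s)⁻¹.val := by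
        have h3 := commute_residue_mat hF i s⁻¹
        have h4 : mat (F (1, s⁻¹)) = (T s)⁻¹.val := by
          rw [← map_inv]
          rfl
        rwa [h4] at h3
      exact (h1.mul_right (hy.2 i)).mul_right h2) l
    (fun v y _ => hDinv l y (fun s => by
      rw [hl, hl, ← mul_assoc, Matrix.trace_mul_comm, ← mul_assoc, ← mul_assoc, hxinv]) v)
    (fun y hy hyD => h y ((mem_tangentSpace_autFImage_iff hH).2 ⟨hy.1,
      (forall_commute_iff hF y).2 ⟨fun i => (hy.2 i).symm, fun s => hDcomm y hyD s⟩⟩))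
  exact fun y hy hyA => hWl y ⟨hy, fun i => hyA i (Finset.mem_univ i)⟩

/-- Stated for any faithful homomorphism with the given image, since it applies both to `Aut(F)`
inside `H` and to the group of constant maps. -/
theorem isReductive_of_range_eq_autFImage
    (hH : IsClosed[zariski (glRing M)] (H : Set (GeneralLinearGroup (Fin M) ℂ)))
    (hred : IsReductive (restrict (glRing M) H))
    (hS : LieAlgebra.IsSemisimple ℂ (GroupLieAlgebra 𝓘(ℂ, Fin d → ℂ) S))
    (hF : ∀ i j : Fin M, HolomorphicOnGtilde (d := d) (fun g : Gtilde k S => mat (F g) i j))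
    (hFss : ∀ n : Fin k → ℤ, Module.End.IsSemisimple (Matrix.toLin' (mat (monodromy F n))))
    {A : Type*} [Group A] (ι : A →* GeneralLinearGroup (Fin M) ℂ) (hι : Function.Injective ι)
    (hr : ι.range = autFImage F) : IsReductive (pullbackRing ι) := by
  have hc : IsClosed[zariski (glRing M)] (ι.range : Set (GeneralLinearGroup (Fin M) ℂ)) := by
    rw [hr]
    exact isClosed_autFImage hH
  have hmem : ∀ x, x ∈ tangentSpace ι.range hc ↔
      x ∈ tangentSpace (autFImage F) (isClosed_autFImage hH) := by
    intro x
    rw [mem_tangentSpace, mem_tangentSpace, hr]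
  refine isReductive_of_trace_nondegenerate ι hι hc fun x hx h => ?_
  exact trace_nondegenerate_autFImage hH hred hS hF hFss ((hmem x).1 hx)
    fun y hy => h y ((hmem y).2 hy)

end HomogeneousRep

end

section

/-! ### Finite-dimensionality of spaces of maps equivariant under a contraction -/

namespace HomogeneousRep

open Matrix

variable {M : ℕ} {V : Type*} [NormedAddCommGroup V] [NormedSpace ℂ V]

theorem isBigO_norm_pow_of_iteratedFDeriv_eq_zero {f : V → ℂ} (hf : ContDiff ℂ ω f) (N : ℕ)
    (h : ∀ m < N, ∀ y, iteratedFDeriv ℂ m f 0 (fun _ => y) = 0) :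
    f =O[𝓝 0] fun y => ‖y‖ ^ N := by
  obtain ⟨p, r, hp⟩ := hf.contDiffAt.analyticAt (x := (0 : V))
  have h1 := hp.hasFPowerSeriesAt.isBigO_sub_partialSum_pow N
  have h2 : ∀ y, p.partialSum N y = 0 := by
    intro y
    refine Finset.sum_eq_zero fun m hm => ?_
    have h3 := hp.factorial_smul y m
    rw [h m (Finset.mem_range.1 hm), ← Nat.cast_smul_eq_nsmul ℂ] at h3
    exact (smul_eq_zero.1 h3).resolve_left (Nat.cast_ne_zero.2 m.factorial_ne_zero)
  simpa [h2] using h1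

theorem exists_norm_pow_entry_le (x : Matrix (Fin M) (Fin M) ℂ) :
    ∃ K : ℝ, 0 ≤ K ∧ ∀ (n : ℕ) (i j : Fin M), ‖(x ^ n) i j‖ ≤ K ^ n := by
  refine ⟨∑ l, ∑ j, ‖x l j‖, by positivity, fun n => ?_⟩
  induction n with
  | zero =>
    intro i j
    rw [pow_zero, pow_zero, Matrix.one_apply]
    split_ifs <;> simp
  | succ n ih =>
    intro i j
    rw [pow_succ, Matrix.mul_apply]
    calc ‖∑ l, (x ^ n) i l * x l j‖ ≤ ∑ l, ‖(x ^ n) i l * x l j‖ := norm_sum_le _ _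
      _ ≤ ∑ l, (∑ l, ∑ j, ‖x l j‖) ^ n * ∑ j, ‖x l j‖ := by
        refine Finset.sum_le_sum fun l _ => ?_
        rw [norm_mul]
        refine mul_le_mul (ih i l) ?_ (norm_nonneg _) (by positivity)
        exact Finset.single_le_sum (f := fun j => ‖x l j‖) (fun _ _ => norm_nonneg _)
          (Finset.mem_univ j)
      _ = (∑ l, ∑ j, ‖x l j‖) ^ (n + 1) := by rw [← Finset.mul_sum, pow_succ]

/-- The `m`-jet at `0`, as a multilinear map, of the entries of the maps in a space of
holomorphic maps. -/
noncomputable def jet {Y : Submodule ℂ (V → Matrix (Fin M) (Fin M) ℂ)}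
    (hhol : ∀ f ∈ Y, ∀ i j, ContDiff ℂ ω fun v => f v i j) (N : ℕ) :
    Y →ₗ[ℂ] ((i j : Fin M) → (m : Fin N) → MultilinearMap ℂ (fun _ : Fin m => V) ℂ) where
  toFun f i j m := (iteratedFDeriv ℂ m (fun v => f.1 v i j) 0).toMultilinearMap
  map_add' f g := by
    funext i j m
    have := iteratedFDeriv_add_apply (x := 0) (i := m)
      ((hhol f.1 f.2 i j).contDiffAt.of_le le_top) ((hhol g.1 g.2 i j).contDiffAt.of_le le_top)
    exact congrArg ContinuousMultilinearMap.toMultilinearMap this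
  map_smul' c f := by
    funext i j m
    have := iteratedFDeriv_const_smul_apply (x := 0) (i := m) (a := c)
      ((hhol f.1 f.2 i j).contDiffAt.of_le le_top)
    exact congrArg ContinuousMultilinearMap.toMultilinearMap this

/-- Iterating equivariance gives `f v = b⁻ⁿ f (Λⁿ v) bⁿ`. If `f` vanishes to high order at `0`, the
middle factor decays faster than the outer ones grow, so `f = 0` and jets of bounded order are
injective. -/
theorem finiteDimensional_of_contracting [FiniteDimensional ℂ V] (Λ : V → V) {r : ℝ} (hr0 : 0 < r)
    (hr1 : r < 1) (hΛ : ∀ v, ∃ C : ℝ, ∀ n : ℕ, ‖Λ^[n] v‖ ≤ C * r ^ n)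
    (b : GeneralLinearGroup (Fin M) ℂ) (Y : Submodule ℂ (V → Matrix (Fin M) (Fin M) ℂ))
    (hhol : ∀ f ∈ Y, ∀ i j, ContDiff ℂ ω fun v => f v i j)
    (heq : ∀ f ∈ Y, ∀ v, f (Λ v) = b.val * f v * b⁻¹.val) : FiniteDimensional ℂ Y := by
  obtain ⟨K, hK0, hK⟩ := exists_norm_pow_entry_le b.val
  obtain ⟨K', hK0', hK'⟩ := exists_norm_pow_entry_le b⁻¹.val
  -- The jet order is chosen so that `N` factors of contraction beat the growth `K' K` of
  -- conjugation.
  obtain ⟨N, hN⟩ : ∃ N : ℕ, K' * K * r ^ N < 1 := by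
    have h1 : Filter.Tendsto (fun N : ℕ => K' * K * r ^ N) Filter.atTop (𝓝 (K' * K * 0)) :=
      (tendsto_pow_atTop_nhds_zero_of_lt_one hr0.le hr1).const_mul _
    rw [mul_zero] at h1
    exact (h1.eventually (gt_mem_nhds one_pos)).exists
  refine FiniteDimensional.of_injective (jet hhol N) ((injective_iff_map_eq_zero _).2 ?_)
  rintro ⟨f, hf⟩ hjet
  have hO : ∀ i j, (fun v => f v i j) =O[𝓝 0] fun v => ‖v‖ ^ N := by
    intro i j
    refine isBigO_norm_pow_of_iteratedFDeriv_eq_zero (hhol f hf i j) N fun m hm y => ?_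
    have := congrFun (congrFun (congrFun hjet i) j) ⟨m, hm⟩
    exact DFunLike.congr_fun this fun _ => y
  refine Subtype.ext (funext fun v => ?_)
  have hiter : ∀ n : ℕ, f (Λ^[n] v) = b.val ^ n * f v * b⁻¹.val ^ n := by
    intro n
    induction n with
    | zero => simp
    | succ n ih =>
      rw [Function.iterate_succ_apply', heq f hf, ih, pow_succ' b.val, pow_succ b⁻¹.val]
      simp only [mul_assoc]
  have hinv : ∀ n : ℕ, f v = b⁻¹.val ^ n * f (Λ^[n] v) * b.val ^ n := by
    intro n
    have h1 : b⁻¹.val ^ n * b.val ^ n = 1 := by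
      rw [← Units.val_pow_eq_pow_val, ← Units.val_pow_eq_pow_val, ← Units.val_mul, inv_pow,
        inv_mul_cancel, Units.val_one]
    rw [hiter]
    calc f v = (b⁻¹.val ^ n * b.val ^ n) * f v * (b⁻¹.val ^ n * b.val ^ n) := by
          rw [h1, one_mul, mul_one]
      _ = _ := by simp only [mul_assoc]
  obtain ⟨C, hC⟩ := hΛ v
  have hC0 : 0 ≤ C := by simpa using (norm_nonneg _).trans (hC 0)
  have htend : Filter.Tendsto (fun n : ℕ => Λ^[n] v) Filter.atTop (𝓝 0) := by
    refine squeeze_zero_norm hC ?_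
    simpa using (tendsto_pow_atTop_nhds_zero_of_lt_one hr0.le hr1).const_mul C
  ext i j
  have hsum : ∀ n : ℕ, f v i j = ∑ l, (∑ m, (b⁻¹.val ^ n) i m * f (Λ^[n] v) m l) *
      (b.val ^ n) l j := by
    intro n
    conv_lhs => rw [hinv n, Matrix.mul_apply]
    simp only [Matrix.mul_apply]
  have hzero : Filter.Tendsto (fun n : ℕ => ∑ l, (∑ m, (b⁻¹.val ^ n) i m * f (Λ^[n] v) m l) *
      (b.val ^ n) l j) Filter.atTop (𝓝 0) := by
    rw [← Finset.sum_const_zero (s := (Finset.univ : Finset (Fin M)))]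
    refine tendsto_finsetSum _ fun l _ => ?_
    simp only [Finset.sum_mul]
    rw [← Finset.sum_const_zero (s := (Finset.univ : Finset (Fin M)))]
    refine tendsto_finsetSum _ fun m _ => ?_
    obtain ⟨B, hB0, hB⟩ := (hO m l).exists_nonneg
    have hB' := htend.eventually hB.bound
    have hlim : Filter.Tendsto (fun n : ℕ => B * C ^ N * (K' * K * r ^ N) ^ n) Filter.atTop
        (𝓝 0) := by
      simpa using (tendsto_pow_atTop_nhds_zero_of_lt_one (by positivity) hN).const_mul (B * C ^ N)
    refine squeeze_zero_norm' ?_ hlim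
    filter_upwards [hB'] with n hn
    rw [norm_mul, norm_mul]
    rw [norm_pow, norm_norm] at hn
    calc ‖(b⁻¹.val ^ n) i m‖ * ‖f (Λ^[n] v) m l‖ * ‖(b.val ^ n) l j‖
        ≤ K' ^ n * (B * (C * r ^ n) ^ N) * K ^ n := by
          gcongr
          · exact hK' n i m
          · exact hn.trans (by gcongr; exact hC n)
          · exact hK n l j
      _ = B * C ^ N * (K' * K * r ^ N) ^ n := by
          rw [mul_pow, mul_pow, mul_pow, ← pow_mul, ← pow_mul, mul_comm n N]
          ring
  have h1 : Filter.Tendsto (fun _ : ℕ => f v i j) Filter.atTop (𝓝 0) :=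
    hzero.congr fun n => (hsum n).symm
  exact tendsto_nhds_unique tendsto_const_nhds h1

/-- Every functional on a finite-dimensional space of matrix valued functions is a linear
combination of evaluations of entries. -/
theorem mem_span_eval {X : Type*} (Y : Submodule ℂ (X → Matrix (Fin M) (Fin M) ℂ))
    [FiniteDimensional ℂ Y] (l : Y →ₗ[ℂ] ℂ) :
    l ∈ Submodule.span ℂ (Set.range fun p : X × Fin M × Fin M =>
      ({ toFun := fun f => f.1 p.1 p.2.1 p.2.2
         map_add' := fun _ _ => rfl
         map_smul' := fun _ _ => rfl } : Y →ₗ[ℂ] ℂ)) := by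
  set W := Submodule.span ℂ (Set.range fun p : X × Fin M × Fin M =>
      ({ toFun := fun f => f.1 p.1 p.2.1 p.2.2
         map_add' := fun _ _ => rfl
         map_smul' := fun _ _ => rfl } : Y →ₗ[ℂ] ℂ)) with hW
  -- Evaluations of entries separate the elements of `Y`, so they span the dual of this
  -- finite-dimensional space.
  have h1 : Submodule.dualCoannihilator W = ⊥ := by
    rw [eq_bot_iff]
    intro f hf
    rw [Submodule.mem_dualCoannihilator] at hf
    refine (Submodule.mem_bot ℂ).2 (Subtype.ext (funext fun v => ?_))
    ext i j
    exact hf _ (Submodule.subset_span ⟨(v, i, j), rfl⟩)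
  have h2 : W = ⊤ := by
    rw [← Subspace.dualCoannihilator_dualAnnihilator_eq (W := W), h1,
      Submodule.dualAnnihilator_bot]
  rw [h2]
  exact Submodule.mem_top

end HomogeneousRep

end

section

/-! ### The one-parameter subgroup acting with positive weights -/

namespace HomogeneousRep

open Matrix

section

variable {k : ℕ} {S : Type*} [Group S]

/-- The one-parameter subgroup `t ↦ (t a_1, …, t a_k)` of `ℂ^k ⊆ G̃`. -/
def oneParam (S : Type*) [Group S] (a : Fin k → ℤ) (t : ℂ) : Gtilde k S :=
  (Multiplicative.ofAdd (t • fun i => (a i : ℂ)), 1)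

theorem oneParam_mul_comm (a : Fin k → ℤ) (t : ℂ) (g : Gtilde k S) :
    oneParam S a t * g = g * oneParam S a t := by
  obtain ⟨b, s⟩ := g
  rw [oneParam, Prod.mk_mul_mk, Prod.mk_mul_mk, mul_comm, one_mul, mul_one]

theorem oneParam_zero (a : Fin k → ℤ) : oneParam S a 0 = 1 := by
  rw [oneParam, zero_smul]
  rfl

theorem oneParam_add (a : Fin k → ℤ) (s t : ℂ) :
    oneParam S a (s + t) = oneParam S a s * oneParam S a t := by
  rw [oneParam, oneParam, oneParam, add_smul, Prod.mk_mul_mk, ofAdd_add, one_mul]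

theorem cover_oneParam (a : Fin k → ℤ) (t : ℂ) : cover k S (oneParam S a t) =
    (fun i => Units.mk0 (Complex.exp t) (Complex.exp_ne_zero t) ^ a i, 1) := by
  refine Prod.ext (funext fun i => Units.ext ?_) rfl
  change Complex.exp (t * (a i : ℂ)) = _
  rw [mul_comm, Complex.exp_int_mul]
  simp

variable {V : Type*} [NormedAddCommGroup V] [NormedSpace ℂ V]
  {ρ : Representation ℂ ((Fin k → ℂˣ) × S) V}

/-- A vector of weight `n` moves along `z ^ n • v`, and `n > 0` lets the orbit extend over `z = 0`
with value `0` and a linear bound on the unit disc. The general case is a sum of these. -/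
theorem exists_scaling {a : Fin k → ℤ}
    (ha : ⨆ n : {n : ℤ // 0 < n}, weightSpace ρ a n = ⊤) (v : V) :
    ∃ c : ℂ → V, Continuous c ∧ c 0 = 0 ∧
      (∀ t, ρ (cover k S (oneParam S a t)) v = c (Complex.exp t)) ∧
      ∃ C : ℝ, ∀ z, ‖z‖ ≤ 1 → ‖c z‖ ≤ C * ‖z‖ := by
  have hv : v ∈ ⨆ n : {n : ℤ // 0 < n}, weightSpace ρ a n := ha ▸ Submodule.mem_top
  induction hv using Submodule.iSup_induction' with
  | mem n v hv =>
    obtain ⟨n, hn⟩ := n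
    lift n to ℕ using hn.le
    have hn' : n ≠ 0 := by
      rintro rfl
      simp at hn
    refine ⟨fun z => z ^ n • v, by fun_prop, by simp [hn'], fun t => ?_, ‖v‖, fun z hz => ?_⟩
    · rw [cover_oneParam]
      have := hv (Units.mk0 (Complex.exp t) (Complex.exp_ne_zero t))
      simpa using this
    · rw [norm_smul, norm_pow, mul_comm]
      exact mul_le_mul_of_nonneg_left (pow_le_of_le_one (norm_nonneg _) hz hn') (norm_nonneg _)
  | zero => exact ⟨fun _ => 0, continuous_const, rfl, fun t => map_zero _, 0, fun z _ => by simp⟩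
  | add v w _ _ hv hw =>
    obtain ⟨c, hc, hc0, hct, C, hC⟩ := hv
    obtain ⟨c', hc', hc0', hct', C', hC'⟩ := hw
    refine ⟨fun z => c z + c' z, hc.add hc', by simp [hc0, hc0'], fun t => ?_, C + C',
      fun z hz => ?_⟩
    · rw [map_add, hct, hct']
    · rw [add_mul]
      exact (norm_add_le _ _).trans (add_le_add (hC z hz) (hC' z hz))

end

/-! ### The group `Aut(p^*F)` -/

section

variable {k M : ℕ} {S : Type*} [Group S] {H : Subgroup (GeneralLinearGroup (Fin M) ℂ)}
  {V : Type*} [NormedAddCommGroup V] [NormedSpace ℂ V]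
  {ρ : Representation ℂ ((Fin k → ℂˣ) × S) V} {F : Gtilde k S →* H}

theorem Aut.apply_smul (h : Aut ρ (pullback V F)) (g : Gtilde k S) (v : V) :
    (h : V → H) (ρ (cover k S g) v) = F g * (h : V → H) v * (F g)⁻¹ :=
  eq_mul_inv_of_mul_eq (h.2.2 g v)

variable (ρ F) in
/-- Evaluation at a point, as a homomorphism to `GL_M(ℂ)`. -/
def evalGL (v : V) : Aut ρ (pullback V F) →* GeneralLinearGroup (Fin M) ℂ :=
  H.subtype.comp ((Pi.evalMonoidHom (fun _ : V => H) v).comp (Aut ρ (pullback V F)).subtype)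

theorem evalGL_mem (v : V) (h : Aut ρ (pullback V F)) : evalGL ρ F v h ∈ H :=
  SetLike.coe_mem _

theorem Aut.ext_of_evalGL {h h' : Aut ρ (pullback V F)}
    (H' : ∀ v, evalGL ρ F v h = evalGL ρ F v h') : h = h' :=
  Subtype.ext (funext fun v => Subtype.ext (H' v))

theorem autRing_eq_adjoin : autRing ρ (pullback V F) =
    Algebra.adjoin ℂ (⋃ v : V, (pullbackRing (evalGL ρ F v) : Set (Aut ρ (pullback V F) → ℂ))) := by
  rw [autRing]
  congr 1
  ext f
  simp only [Set.mem_ofPred_eq, Set.mem_iUnion, SetLike.mem_coe]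
  refine exists_congr fun v => ?_
  rw [restrict_glRing, mem_pullbackRing]
  constructor
  · rintro ⟨q, hq, rfl⟩
    obtain ⟨q', hq', rfl⟩ := mem_pullbackRing.1 hq
    exact ⟨q', hq', rfl⟩
  · rintro ⟨q, hq, rfl⟩
    exact ⟨fun x => q x, mem_pullbackRing.2 ⟨q, hq, rfl⟩, rfl⟩

theorem pullbackRing_evalGL_le (v : V) :
    pullbackRing (evalGL ρ F v) ≤ autRing ρ (pullback V F) := by
  rw [autRing_eq_adjoin]
  exact fun f hf => Algebra.subset_adjoin (Set.mem_iUnion.2 ⟨v, hf⟩)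

theorem evalGL_entry_mem (v : V) (i j : Fin M) :
    (fun h => (evalGL ρ F v h).val i j) ∈ autRing ρ (pullback V F) :=
  pullbackRing_evalGL_le v (entry_mem_pullbackRing _ i j)

theorem evalGL_inv_entry_mem (v : V) (i j : Fin M) :
    (fun h => (evalGL ρ F v h)⁻¹.val i j) ∈ autRing ρ (pullback V F) :=
  pullbackRing_evalGL_le v (inv_entry_mem_pullbackRing _ i j)

theorem autRing_le {O : Subalgebra ℂ (Aut ρ (pullback V F) → ℂ)}
    (h1 : ∀ v i j, (fun h => (evalGL ρ F v h).val i j) ∈ O)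
    (h2 : ∀ v i j, (fun h => (evalGL ρ F v h)⁻¹.val i j) ∈ O) :
    autRing ρ (pullback V F) ≤ O := by
  rw [autRing_eq_adjoin, Algebra.adjoin_le_iff, Set.iUnion_subset_iff]
  intro v
  rw [SetLike.coe_subset_coe, pullbackRing_eq_adjoin, Algebra.adjoin_le_iff]
  rintro _ ⟨i, j, rfl | rfl⟩
  · exact h1 v i j
  · exact h2 v i j

variable (ρ F) in
/-- The matrix valued holomorphic maps on `V` which are equivariant under `G̃`. -/
def equivariantMaps : Submodule ℂ (V → Matrix (Fin M) (Fin M) ℂ) where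
  carrier := {f | (∀ i j, ContDiff ℂ ω fun v => f v i j) ∧
    ∀ (g : Gtilde k S) (v : V), f (ρ (cover k S g) v) * mat (F g) = mat (F g) * f v}
  zero_mem' := ⟨fun _ _ => contDiff_const, fun _ _ => by simp⟩
  add_mem' hf hg := ⟨fun i j => (hf.1 i j).add (hg.1 i j), fun g v => by
    rw [Pi.add_apply, Pi.add_apply, add_mul, mul_add, hf.2, hg.2]⟩
  smul_mem' c f hf := ⟨fun i j => contDiff_const.mul (hf.1 i j), fun g v => by
    rw [Pi.smul_apply, Pi.smul_apply, smul_mul_assoc, mul_smul_comm, hf.2]⟩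

/-- The matrix valued map underlying an automorphism. -/
def toEquivariantMap (h : Aut ρ (pullback V F)) : equivariantMaps ρ F :=
  ⟨fun v => mat ((h : V → H) v), h.2.1, fun g v => congrArg (fun x : H => mat x) (h.2.2 g v)⟩

theorem functional_mem_autRing [FiniteDimensional ℂ (equivariantMaps ρ F)]
    (l : equivariantMaps ρ F →ₗ[ℂ] ℂ) :
    (fun h => l (toEquivariantMap h)) ∈ autRing ρ (pullback V F) := by
  have := mem_span_eval _ l
  induction this using Submodule.span_induction with
  | mem l hl =>
    obtain ⟨⟨v, i, j⟩, rfl⟩ := hl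
    exact evalGL_entry_mem v i j
  | zero => exact Subalgebra.zero_mem _
  | add l l' _ _ hl hl' => exact Subalgebra.add_mem _ hl hl'
  | smul c l _ hl => exact Subalgebra.smul_mem _ hl c

theorem inv_mem_autRing {f : Aut ρ (pullback V F) → ℂ} (hf : f ∈ autRing ρ (pullback V F)) :
    (fun h => f h⁻¹) ∈ autRing ρ (pullback V F) := by
  let O : Subalgebra ℂ (Aut ρ (pullback V F) → ℂ) :=
    (autRing ρ (pullback V F)).comap
      (AlgHom.pi (fun h : Aut ρ (pullback V F) => Pi.evalAlgHom ℂ (fun _ => ℂ) h⁻¹))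
  have : autRing ρ (pullback V F) ≤ O := by
    refine autRing_le (fun v i j => ?_) fun v i j => ?_
    · change (fun h => (evalGL ρ F v h⁻¹).val i j) ∈ autRing ρ (pullback V F)
      simp only [map_inv]
      exact evalGL_inv_entry_mem v i j
    · change (fun h => (evalGL ρ F v h⁻¹)⁻¹.val i j) ∈ autRing ρ (pullback V F)
      simp only [map_inv, inv_inv]
      exact evalGL_entry_mem v i j
  exact this hf

theorem mul_mem_autRing {f : Aut ρ (pullback V F) → ℂ} (hf : f ∈ autRing ρ (pullback V F)) :
    (fun p : Aut ρ (pullback V F) × Aut ρ (pullback V F) => f (p.1 * p.2)) ∈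
      Algebra.adjoin ℂ {u : Aut ρ (pullback V F) × Aut ρ (pullback V F) → ℂ |
        ∃ q ∈ autRing ρ (pullback V F), u = (fun p => q p.1) ∨ u = (fun p => q p.2)} := by
  set P := Algebra.adjoin ℂ {u : Aut ρ (pullback V F) × Aut ρ (pullback V F) → ℂ |
        ∃ q ∈ autRing ρ (pullback V F), u = (fun p => q p.1) ∨ u = (fun p => q p.2)} with hP
  have hP1 : ∀ q ∈ autRing ρ (pullback V F), (fun p : _ × Aut ρ (pullback V F) => q p.1) ∈ P :=
    fun q hq => Algebra.subset_adjoin ⟨q, hq, Or.inl rfl⟩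
  have hP2 : ∀ q ∈ autRing ρ (pullback V F), (fun p : Aut ρ (pullback V F) × _ => q p.2) ∈ P :=
    fun q hq => Algebra.subset_adjoin ⟨q, hq, Or.inr rfl⟩
  let O : Subalgebra ℂ (Aut ρ (pullback V F) → ℂ) :=
    P.comap (AlgHom.pi (fun p : Aut ρ (pullback V F) × Aut ρ (pullback V F) =>
      Pi.evalAlgHom ℂ (fun _ => ℂ) (p.1 * p.2)))
  have : autRing ρ (pullback V F) ≤ O := by
    refine autRing_le (fun v i j => ?_) fun v i j => ?_
    · change (fun p : Aut ρ (pullback V F) × Aut ρ (pullback V F) =>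
        (evalGL ρ F v (p.1 * p.2)).val i j) ∈ P
      simp only [map_mul, Units.val_mul]
      exact polynomial_mem_of_entries (fun i j => hP1 _ (evalGL_entry_mem v i j))
        (fun i j => hP2 _ (evalGL_entry_mem v i j)) i j
    · change (fun p : Aut ρ (pullback V F) × Aut ρ (pullback V F) =>
        (evalGL ρ F v (p.1 * p.2))⁻¹.val i j) ∈ P
      simp only [map_mul, _root_.mul_inv_rev, Units.val_mul]
      exact polynomial_mem_of_entries (fun i j => hP2 _ (evalGL_inv_entry_mem v i j))
        (fun i j => hP1 _ (evalGL_inv_entry_mem v i j)) i j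
  exact this hf

/-- The coordinates of `h` and of `h⁻¹` in a basis of the equivariant maps generate, since each
evaluated entry is a linear combination of them. -/
theorem fg_autRing [FiniteDimensional ℂ (equivariantMaps ρ F)] :
    (autRing ρ (pullback V F)).FG := by
  let b := Module.finBasis ℂ (equivariantMaps ρ F)
  let s : Set (Aut ρ (pullback V F) → ℂ) :=
    Set.range (fun i => fun h => b.coord i (toEquivariantMap h)) ∪
    Set.range (fun i => fun h => b.coord i (toEquivariantMap h⁻¹))
  have hs : s.Finite := (Set.finite_range _).union (Set.finite_range _)
  refine Subalgebra.fg_def.2 ⟨s, hs, le_antisymm ?_ ?_⟩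
  · rw [Algebra.adjoin_le_iff]
    rintro _ (⟨i, rfl⟩ | ⟨i, rfl⟩)
    · exact functional_mem_autRing _
    · exact inv_mem_autRing (functional_mem_autRing (b.coord i))
  · have key : ∀ (f : equivariantMaps ρ F) v i j,
        f.1 v i j = ∑ c, b.coord c f * (b c).1 v i j := by
      intro f v i j
      have h1 := congrArg (fun y : equivariantMaps ρ F => y.1 v i j) (b.sum_repr f)
      simp only [Submodule.coe_sum, Submodule.coe_smul, Finset.sum_apply, Pi.smul_apply,
        Matrix.sum_apply, Matrix.smul_apply, smul_eq_mul] at h1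
      exact h1.symm
    refine autRing_le (fun v i j => ?_) fun v i j => ?_
    · have : (fun h => (evalGL ρ F v h).val i j) =
          ∑ c, (b c).1 v i j • fun h => b.coord c (toEquivariantMap h) := by
        funext h
        refine (key (toEquivariantMap h) v i j).trans ?_
        simp [mul_comm]
      have hmem : ∀ c, (fun h => b.coord c (toEquivariantMap h)) ∈ Algebra.adjoin ℂ s := fun c =>
        Algebra.subset_adjoin (Set.mem_union_left _ ⟨c, rfl⟩)
      rw [this]
      exact Subalgebra.sum_mem _ fun c _ => Subalgebra.smul_mem _ (hmem c) _
    · have : (fun h => (evalGL ρ F v h)⁻¹.val i j) =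
          ∑ c, (b c).1 v i j • fun h => b.coord c (toEquivariantMap h⁻¹) := by
        funext h
        rw [← map_inv]
        refine (key (toEquivariantMap h⁻¹) v i j).trans ?_
        simp [mul_comm]
      have hmem : ∀ c, (fun h => b.coord c (toEquivariantMap h⁻¹)) ∈ Algebra.adjoin ℂ s := fun c =>
        Algebra.subset_adjoin (Set.mem_union_right _ ⟨c, rfl⟩)
      rw [this]
      exact Subalgebra.sum_mem _ fun c _ => Subalgebra.smul_mem _ (hmem c) _

end

end HomogeneousRep

end

/-! ### The affine algebraic group structure on `Aut(p^*F)` -/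

section

namespace HomogeneousRep

open Matrix NormedSpace

variable {k M : ℕ} {S : Type*} [Group S] {H : Subgroup (GeneralLinearGroup (Fin M) ℂ)}
  {V : Type*} [NormedAddCommGroup V] [NormedSpace ℂ V]
  {ρ : Representation ℂ ((Fin k → ℂˣ) × S) V} {F : Gtilde k S →* H}

theorem finiteDimensional_equivariantMaps [FiniteDimensional ℂ V] (hpos : IsPositive ρ) :
    FiniteDimensional ℂ (equivariantMaps ρ F) := by
  obtain ⟨a, ha⟩ := hpos
  -- At time `-1` every positive weight space is contracted by a factor at most `e⁻¹`.
  let g := oneParam S a (-1)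
  have hiter : ∀ (n : ℕ) v, (fun v => ρ (cover k S g) v)^[n] v =
      ρ (cover k S (oneParam S a (-n))) v := by
    intro n v
    induction n with
    | zero =>
      rw [Function.iterate_zero_apply, Nat.cast_zero, neg_zero, oneParam_zero, map_one, map_one]
      rfl
    | succ n ih =>
      rw [Function.iterate_succ_apply', ih, Nat.cast_succ, neg_add_rev, oneParam_add, map_mul,
        map_mul]
      rfl
  refine finiteDimensional_of_contracting (fun v => ρ (cover k S g) v)
    (r := Real.exp (-1)) (Real.exp_pos _) (by simp) (fun v => ?_)
    (F g : GeneralLinearGroup (Fin M) ℂ) (equivariantMaps ρ F) (fun f hf => hf.1)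
    fun f hf v => ?_
  · obtain ⟨c, -, -, hct, C, hC⟩ := exists_scaling ha v
    refine ⟨C, fun n => ?_⟩
    have hnorm : ‖Complex.exp (-n)‖ = Real.exp (-1) ^ n := by
      rw [Complex.norm_exp, ← Real.exp_nat_mul]
      simp
    rw [hiter, hct, ← hnorm]
    refine hC _ ?_
    rw [hnorm]
    exact pow_le_one₀ (Real.exp_pos _).le (by simp)
  · have h1 := hf.2 g v
    have h2 : mat (F g) * (F g : GeneralLinearGroup (Fin M) ℂ)⁻¹.val = 1 := Units.mul_inv _
    have h3 : f (ρ (cover k S g) v) = f (ρ (cover k S g) v) * mat (F g) *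
        (F g : GeneralLinearGroup (Fin M) ℂ)⁻¹.val := by
      rw [mul_assoc, h2, mul_one]
    rw [h3, h1]
    rfl

/-- A character applied to the entries of `h ↦ h(v)`, for each `v`, defines a map `y` on `V`. Linear
identities in the ring make `y` equivariant, closedness of `H` gives it values in `H`, and finite
dimensionality makes it holomorphic. -/
theorem isAffineAlgebraicGroup_autRing [FiniteDimensional ℂ (equivariantMaps ρ F)]
    (hH : IsClosed[zariski (glRing M)] (H : Set (GeneralLinearGroup (Fin M) ℂ))) :
    IsAffineAlgebraicGroup (autRing ρ (pullback V F)) where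
  fg := fg_autRing
  mul_regular _ hf := mul_mem_autRing hf
  inv_regular _ hf := inv_mem_autRing hf
  bijective_eval := by
    constructor
    · intro h h' heq
      refine Aut.ext_of_evalGL fun v => Units.ext ?_
      ext i j
      exact DFunLike.congr_fun heq ⟨_, evalGL_entry_mem v i j⟩
    · intro χ
      let e : V → Matrix (Fin M) (Fin M) (autRing ρ (pullback V F)) := fun v =>
        Matrix.of fun i j => ⟨_, evalGL_entry_mem v i j⟩
      let e' : V → Matrix (Fin M) (Fin M) (autRing ρ (pullback V F)) := fun v =>
        Matrix.of fun i j => ⟨_, evalGL_inv_entry_mem v i j⟩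
      have hee' : ∀ v, e v * e' v = 1 := by
        intro v
        ext i j h
        have h1 : (evalGL ρ F v h).val * (evalGL ρ F v h)⁻¹.val = 1 := Units.mul_inv _
        have h2 := congrFun (congrFun h1 i) j
        rw [Matrix.mul_apply] at h2
        rw [Matrix.mul_apply, AddSubmonoidClass.coe_finsetSum, Finset.sum_apply]
        refine Eq.trans h2 ?_
        rw [Matrix.one_apply, Matrix.one_apply]
        split_ifs <;> rfl
      have he'e : ∀ v, e' v * e v = 1 := fun v => mul_eq_one_comm.1 (hee' v)
      let x : V → GeneralLinearGroup (Fin M) ℂ := fun v =>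
        ⟨(e v).map χ, (e' v).map χ, by
          rw [← Matrix.map_mul, hee', Matrix.map_one _ (map_zero χ) (map_one χ)], by
          rw [← Matrix.map_mul, he'e, Matrix.map_one _ (map_zero χ) (map_one χ)]⟩
      have hxH : ∀ v, x v ∈ H := by
        intro v
        by_contra hx
        obtain ⟨q, hq, hqx, hqH⟩ := (isClosed_zariski_iff (glRing M) H).1 hH (x v) hx
        -- Adjoining `χ` as one extra point to the automorphisms yields a single ring element that
        -- computes `q` at both: it vanishes at all automorphisms, hence is zero, hence is killed by
        -- `χ`.
        let ev : Option (Aut ρ (pullback V F)) → autRing ρ (pullback V F) →ₐ[ℂ] ℂ := fun o =>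
          o.elim χ fun h => (Pi.evalAlgHom ℂ (fun _ => ℂ) h).comp (autRing ρ (pullback V F)).val
        let pt : Option (Aut ρ (pullback V F)) → GeneralLinearGroup (Fin M) ℂ := fun o =>
          o.elim (x v) fun h => evalGL ρ F v h
        obtain ⟨r, hr⟩ := exists_eval_eq ev pt (e v) (e' v)
          (by rintro (_ | h) i j <;> rfl) (by rintro (_ | h) i j <;> rfl) hq
        have hr0 : r = 0 := by
          refine Subtype.ext (funext fun h => ?_)
          exact (hr (some h)).symm.trans (hqH _ (evalGL_mem v h))
        apply hqx
        have := hr none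
        rw [hr0, map_zero] at this
        exact this
      let y : V → H := fun v => ⟨x v, hxH v⟩
      have hy : ∀ v i j, mat (y v) i j = χ (e v i j) := fun v i j => rfl
      have hhol : IsHolomorphic y := by
        intro i j
        let b := Module.finBasis ℂ (equivariantMaps ρ F)
        -- The entry at `v` is a fixed finite combination of coordinate functions with coefficients
        -- holomorphic in `v`, so applying `χ` preserves holomorphy.
        have h1 : ∀ v, e v i j =
            ∑ c, (b c).1 v i j • (⟨_, functional_mem_autRing (b.coord c)⟩ :
              autRing ρ (pullback V F)) := by
          intro v
          refine Subtype.ext (funext fun h => ?_)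
          have h2 := congrArg (fun y : equivariantMaps ρ F => y.1 v i j)
            (b.sum_repr (toEquivariantMap h))
          simp only [Submodule.coe_sum, Submodule.coe_smul, Finset.sum_apply, Pi.smul_apply,
            Matrix.sum_apply, Matrix.smul_apply, smul_eq_mul] at h2
          rw [AddSubmonoidClass.coe_finsetSum, Finset.sum_apply]
          refine Eq.trans h2.symm (Finset.sum_congr rfl fun c _ => ?_)
          exact mul_comm _ _
        simp only [hy, h1, map_sum, map_smul, smul_eq_mul]
        exact ContDiff.sum fun c _ => ((b c).2.1 i j).mul contDiff_const
      have hequiv : ∀ (g : Gtilde k S) (v : V),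
          y (ρ (cover k S g) v) * pullback V F (g, v) = pullback V F (g, v) * y v := by
        intro g v
        refine Subtype.ext (Units.ext ?_)
        change mat (y (ρ (cover k S g) v)) * mat (F g) = mat (F g) * mat (y v)
        ext i j
        have h1 : ∑ l, mat (F g) l j • e (ρ (cover k S g) v) i l =
            ∑ l, mat (F g) i l • e v l j := by
          refine Subtype.ext (funext fun h => ?_)
          have h2 := congrFun (congrFun ((toEquivariantMap h).2.2 g v) i) j
          rw [Matrix.mul_apply, Matrix.mul_apply] at h2
          rw [AddSubmonoidClass.coe_finsetSum, Finset.sum_apply,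
            AddSubmonoidClass.coe_finsetSum, Finset.sum_apply]
          refine Eq.trans (Finset.sum_congr rfl fun l _ => ?_) h2
          exact mul_comm _ _
        have h3 := congrArg χ h1
        simp only [map_sum, map_smul, smul_eq_mul, ← hy] at h3
        rw [Matrix.mul_apply, Matrix.mul_apply, ← h3]
        exact Finset.sum_congr rfl fun l _ => mul_comm _ _
      let h₀ : Aut ρ (pullback V F) := ⟨y, hhol, hequiv⟩
      refine ⟨h₀, ?_⟩
      let ev₀ : autRing ρ (pullback V F) →ₐ[ℂ] ℂ :=
        (Pi.evalAlgHom ℂ (fun _ => ℂ) h₀).comp (autRing ρ (pullback V F)).val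
      have hmain : autRing ρ (pullback V F) ≤
          (AlgHom.equalizer ev₀ χ).map (autRing ρ (pullback V F)).val := by
        refine autRing_le (fun v i j => ?_) fun v i j => ?_
        · exact ⟨e v i j, rfl, rfl⟩
        · exact ⟨e' v i j, rfl, rfl⟩
      refine AlgHom.ext fun f => ?_
      obtain ⟨f', hf', hff'⟩ := hmain f.2
      have : f' = f := Subtype.ext hff'
      rw [← this]
      exact hf'

end HomogeneousRep

end

section

/-! ### The Levi decomposition of `Aut(p^*F)` -/

namespace HomogeneousRep

open Matrix

variable {k M : ℕ} {S : Type*} [Group S] {H : Subgroup (GeneralLinearGroup (Fin M) ℂ)}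
  {V : Type*} [NormedAddCommGroup V] [NormedSpace ℂ V]
  {ρ : Representation ℂ ((Fin k → ℂˣ) × S) V} {F : Gtilde k S →* H}

theorem mem_Aut₀_iff {h : Aut ρ (pullback V F)} : h ∈ Aut₀ ρ F ↔ (h : V → H) 0 = 1 := by
  rw [Aut₀, MonoidHom.mem_ker, Subtype.ext_iff]
  rfl

theorem isClosed_Aut₀ :
    IsClosed[zariski (autRing ρ (pullback V F))] (Aut₀ ρ F : Set (Aut ρ (pullback V F))) := by
  refine isClosed_zariski_of_forall (ι := Fin M × Fin M) _ _
    (fun p h => (evalGL ρ F 0 h).val p.1 p.2 - (1 : Matrix (Fin M) (Fin M) ℂ) p.1 p.2)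
    (fun p => Subalgebra.sub_mem _ (evalGL_entry_mem 0 _ _)
      (Subalgebra.algebraMap_mem _ ((1 : Matrix (Fin M) (Fin M) ℂ) p.1 p.2))) fun h => ?_
  rw [SetLike.mem_coe, mem_Aut₀_iff, Subtype.ext_iff, Units.ext_iff, ← Matrix.ext_iff]
  simp only [sub_eq_zero, Prod.forall]
  rfl

theorem continuous_mat (h : Aut ρ (pullback V F)) : Continuous fun v => (evalGL ρ F v h).val :=
  continuous_matrix fun i j => (h.2.1 i j).continuous

theorem continuous_mat_inv (h : Aut ρ (pullback V F)) :
    Continuous fun v => (evalGL ρ F v h)⁻¹.val :=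
  continuous_matrix fun i j => (h⁻¹.2.1 i j).continuous

theorem charpoly_conj (P : GeneralLinearGroup (Fin M) ℂ) (A : Matrix (Fin M) (Fin M) ℂ) :
    (P.val * A * P⁻¹.val).charpoly = A.charpoly := by
  rw [Matrix.charpoly_mul_comm, ← mul_assoc, Units.inv_mul, one_mul]

theorem isNilpotent_sub_one_of_charpoly_eq {A : Matrix (Fin M) (Fin M) ℂ}
    (hA : A.charpoly = (1 : Matrix (Fin M) (Fin M) ℂ).charpoly) : IsNilpotent (A - 1) := by
  have h := Matrix.aeval_self_charpoly A
  rw [hA, Matrix.charpoly_one] at h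
  refine ⟨M, ?_⟩
  simpa using h

/-- Equivariance conjugates `h` along the orbit of `v`, so the characteristic polynomial is constant
there. The orbit tends to `0`, where `h` is the identity. -/
theorem isNilpotent_of_mem_Aut₀ {a : Fin k → ℤ}
    (ha : ⨆ n : {n : ℤ // 0 < n}, weightSpace ρ a n = ⊤) {h : Aut ρ (pullback V F)}
    (hh : h ∈ Aut₀ ρ F) (v : V) : IsNilpotent ((evalGL ρ F v h).val - 1) := by
  obtain ⟨c, hc, hc0, hct, -⟩ := exists_scaling ha v
  have hchar : ∀ t : ℂ, (evalGL ρ F (c (Complex.exp t)) h).val.charpoly =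
      (evalGL ρ F v h).val.charpoly := by
    intro t
    have h1 := Aut.apply_smul h (oneParam S a t) v
    rw [hct] at h1
    have h2 : evalGL ρ F (c (Complex.exp t)) h =
        (F (oneParam S a t) : GeneralLinearGroup (Fin M) ℂ) * evalGL ρ F v h *
          (F (oneParam S a t) : GeneralLinearGroup (Fin M) ℂ)⁻¹ :=
      congrArg (fun x : H => (x : GeneralLinearGroup (Fin M) ℂ)) h1
    rw [h2, Units.val_mul, Units.val_mul, charpoly_conj]
  have hpoly : (evalGL ρ F v h).val.charpoly = (1 : Matrix (Fin M) (Fin M) ℂ).charpoly := by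
    refine Polynomial.funext fun T => ?_
    have hcont : Continuous fun z : ℂ => (Matrix.scalar (Fin M) T -
        (evalGL ρ F (c z) h).val).det :=
      (continuous_const.sub ((continuous_mat h).comp hc)).matrix_det
    have hlim : Filter.Tendsto (fun n : ℕ => Complex.exp (-(n : ℂ))) Filter.atTop (𝓝 0) := by
      rw [tendsto_zero_iff_norm_tendsto_zero]
      have : ∀ n : ℕ, ‖Complex.exp (-(n : ℂ))‖ = Real.exp (-(n : ℝ)) := fun n => by
        rw [Complex.norm_exp]
        simp
      simp only [this]
      exact Real.tendsto_exp_neg_atTop_nhds_zero.comp tendsto_natCast_atTop_atTop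
    have h3 := (hcont.tendsto 0).comp hlim
    have h4 : evalGL ρ F (c 0) h = 1 := by
      rw [hc0]
      exact congrArg Subtype.val (mem_Aut₀_iff.1 hh)
    simp only [h4, Units.val_one] at h3
    have h5 : ∀ n : ℕ, ((fun z : ℂ => (Matrix.scalar (Fin M) T -
        (evalGL ρ F (c z) h).val).det) ∘ fun n : ℕ => Complex.exp (-(n : ℂ))) n =
        (evalGL ρ F v h).val.charpoly.eval T := by
      intro n
      rw [← hchar (-(n : ℂ)), Matrix.eval_charpoly]
      rfl
    rw [Matrix.eval_charpoly (1 : Matrix (Fin M) (Fin M) ℂ)]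
    exact tendsto_nhds_unique (tendsto_const_nhds.congr fun n => (h5 n).symm) h3
  exact isNilpotent_sub_one_of_charpoly_eq hpoly

theorem isUnipotentElement_of_mem_Aut₀ {a : Fin k → ℤ}
    (ha : ⨆ n : {n : ℤ // 0 < n}, weightSpace ρ a n = ⊤) {h : Aut ρ (pullback V F)}
    (hh : h ∈ Aut₀ ρ F) : IsUnipotentElement (autRing ρ (pullback V F)) h := by
  rw [autRing_eq_adjoin]
  refine isUnipotentElement_adjoin _ _ fun f hf => ?_
  obtain ⟨v, hv⟩ := Set.mem_iUnion.1 hf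
  exact (isUnipotentElement_pullbackRing_iff _ _).2 (isNilpotent_of_mem_Aut₀ ha hh v) f hv

/-- The automorphism `v ↦ h(t · v)`, where `t` acts through a one-parameter subgroup. -/
noncomputable def Aut.rescale [FiniteDimensional ℂ V] (a : Fin k → ℤ) (h : Aut ρ (pullback V F))
    (t : ℂ) : Aut ρ (pullback V F) :=
  ⟨fun v => (h : V → H) (ρ (cover k S (oneParam S a t)) v), fun i j =>
    (h.2.1 i j).comp
      (LinearMap.toContinuousLinearMap (ρ (cover k S (oneParam S a t)))).contDiff, fun g v => by
    have h1 : ρ (cover k S (oneParam S a t)) (ρ (cover k S g) v) =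
        ρ (cover k S g) (ρ (cover k S (oneParam S a t)) v) := by
      rw [← Module.End.mul_apply, ← Module.End.mul_apply, ← map_mul, ← map_mul, ← map_mul,
        ← map_mul, oneParam_mul_comm]
    change (h : V → H) (ρ (cover k S (oneParam S a t)) (ρ (cover k S g) v)) * F g = _
    rw [h1]
    exact h.2.2 g _⟩

theorem Aut.rescale_apply [FiniteDimensional ℂ V] (a : Fin k → ℤ) (h : Aut ρ (pullback V F))
    (t : ℂ) (v : V) : (Aut.rescale a h t : V → H) v =
      (h : V → H) (ρ (cover k S (oneParam S a t)) v) := rfl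

theorem isConnected_Aut₀ [FiniteDimensional ℂ V] {a : Fin k → ℤ}
    (ha : ⨆ n : {n : ℤ // 0 < n}, weightSpace ρ a n = ⊤) :
    @IsConnected _ (zariski (autRing ρ (pullback V F)))
      (Aut₀ ρ F : Set (Aut ρ (pullback V F))) := by
  refine isConnected_zariski_of_paths _ _ fun h hh => ?_
  classical
  have h0 : (h : V → H) 0 = 1 := mem_Aut₀_iff.1 hh
  -- The branch of the logarithm is harmless, since the action depends only on `exp t = z`; the
  -- value at `0` is the limit because `h 0 = 1`.
  let γ : ℂ → Aut ρ (pullback V F) := fun z => if z = 0 then 1 else Aut.rescale a h (Complex.log z)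
  have hγ : ∀ v, ∃ c : ℂ → V, Continuous c ∧ ∀ z, evalGL ρ F v (γ z) = evalGL ρ F (c z) h := by
    intro v
    obtain ⟨c, hc, hc0, hct, -⟩ := exists_scaling ha v
    refine ⟨c, hc, fun z => ?_⟩
    by_cases hz : z = 0
    · simp only [γ, hz, if_true, hc0, map_one]
      exact (congrArg Subtype.val h0).symm
    · simp only [γ, hz, if_false]
      have : c z = ρ (cover k S (oneParam S a (Complex.log z))) v := by
        rw [hct, Complex.exp_log hz]
      rw [this]
      rfl
  refine ⟨γ, fun z => ?_, if_pos rfl, ?_, fun f hf => ?_⟩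
  · by_cases hz : z = 0
    · simp only [γ, hz, if_true]
      exact one_mem _
    · simp only [γ, hz, if_false]
      rw [mem_Aut₀_iff, Aut.rescale_apply, map_zero, h0]
  · simp only [γ, one_ne_zero, if_false, Complex.log_one]
    refine Subtype.ext (funext fun v => ?_)
    rw [Aut.rescale_apply, oneParam_zero, map_one, map_one]
    rfl
  · let O : Subalgebra ℂ (Aut ρ (pullback V F) → ℂ) :=
      { carrier := {f | Continuous fun z => f (γ z)}
        mul_mem' := fun hf hg => hf.mul hg
        add_mem' := fun hf hg => hf.add hg
        algebraMap_mem' := fun r => continuous_const }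
    have hle : autRing ρ (pullback V F) ≤ O := by
      refine autRing_le (fun v i j => ?_) fun v i j => ?_
      · obtain ⟨c, hc, hcγ⟩ := hγ v
        change Continuous fun z => (evalGL ρ F v (γ z)).val i j
        simp only [hcγ]
        exact ((continuous_mat h).comp hc).matrix_elem i j
      · obtain ⟨c, hc, hcγ⟩ := hγ v
        change Continuous fun z => (evalGL ρ F v (γ z))⁻¹.val i j
        simp only [hcγ]
        exact ((continuous_mat_inv h).comp hc).matrix_elem i j
    exact hle hf

theorem evalZero_surjective : Function.Surjective (evalZero ρ F) := fun x =>
  ⟨constant ρ F x, rfl⟩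

theorem restrict_restrict_eq : restrict (restrict (glRing M) H) (AutF F) =
    pullbackRing (H.subtype.comp (AutF F).subtype) := by
  rw [restrict_glRing, restrict_pullbackRing]

theorem isAlgebraicHom_evalZero : IsAlgebraicHom (autRing ρ (pullback V F))
    (restrict (restrict (glRing M) H) (AutF F)) (evalZero ρ F) := by
  intro q hq
  rw [restrict_restrict_eq, mem_pullbackRing] at hq
  obtain ⟨q', hq', rfl⟩ := hq
  exact pullbackRing_evalGL_le 0 (mem_pullbackRing.2 ⟨q', hq', rfl⟩)

theorem isAlgebraicHom_constant : IsAlgebraicHom (restrict (restrict (glRing M) H) (AutF F))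
    (autRing ρ (pullback V F)) (constant ρ F) := by
  intro q hq
  rw [restrict_restrict_eq]
  let O : Subalgebra ℂ (Aut ρ (pullback V F) → ℂ) :=
    (pullbackRing (H.subtype.comp (AutF F).subtype)).comap
      (AlgHom.pi (fun x : AutF F => Pi.evalAlgHom ℂ (fun _ => ℂ) (constant ρ F x)))
  have hle : autRing ρ (pullback V F) ≤ O :=
    autRing_le (fun v i j => entry_mem_pullbackRing (H.subtype.comp (AutF F).subtype) i j)
      fun v i j => inv_entry_mem_pullbackRing (H.subtype.comp (AutF F).subtype) i j
  exact hle hq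

theorem mem_range_constant_iff {h : Aut ρ (pullback V F)} :
    h ∈ (constant ρ F).range ↔ ∀ v, (h : V → H) v = (h : V → H) 0 := by
  constructor
  · rintro ⟨x, rfl⟩ v
    rfl
  · intro hh
    exact ⟨evalZero ρ F h, Subtype.ext (funext fun v => (hh v).symm)⟩

theorem isClosed_range_constant : IsClosed[zariski (autRing ρ (pullback V F))]
    ((constant ρ F).range : Set (Aut ρ (pullback V F))) := by
  refine isClosed_zariski_of_forall (ι := V × Fin M × Fin M) _ _
    (fun p h => (evalGL ρ F p.1 h).val p.2.1 p.2.2 - (evalGL ρ F 0 h).val p.2.1 p.2.2)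
    (fun p => Subalgebra.sub_mem _ (evalGL_entry_mem _ _ _) (evalGL_entry_mem _ _ _)) fun h => ?_
  rw [SetLike.mem_coe, mem_range_constant_iff]
  simp only [Subtype.ext_iff, Units.ext_iff, ← Matrix.ext_iff, sub_eq_zero, Prod.forall]
  rfl

theorem isComplement_Aut₀ : Subgroup.IsComplement' (Aut₀ ρ F) (constant ρ F).range := by
  refine Subgroup.isComplement'_of_disjoint_and_mul_eq_univ ?_ ?_
  · rw [Subgroup.disjoint_def]
    intro h hh hc
    refine Subtype.ext (funext fun v => ?_)
    rw [mem_range_constant_iff.1 hc v, mem_Aut₀_iff.1 hh]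
    rfl
  · refine Set.eq_univ_of_forall fun h => ?_
    refine ⟨h * (constant ρ F (evalZero ρ F h))⁻¹, ?_, constant ρ F (evalZero ρ F h), ⟨_, rfl⟩,
      inv_mul_cancel_right _ _⟩
    rw [SetLike.mem_coe, Aut₀, MonoidHom.mem_ker, map_mul, map_inv]
    exact mul_inv_cancel _

/-- On constant maps all evaluations agree with the one at `0`, so the Levi factor carries the
coordinate ring of a closed linear group. -/
theorem restrict_autRing_range : restrict (autRing ρ (pullback V F)) (constant ρ F).range =
    pullbackRing ((evalGL ρ F 0).comp (constant ρ F).range.subtype) := by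
  rw [← restrict_pullbackRing]
  apply le_antisymm
  · rintro _ ⟨f, hf, rfl⟩
    let O : Subalgebra ℂ (Aut ρ (pullback V F) → ℂ) :=
      (restrict (pullbackRing (evalGL ρ F 0)) (constant ρ F).range).comap
        (AlgHom.pi (fun x : (constant ρ F).range => Pi.evalAlgHom ℂ (fun _ => ℂ)
          (x : Aut ρ (pullback V F))))
    have hval : ∀ v, (fun h : (constant ρ F).range => evalGL ρ F v (h : Aut ρ (pullback V F))) =
        fun h : (constant ρ F).range => evalGL ρ F 0 (h : Aut ρ (pullback V F)) := fun v =>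
      funext fun h : (constant ρ F).range => congrArg Subtype.val (mem_range_constant_iff.1 h.2 v)
    have hle : autRing ρ (pullback V F) ≤ O := by
      refine autRing_le (fun v i j => ?_) fun v i j => ?_
      · refine ⟨_, entry_mem_pullbackRing (evalGL ρ F 0) i j, funext fun h => ?_⟩
        exact congrArg (fun x : GeneralLinearGroup (Fin M) ℂ => x.val i j)
          (congrFun (hval v) h).symm
      · refine ⟨_, inv_entry_mem_pullbackRing (evalGL ρ F 0) i j, funext fun h => ?_⟩
        exact congrArg (fun x : GeneralLinearGroup (Fin M) ℂ => x⁻¹.val i j)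
          (congrFun (hval v) h).symm
    exact hle hf
  · exact Subalgebra.map_mono (pullbackRing_evalGL_le 0)

theorem range_evalGL_constant :
    ((evalGL ρ F 0).comp (constant ρ F).range.subtype).range = autFImage F := by
  ext x
  constructor
  · rintro ⟨⟨_, y, rfl⟩, rfl⟩
    exact ⟨y, y.2, rfl⟩
  · rintro ⟨y, hy, rfl⟩
    exact ⟨⟨_, ⟨y, hy⟩, rfl⟩, rfl⟩

theorem evalGL_constant_injective :
    Function.Injective ((evalGL ρ F 0).comp (constant ρ F).range.subtype) := by
  rintro ⟨_, y, rfl⟩ ⟨_, z, rfl⟩ h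
  have : y = z := Subtype.ext (Subtype.ext h)
  rw [this]

theorem subtype_comp_injective :
    Function.Injective (H.subtype.comp (AutF F).subtype) :=
  H.subtype_injective.comp (AutF F).subtype_injective

theorem range_subtype_comp : (H.subtype.comp (AutF F).subtype).range = autFImage F := by
  rw [MonoidHom.range_comp, Subgroup.range_subtype]
  rfl

/-- For maximality, evaluation at `0` sends a connected normal unipotent subgroup to one of the same
kind in `Aut(F)`, apart from closedness. Its Zariski closure keeps these properties, hence is
trivial by reductivity. -/
theorem isUnipotentRadical_Aut₀ [FiniteDimensional ℂ V] (hpos : IsPositive ρ)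
    (hred : IsReductive (restrict (restrict (glRing M) H) (AutF F))) :
    IsUnipotentRadical (autRing ρ (pullback V F)) (Aut₀ ρ F) where
  isConnectedNormalUnipotent := by
    obtain ⟨a, ha⟩ := hpos
    exact ⟨isClosed_Aut₀, isConnected_Aut₀ ha, MonoidHom.normal_ker _,
      fun g hg => isUnipotentElement_of_mem_Aut₀ ha hg⟩
  le_of_isConnectedNormalUnipotent N hN := by
    have hO := hred.isAffineAlgebraicGroup
    set K := N.map (evalZero ρ F) with hK
    -- The fixed exponent `M` expresses unipotence by polynomial equations, which persist on the
    -- closure.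
    have hKu : ∀ x ∈ K, ((x : H) : GeneralLinearGroup (Fin M) ℂ).val - 1 ∈
        {y : Matrix (Fin M) (Fin M) ℂ | y ^ M = 0} := by
      rintro _ ⟨h, hh, rfl⟩
      have h1 := (hN.unipotent h hh).map isAlgebraicHom_evalZero evalZero_surjective
      rw [restrict_restrict_eq, isUnipotentElement_pullbackRing_iff] at h1
      exact pow_eq_zero_of_isNilpotent h1
    have hconn : @IsConnected _ (zariski (restrict (restrict (glRing M) H) (AutF F)))
        (K : Set (AutF F)) := by
      rw [hK, Subgroup.coe_map]
      let _ := zariski (autRing ρ (pullback V F))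
      let _ := zariski (restrict (restrict (glRing M) H) (AutF F))
      exact hN.connected.image _ isAlgebraicHom_evalZero.continuous.continuousOn
    have hbot := hred.isUnipotentRadical_bot.le_of_isConnectedNormalUnipotent
      (closureSubgroup hO K)
      ⟨isClosed_closureSubgroup hO K, isConnected_closureSubgroup hO hconn,
        closureSubgroup_normal hO (hN.normal.map _ evalZero_surjective), fun x hx => by
        rw [restrict_restrict_eq, isUnipotentElement_pullbackRing_iff]
        refine ⟨M, ?_⟩
        ext i j
        have hent : ∀ i j, (fun x : AutF F =>
            (((x : H) : GeneralLinearGroup (Fin M) ℂ).val - 1) i j) ∈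
            restrict (restrict (glRing M) H) (AutF F) := by
          intro i j
          rw [restrict_restrict_eq]
          exact Subalgebra.sub_mem _
            (entry_mem_pullbackRing (H.subtype.comp (AutF F).subtype) i j)
            (Subalgebra.algebraMap_mem _ ((1 : Matrix (Fin M) (Fin M) ℂ) i j))
        exact (mem_closureSubgroup hO).1 hx _ (pow_entry_mem hent M i j) fun y hy =>
          congrFun (congrFun (hKu y hy) i) j⟩
    intro h hh
    have h1 : evalZero ρ F h ∈ (⊥ : Subgroup (AutF F)) :=
      hbot (le_closureSubgroup hO K ⟨h, hh, rfl⟩)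
    exact Subgroup.mem_bot.1 h1

end HomogeneousRep

end

theorem mainTheorem12
    {M : ℕ} (H : Subgroup (Matrix.GeneralLinearGroup (Fin M) ℂ))
    (hHclosed : IsClosed[zariski (glRing M)] (H : Set (Matrix.GeneralLinearGroup (Fin M) ℂ)))
    (hHconnected : @IsConnected _ (zariski (glRing M))
      (H : Set (Matrix.GeneralLinearGroup (Fin M) ℂ)))
    (hHreductive : IsReductive (restrict (glRing M) H))
    {k d : ℕ} {S : Type*} [TopologicalSpace S] [ChartedSpace (Fin d → ℂ) S] [Group S]
    [LieGroup 𝓘(ℂ, Fin d → ℂ) ω S] [SimplyConnectedSpace S]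
    (hS : LieAlgebra.IsSemisimple ℂ (GroupLieAlgebra 𝓘(ℂ, Fin d → ℂ) S))
    {V : Type*} [NormedAddCommGroup V] [NormedSpace ℂ V] [FiniteDimensional ℂ V]
    (ρ : Representation ℂ ((Fin k → ℂˣ) × S) V)
    (hρ : ∀ v : V, HolomorphicOnGtilde (d := d) (fun g : Gtilde k S => ρ (cover k S g) v))
    (hpos : IsPositive ρ)
    (F : Gtilde k S →* H)
    (hF : ∀ i j : Fin M, HolomorphicOnGtilde (d := d) (fun g : Gtilde k S => mat (F g) i j))
    (hFss : ∀ n : Fin k → ℤ, Module.End.IsSemisimple (Matrix.toLin' (mat (monodromy F n)))) :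
    -- the `S_i` are commuting and semisimple, and `Aut(F) = ⋂ C_H(S_i) ∩ C_H(F|_S)`
    (∀ i j : Fin k, Commute (residue F i) (residue F j)) ∧
    (∀ i : Fin k, Module.End.IsSemisimple (Matrix.toLin' (residue F i))) ∧
    (∀ x : H, x ∈ AutF F ↔
      (∀ i : Fin k, Commute (mat x) (residue F i)) ∧ ∀ s : S, Commute x (F (1, s))) ∧
    -- `Aut(F)` is a closed reductive subgroup of `H`
    IsClosed[zariski (restrict (glRing M) H)] (AutF F : Set H) ∧
    IsReductive (restrict (restrict (glRing M) H) (AutF F)) ∧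
    -- the sequence `1 → Aut_0 → Aut(p^*F) → Aut(F) → 1` is exact, split by `p^*`, and algebraic
    Function.Surjective (evalZero ρ F) ∧
    (evalZero ρ F).comp (constant ρ F) = MonoidHom.id (AutF F) ∧
    IsAlgebraicHom (autRing ρ (pullback V F)) (restrict (restrict (glRing M) H) (AutF F))
      (evalZero ρ F) ∧
    IsAlgebraicHom (restrict (restrict (glRing M) H) (AutF F)) (autRing ρ (pullback V F))
      (constant ρ F) ∧
    -- it is a Levi decomposition; in particular `Aut_0` is unipotent
    IsLeviDecomposition (autRing ρ (pullback V F)) (Aut₀ ρ F) (constant ρ F).range := by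
  have : FiniteDimensional ℂ (equivariantMaps ρ F) := finiteDimensional_equivariantMaps hpos
  have hred : IsReductive (restrict (restrict (glRing M) H) (AutF F)) := by
    rw [restrict_restrict_eq]
    exact isReductive_of_range_eq_autFImage hHclosed hHreductive hS hF hFss _
      subtype_comp_injective range_subtype_comp
  refine ⟨residue_commute hF, residue_isSemisimple hF hFss, fun x => ?_, isClosed_AutF, hred,
    evalZero_surjective, rfl, isAlgebraicHom_evalZero, isAlgebraicHom_constant,
    isAffineAlgebraicGroup_autRing hHclosed, isUnipotentRadical_Aut₀ hpos hred,
    isClosed_range_constant, ?_, isComplement_Aut₀⟩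
  · simp only [mem_AutF_iff, forall_commute_iff hF, commute_iff_commute_mat]
  · rw [restrict_autRing_range]
    exact isReductive_of_range_eq_autFImage hHclosed hHreductive hS hF hFss _
      evalGL_constant_injective range_evalGL_constant
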